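/- **Setting.** Let $n\ge 1$ and let $p_0\ge p_1\ge\dots\ge p_n\ge 1$ be integers, $N=p_0+\dots+p_n$, $Q=\sum_{i=0}^n(2i+1)p_i$. Write $x=(x^{(p_0)},\dots,x^{(p_n)})\in\mathbb R^{p_0}\times\dots\times\mathbb R^{p_n}=\mathbb R^N$ and $z=(x,t)\in\mathbb R^{N+1}$. Let $B\in\mathbb R^{N\times N}$ be the block matrix whose only non-zero blocks are the blocks $\mathbb B_j$ ($j=1,\dots,n$) of size $p_{j-1}\times p_j$ and rank $p_j$ on the first block superdiagonal. Put $E(\sigma)=\exp(-\sigma B^T)$, $(x,t)\circ(\xi,\tau)=(\xi+E(\tau)x,\,t+\tau)$, $|x|_B=\sum_{i=0}^n|x^{(p_i)}|^{1/(2i+1)}$, and $$\mathcal Q_r^{t_1,t_2}(z_0)=z_0\circ\big(\{|x|_B<r\}\times(t_1,t_2)\big).$$ Let $\sigma_0=\min_{|x|=1}|x|_B$, $\bar\sigma=\max_{|x|=1}|x|_B$, and fix $b_B$ with $0<b_B\le(\sigma_0/\bar\sigma)^2$ and $\|E(\sigma)\|\le 2$ for $|\sigma|\le b_B$ (Euclidean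 operator norm). For $K,r>0$ let $$\mathcal Q^1_r(z_0)=\mathcal Q_{Kr}^{-b_Br^2,0}(z_0),\quad \mathcal Q^2_r(z_0)=\mathcal Q_{\sigma_0r}^{-\frac14b_Br^2,0}(z_0),\quad \mathcal Q^3_r(z_0)=\mathcal Q_{\sigma_0r}^{-b_Br^2,-\frac12b_Br^2}(z_0).$$ Fix $\lambda,\Lambda>0$. For an open set $\Omega\subseteq\mathbb R^{N+1}$ consider $$\mathcal L_A=\mathrm{tr}(A(z)D_x^2)+\langle x,B\nabla_x\rangle-\partial_t,\qquad A(z)=\begin{bmatrix}\mathbb A(z)&0\\0&0\end{bmatrix},$$ where for every $z\in\Omega$ the $p_0\times p_0$ matrix $\mathbb A(z)$ is symmetric and $\lambda\mathbb I\le\mathbb A(z)\le\Lambda\mathbb I$. Let $\omega:[0,1)\to[0,1)$ be non-decreasing with $\lim_{s\to0^+}\omega(s)=\omega(0)=0$. Hypothesis (H2) with modulus $\omega$ says that $\|\mathbb A(z)-\mathbb A(z_0)\|\le\omega(\epsilon)$ for all $0<\epsilon<1$, $z_0\in\Omega$ and $z\in\Omega\cap\mathcal Q_\epsilon^{-\epsilon^2,\epsilon^2}(z_0)$.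 **Theorem (growth lemma under H2).** There is a constant $K_0\ge1$, $K_0>\sigma_0$, depending only on $n$, the $p_i$, $B$, $\lambda$, $\Lambda$, $b_B$, and for every $K>K_0$ a constant $\eta>0$ depending only on the same data and $K$, such that the following holds for every modulus $\omega$. There exist $\epsilon_0\in(0,1)$ with $\omega(\epsilon_0)\le\frac{s_0}{2+s_0}\lambda$, where $s_0=\frac1Q$; and for every such $\epsilon_0$, every $\Omega$ and $A$ as above satisfying (H2) with modulus $\omega$, every $z_0\in\Omega$, every $0<r\le\epsilon_0/K$ with $\mathcal Q^1_r(z_0)\subseteq\Omega$, every open $D\subseteq\mathcal Q^1_r(z_0)$ with $D\cap\mathcal Q^2_r(z_0)\ne\emptyset$, and every $u\in C^2(D)\cap C(\overline D)$ which is non-negative in $D$, vanishes on $\partial D\cap\mathcal Q^1_r(z_0)$ and satisfies $\mathcal L_Au\ge0$ in $D$, one has $$\sup_Du\ \ge\ \Big(1+\eta\,\frac{|\mathcal Q^3_r(z_0)\setminus D|}{|\mathcal Q^3_r(z_0)|}\Big)\sup_{D\cap\mathcal Q^2_r(z_0)}u,$$ where $|\cdot|$ is Lebesgue measure. -/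

import Mathlib

open Set Filter Topology MeasureTheory

noncomputable section

namespace Kolmogorov

/-- Coordinates of `ℝ^N = ℝ^{p 0} × ⋯ × ℝ^{p n}`: a block `i` and a position inside the block. -/
abbrev Idx {n : ℕ} (p : Fin (n + 1) → ℕ) : Type := Σ i : Fin (n + 1), Fin (p i)

/-- `ℝ^N`, `N = p 0 + ⋯ + p n`, with the Euclidean norm. -/
abbrev Space {n : ℕ} (p : Fin (n + 1) → ℕ) : Type := EuclideanSpace ℝ (Idx p)

/-- Points `z = (x, t)` of `ℝ^N × ℝ`. -/
abbrev Pt {n : ℕ} (p : Fin (n + 1) → ℕ) : Type := Space p × ℝ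

/-- The component `x^{(p_i)} ∈ ℝ^{p i}` of `x`. -/
def blk {n : ℕ} {p : Fin (n + 1) → ℕ} (x : Space p) (i : Fin (n + 1)) :
    EuclideanSpace ℝ (Fin (p i)) :=
  WithLp.toLp 2 (fun a => x ⟨i, a⟩)

/-- `Q = p 0 + 3 p 1 + ⋯ + (2n+1) p n`. -/
def homDim {n : ℕ} (p : Fin (n + 1) → ℕ) : ℕ := ∑ i : Fin (n + 1), (2 * (i : ℕ) + 1) * p i

/-- The homogeneous norm `|x|_B = ∑ i, |x^{(p_i)}|^{1/(2i+1)}`. -/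
def normB {n : ℕ} {p : Fin (n + 1) → ℕ} (x : Space p) : ℝ :=
  ∑ i : Fin (n + 1), ‖blk x i‖ ^ (1 / (2 * ((i : ℕ) : ℝ) + 1))

/-- `σ₀`, the minimum of `|x|_B` over the Euclidean unit sphere. -/
def sigmaMin {n : ℕ} (p : Fin (n + 1) → ℕ) : ℝ :=
  sInf (normB '' Metric.sphere (0 : Space p) 1)

/-- `σ̄`, the maximum of `|x|_B` over the Euclidean unit sphere. -/
def sigmaMax {n : ℕ} (p : Fin (n + 1) → ℕ) : ℝ :=
  sSup (normB '' Metric.sphere (0 : Space p) 1)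

/-- The Euclidean operator norm of a square matrix. -/
def opNorm {m : Type} [Fintype m] [DecidableEq m] (M : Matrix m m ℝ) : ℝ :=
  ‖Matrix.toEuclideanCLM (n := m) (𝕜 := ℝ) M‖

/-- `B` has the block form with blocks `𝔹_j` of size `p (j-1) × p j` and rank `p j` on the
first superdiagonal, and zeros elsewhere. -/
structure IsDrift {n : ℕ} {p : Fin (n + 1) → ℕ} (B : Matrix (Idx p) (Idx p) ℝ) : Prop where
  zero_off : ∀ k l : Idx p, (l.1 : ℕ) ≠ (k.1 : ℕ) + 1 → B k l = 0
  rank_block : ∀ j : Fin n,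
    (B.submatrix (fun a : Fin (p j.castSucc) => (⟨j.castSucc, a⟩ : Idx p))
      (fun b : Fin (p j.succ) => (⟨j.succ, b⟩ : Idx p))).rank = p j.succ

/-- `E(σ) = exp(-σ Bᵀ)`. -/
def expE {n : ℕ} {p : Fin (n + 1) → ℕ} (B : Matrix (Idx p) (Idx p) ℝ) (σ : ℝ) :
    Matrix (Idx p) (Idx p) ℝ :=
  NormedSpace.exp (-(σ • B.transpose))

/-- The group law `(x, t) ∘ (ξ, τ) = (ξ + E(τ) x, t + τ)`. -/
def comp {n : ℕ} {p : Fin (n + 1) → ℕ} (B : Matrix (Idx p) (Idx p) ℝ) (z ζ : Pt p) : Pt p :=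
  (ζ.1 + Matrix.toEuclideanCLM (n := Idx p) (𝕜 := ℝ) (expE B ζ.2) z.1, z.2 + ζ.2)

/-- The cylinder `𝒬_r^{t₁,t₂}(z₀) = z₀ ∘ (B_r(0) × (t₁, t₂))`. -/
def cyl {n : ℕ} {p : Fin (n + 1) → ℕ} (B : Matrix (Idx p) (Idx p) ℝ)
    (r t₁ t₂ : ℝ) (z₀ : Pt p) : Set (Pt p) :=
  comp B z₀ '' ({x : Space p | normB x < r} ×ˢ Ioo t₁ t₂)

/-- The conditions defining an admissible constant `b_B`. -/
structure IsTimeScale {n : ℕ} {p : Fin (n + 1) → ℕ} (B : Matrix (Idx p) (Idx p) ℝ)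
    (b : ℝ) : Prop where
  pos : 0 < b
  le : b ≤ (sigmaMin p / sigmaMax p) ^ 2
  exp_le : ∀ σ : ℝ, |σ| ≤ b → opNorm (expE B σ) ≤ 2

/-- `𝒬¹_r(z₀)`. -/
def cyl1 {n : ℕ} {p : Fin (n + 1) → ℕ} (B : Matrix (Idx p) (Idx p) ℝ)
    (b K r : ℝ) (z₀ : Pt p) : Set (Pt p) :=
  cyl B (K * r) (-(b * r ^ 2)) 0 z₀

/-- `𝒬²_r(z₀)`. -/
def cyl2 {n : ℕ} {p : Fin (n + 1) → ℕ} (B : Matrix (Idx p) (Idx p) ℝ)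
    (b r : ℝ) (z₀ : Pt p) : Set (Pt p) :=
  cyl B (sigmaMin p * r) (-(1 / 4 * b * r ^ 2)) 0 z₀

/-- `𝒬³_r(z₀)`. -/
def cyl3 {n : ℕ} {p : Fin (n + 1) → ℕ} (B : Matrix (Idx p) (Idx p) ℝ)
    (b r : ℝ) (z₀ : Pt p) : Set (Pt p) :=
  cyl B (sigmaMin p * r) (-(b * r ^ 2)) (-(1 / 2 * b * r ^ 2)) z₀

/-- The upper left `p 0 × p 0` block `𝔸` of an `N × N` matrix. -/
def topBlock {n : ℕ} {p : Fin (n + 1) → ℕ} (A : Matrix (Idx p) (Idx p) ℝ) :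
    Matrix (Fin (p 0)) (Fin (p 0)) ℝ :=
  A.submatrix (fun a => (⟨0, a⟩ : Idx p)) (fun a => (⟨0, a⟩ : Idx p))

/-- On `Ω`, the matrix `A(z)` vanishes outside its upper left block `𝔸(z)`, and `𝔸(z)` is
symmetric with `lam I ≤ 𝔸(z) ≤ Lam I` (`PosSemidef` includes symmetry). -/
structure IsCoefficient {n : ℕ} {p : Fin (n + 1) → ℕ} (Ω : Set (Pt p)) (lam Lam : ℝ)
    (A : Pt p → Matrix (Idx p) (Idx p) ℝ) : Prop where
  zero_off : ∀ z ∈ Ω, ∀ k l : Idx p, (k.1 ≠ 0 ∨ l.1 ≠ 0) → A z k l = 0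
  lower : ∀ z ∈ Ω, (topBlock (A z) - lam • (1 : Matrix (Fin (p 0)) (Fin (p 0)) ℝ)).PosSemidef
  upper : ∀ z ∈ Ω, (Lam • (1 : Matrix (Fin (p 0)) (Fin (p 0)) ℝ) - topBlock (A z)).PosSemidef

/-- `ω : [0,1) → [0,1)` is non-decreasing with `lim_{s → 0⁺} ω(s) = ω(0) = 0`. Values of `ω`
outside `[0,1)` are irrelevant. -/
structure IsModulus (ω : ℝ → ℝ) : Prop where
  mapsTo : MapsTo ω (Ico 0 1) (Ico 0 1)
  mono : MonotoneOn ω (Ico 0 1)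
  zero : ω 0 = 0
  tendsto : Tendsto ω (𝓝[>] 0) (𝓝 0)

/-- `A` admits the uniform modulus of continuity `ω` in `Ω`. -/
def HasModulus {n : ℕ} {p : Fin (n + 1) → ℕ} (B : Matrix (Idx p) (Idx p) ℝ) (Ω : Set (Pt p))
    (A : Pt p → Matrix (Idx p) (Idx p) ℝ) (ω : ℝ → ℝ) : Prop :=
  ∀ ε : ℝ, 0 < ε → ε < 1 → ∀ z₀ ∈ Ω, ∀ z ∈ Ω ∩ cyl B ε (-ε ^ 2) (ε ^ 2) z₀,
    opNorm (topBlock (A z) - topBlock (A z₀)) ≤ ω ε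

/-- `ε₀ ∈ (0,1)` is such that `ω(ε₀) ≤ s₀ / (2 + s₀) * lam` with `s₀ = 1/Q`. -/
structure IsScale (Q : ℕ) (lam : ℝ) (ω : ℝ → ℝ) (ε₀ : ℝ) : Prop where
  pos : 0 < ε₀
  lt_one : ε₀ < 1
  le : ω ε₀ ≤ (1 / (Q : ℝ)) / (2 + 1 / (Q : ℝ)) * lam

/-- The spatial Hessian `D²_x u (z)`. -/
def hess {n : ℕ} {p : Fin (n + 1) → ℕ} (u : Pt p → ℝ) (z : Pt p) : Matrix (Idx p) (Idx p) ℝ :=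
  Matrix.of fun k l =>
    fderiv ℝ (fun y => fderiv ℝ (fun x => u (x, z.2)) y (EuclideanSpace.single l 1)) z.1
      (EuclideanSpace.single k 1)

/-- `ℒ_A u = tr(A D²u) + ⟨x, B ∇u⟩ - ∂_t u`. -/
def opL {n : ℕ} {p : Fin (n + 1) → ℕ} (B : Matrix (Idx p) (Idx p) ℝ)
    (A : Pt p → Matrix (Idx p) (Idx p) ℝ) (u : Pt p → ℝ) (z : Pt p) : ℝ :=
  (A z * hess u z).trace
    + inner ℝ z.1 (Matrix.toEuclideanCLM (n := Idx p) (𝕜 := ℝ) B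
        (gradient (fun x => u (x, z.2)) z.1))
    - deriv (fun t => u (z.1, t)) z.2

end Kolmogorov

end

noncomputable section

namespace Kolmogorov

open Matrix

variable {n : ℕ} {p : Fin (n + 1) → ℕ}

/-! ### Powers of the drift matrix -/

/-! The proof is a Landis-type barrier argument. Freeze the coefficients at `z₀`. The explicit
covariance `gram B (A z₀)` solves a Lyapunov equation, and its inverse `M`, rescaled in time, is the
precision matrix of the frozen fundamental solution `s^{-Q/2} exp(-⟨M(s)y,y⟩/4)`. The constants
`1/4` and `Q/2` are replaced by `c = (1 + s₀/2)/4` and `a = (1 + s₀)Q/2 = (Q+1)/2`. This turns the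
kernel into a subsolution, away from its pole, of every operator whose coefficients lie within
`s₀/(2+s₀)·lam` of `A z₀` (`opL_poleKer_nonneg`). The bound on `ω ε₀` provides exactly this
closeness on `𝒬¹`.

For compact `H ⊆ 𝒬³ \ D` consider the potential `U = ∫_H poleKer(·, ζ) dζ`. Three bounds on the
kernel matter. (1) Its spatial integral is at most `J s^{-1/2}`, because `a` exceeds `Q/2` only by
`1/2`; hence `U ≤ C₂ ~ r` (`exists_lintegral_heatKer_le`). (2) For `z ∈ 𝒬²` and `ζ ∈ 𝒬³` the kernel
is at least `r^{-2a} e` (`le_poleKer`). (3) On the lateral boundary of `𝒬¹` it is at most half of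
that if `K` is large (`poleKer_lateral_le`).

Compare `u + qU`, where `q = sup u / (2 C₂)`, with `sup u + q · sup_lateral U` by the maximum
principle. Where `u` is small, `qU ≤ sup u` suffices; on the lateral side `u ≤ sup u`; at the bottom
`U` vanishes. At a point of `𝒬²` the potential is at least twice its lateral bound, and this
surplus, proportional to `|H|/|𝒬³|`, is the gain (`growth_of_isCompact`). Inner regularity replaces
`H` by `𝒬³ \ D`.

The potential is never differentiated: on `{u ≥ ε}`, which is disjoint from `H`, it is replaced by a
Riemann sum of kernels (`exists_riemann_sum`), and `comparison_finite_poles` applies the maximum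
principle to finitely many poles.

The constants are uniform because `M` has spectral bounds depending only on `B`, `lam`, `Lam`
(`exists_precision`), and dilations and the group law reduce every scale to `r = 1`. -/

theorem IsDrift.eq_add_one {B : Matrix (Idx p) (Idx p) ℝ} (hB : IsDrift B) {k l : Idx p}
    (h : B k l ≠ 0) : (l.1 : ℕ) = (k.1 : ℕ) + 1 := by
  by_contra hne
  exact h (hB.zero_off k l hne)

/-- A vector in the kernel of a matrix of full column rank vanishes. -/
theorem eq_zero_of_mulVec_eq_zero_of_rank {m l : ℕ} {M : Matrix (Fin m) (Fin l) ℝ}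
    (hM : M.rank = l) {v : Fin l → ℝ} (hv : M *ᵥ v = 0) : v = 0 := by
  have h := LinearMap.finrank_range_add_finrank_ker M.mulVecLin
  have h1 : Module.finrank ℝ (LinearMap.range M.mulVecLin) = l := hM
  rw [h1, Module.finrank_fintype_fun_eq_card, Fintype.card_fin] at h
  have h2 : LinearMap.ker M.mulVecLin = ⊥ := by
    apply Submodule.finrank_eq_zero.mp
    omega
  have h3 : v ∈ LinearMap.ker M.mulVecLin := by simpa using hv
  rw [h2] at h3
  simpa using h3

theorem IsDrift.eq_zero_of_mulVec_eq_zero {B : Matrix (Idx p) (Idx p) ℝ} (hB : IsDrift B)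
    {i : ℕ} {y : Idx p → ℝ} (hy : ∀ k : Idx p, (k.1 : ℕ) ≠ i + 1 → y k = 0)
    (h : B *ᵥ y = 0) : y = 0 := by
  by_cases hi : i < n
  · set j : Fin n := ⟨i, hi⟩ with hj
    have hz : (fun b : Fin (p j.succ) => y ⟨j.succ, b⟩) = 0 := by
      apply eq_zero_of_mulVec_eq_zero_of_rank (hB.rank_block j)
      funext a
      have h1 := congrFun h ⟨j.castSucc, a⟩
      simp only [Matrix.mulVec, dotProduct, Pi.zero_apply] at h1 ⊢
      rw [Fintype.sum_sigma, Finset.sum_eq_single j.succ] at h1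
      · simpa using h1
      · intro c _ hc
        apply Finset.sum_eq_zero
        intro b _
        rw [hy ⟨c, b⟩, mul_zero]
        intro h2
        exact hc (Fin.ext (by simpa [hj] using h2))
      · simp
    funext k
    by_cases hk : (k.1 : ℕ) = i + 1
    · obtain ⟨c, b⟩ := k
      have hc : c = j.succ := Fin.ext (by simpa [hj] using hk)
      subst hc
      exact congrFun hz b
    · exact hy k hk
  · funext k
    apply hy
    have := k.1.2
    omega

/-- Kalman's condition: on block `i`, `B ^ i` acts as the product `𝔹_1 ⋯ 𝔹_i` into block `0`, and
each factor is injective by full column rank. -/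
theorem IsDrift.eq_zero_of_pow_mulVec {B : Matrix (Idx p) (Idx p) ℝ} (hB : IsDrift B) (i : ℕ) :
    ∀ y : Idx p → ℝ, (∀ k : Idx p, (k.1 : ℕ) ≠ i → y k = 0) →
      (∀ m : Idx p, (m.1 : ℕ) = 0 → ((B ^ i) *ᵥ y) m = 0) → y = 0 := by
  induction i with
  | zero =>
    intro y hy h
    funext k
    by_cases hk : (k.1 : ℕ) = 0
    · simpa using h k hk
    · exact hy k hk
  | succ i ih =>
    intro y hy h
    apply hB.eq_zero_of_mulVec_eq_zero hy
    apply ih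
    · intro k hk
      simp only [Matrix.mulVec, dotProduct]
      apply Finset.sum_eq_zero
      intro l _
      by_cases hkl : B k l = 0
      · rw [hkl, zero_mul]
      · rw [hy l, mul_zero]
        have := hB.eq_add_one hkl
        omega
    · intro m hm
      rw [Matrix.mulVec_mulVec, ← pow_succ]
      exact h m hm

/-! ### The Gram matrix -/

/-- The explicit solution `∫₀¹ E(s) A E(s)ᵀ ds` of the Lyapunov equation. -/
def gram (B A : Matrix (Idx p) (Idx p) ℝ) : Matrix (Idx p) (Idx p) ℝ :=
  Matrix.of fun k l => (-1) ^ ((k.1 : ℕ) + (l.1 : ℕ))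
    / ((k.1 : ℕ).factorial * (l.1 : ℕ).factorial * ((k.1 : ℝ) + (l.1 : ℝ) + 1))
    * (Bᵀ ^ (k.1 : ℕ) * A * B ^ (l.1 : ℕ)) k l

/-- The matrix vanishes outside the upper left block. -/
def TopSupported (A : Matrix (Idx p) (Idx p) ℝ) : Prop :=
  ∀ k l : Idx p, (k.1 ≠ 0 ∨ l.1 ≠ 0) → A k l = 0

/-- `Bᵀ` raises the block index by one, so only block `k - 1` contributes to row `k`, and the extra
factor completes `Bᵀ ^ k`. -/
theorem transpose_mul_gram_apply {B A : Matrix (Idx p) (Idx p) ℝ} (hB : IsDrift B)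
    (k l : Idx p) :
    (Bᵀ * gram B A) k l = if (k.1 : ℕ) = 0 then 0 else
      (-1) ^ ((k.1 : ℕ) - 1 + (l.1 : ℕ))
        / (((k.1 : ℕ) - 1).factorial * (l.1 : ℕ).factorial * ((k.1 : ℝ) + (l.1 : ℝ)))
        * (Bᵀ ^ (k.1 : ℕ) * A * B ^ (l.1 : ℕ)) k l := by
  rw [Matrix.mul_apply]
  split_ifs with hk
  · apply Finset.sum_eq_zero
    intro m _
    have : B m k = 0 := hB.zero_off m k (by omega)
    simp [this]
  · obtain ⟨i, hi⟩ : ∃ i, (k.1 : ℕ) = i + 1 := ⟨k.1 - 1, by omega⟩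
    have hr : ((k.1 : ℕ) : ℝ) = (i : ℝ) + 1 := by rw [hi]; push_cast; ring
    rw [hr, hi, pow_succ' Bᵀ i, Matrix.mul_assoc, Matrix.mul_assoc, Matrix.mul_apply,
      Finset.mul_sum]
    apply Finset.sum_congr rfl
    intro m _
    by_cases hm : B m k = 0
    · simp [hm]
    · have hmi : (m.1 : ℕ) = i := by have := hB.eq_add_one hm; omega
      simp only [gram, Matrix.of_apply, hmi, Matrix.transpose_apply, Matrix.mul_assoc,
        Nat.add_sub_cancel]
      ring_nf

theorem transpose_pow_mul_mul_pow_apply (B A : Matrix (Idx p) (Idx p) ℝ) (i j : ℕ)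
    (k l : Idx p) : (Bᵀ ^ i * Aᵀ * B ^ j) k l = (Bᵀ ^ j * A * B ^ i) l k := by
  have h : (Bᵀ ^ j * A * B ^ i)ᵀ = Bᵀ ^ i * Aᵀ * B ^ j := by
    rw [Matrix.transpose_mul, Matrix.transpose_mul, Matrix.transpose_pow, Matrix.transpose_pow,
      Matrix.transpose_transpose, Matrix.mul_assoc]
  rw [← h, Matrix.transpose_apply]

theorem gram_transpose (B A : Matrix (Idx p) (Idx p) ℝ) : (gram B A)ᵀ = gram B Aᵀ := by
  ext k l
  simp only [gram, Matrix.of_apply, Matrix.transpose_apply]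
  rw [transpose_pow_mul_mul_pow_apply]
  ring

theorem gram_mul_apply {B A : Matrix (Idx p) (Idx p) ℝ} (hB : IsDrift B) (k l : Idx p) :
    (gram B A * B) k l = if (l.1 : ℕ) = 0 then 0 else
      (-1) ^ ((k.1 : ℕ) + ((l.1 : ℕ) - 1))
        / ((k.1 : ℕ).factorial * ((l.1 : ℕ) - 1).factorial * ((k.1 : ℝ) + (l.1 : ℝ)))
        * (Bᵀ ^ (k.1 : ℕ) * A * B ^ (l.1 : ℕ)) k l := by
  have h := transpose_mul_gram_apply (A := Aᵀ) hB l k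
  rw [← gram_transpose, ← Matrix.transpose_mul, Matrix.transpose_apply] at h
  rw [h, transpose_pow_mul_mul_pow_apply]
  split_ifs
  · rfl
  · rw [add_comm ((l.1 : ℕ) - 1), add_comm ((l.1 : ℕ) : ℝ),
      mul_comm ((((l.1 : ℕ) - 1).factorial) : ℝ)]

/-- Off the top block `A` vanishes and the coefficients cancel, since `1/(k! l!) = (k + l)/(k! l! (k
+ l))` with opposite signs; for `k = l = 0` only the first term survives and equals `A`. -/
theorem gram_lyapunov {B A : Matrix (Idx p) (Idx p) ℝ} (hB : IsDrift B) (hA : TopSupported A)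
    (k l : Idx p) :
    ((k.1 : ℝ) + (l.1 : ℝ) + 1) * gram B A k l + (Bᵀ * gram B A) k l + (gram B A * B) k l
      = A k l := by
  rw [transpose_mul_gram_apply hB, gram_mul_apply hB]
  simp only [gram, Matrix.of_apply]
  have hval : ∀ q : Idx p, (q.1 : ℕ) ≠ 0 → q.1 ≠ 0 := fun q hq h => hq (by rw [h]; rfl)
  by_cases hk : (k.1 : ℕ) = 0 <;> by_cases hl : (l.1 : ℕ) = 0
  · simp [hk, hl]
  · rw [hA k l (Or.inr (hval l hl)), if_pos hk, if_neg hl]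
    obtain ⟨i, hi⟩ : ∃ i, (l.1 : ℕ) = i + 1 := ⟨l.1 - 1, by omega⟩
    rw [hk, hi, Nat.add_sub_cancel, Nat.factorial_succ]
    push_cast
    have : ((i : ℝ) + 1) ≠ 0 := by positivity
    field_simp
    ring
  · rw [hA k l (Or.inl (hval k hk)), if_neg hk, if_pos hl]
    obtain ⟨i, hi⟩ : ∃ i, (k.1 : ℕ) = i + 1 := ⟨k.1 - 1, by omega⟩
    rw [hl, hi, Nat.add_sub_cancel, Nat.factorial_succ]
    push_cast
    have : ((i : ℝ) + 1) ≠ 0 := by positivity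
    field_simp
    ring
  · rw [hA k l (Or.inl (hval k hk)), if_neg hk, if_neg hl]
    obtain ⟨i, hi⟩ : ∃ i, (k.1 : ℕ) = i + 1 := ⟨k.1 - 1, by omega⟩
    obtain ⟨j, hj⟩ : ∃ i, (l.1 : ℕ) = i + 1 := ⟨l.1 - 1, by omega⟩
    rw [hi, hj, Nat.add_sub_cancel, Nat.add_sub_cancel, Nat.factorial_succ, Nat.factorial_succ]
    push_cast
    have h1 : ((i : ℝ) + 1) ≠ 0 := by positivity
    have h2 : ((j : ℝ) + 1) ≠ 0 := by positivity
    have h3 : ((i : ℝ) + 1 + (j + 1)) ≠ 0 := by positivity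
    have h4 : ((i : ℝ) + 1 + (j + 1) + 1) ≠ 0 := by positivity
    field_simp
    ring

/-- The rows of `exp(-sB)` in the first block, as far as they enter `gram`. -/
def flowRow (B : Matrix (Idx p) (Idx p) ℝ) (s : ℝ) : Matrix (Idx p) (Idx p) ℝ :=
  Matrix.of fun m k => (-s) ^ (k.1 : ℕ) / (k.1 : ℕ).factorial * (B ^ (k.1 : ℕ)) m k

theorem flowRow_conj_apply (B A : Matrix (Idx p) (Idx p) ℝ) (s : ℝ) (k l : Idx p) :
    ((flowRow B s)ᵀ * A * flowRow B s) k l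
      = (-s) ^ ((k.1 : ℕ) + (l.1 : ℕ)) / ((k.1 : ℕ).factorial * (l.1 : ℕ).factorial)
        * (Bᵀ ^ (k.1 : ℕ) * A * B ^ (l.1 : ℕ)) k l := by
  rw [← Matrix.transpose_pow]
  simp only [Matrix.mul_apply, flowRow, Matrix.transpose_apply, Matrix.of_apply, Finset.sum_mul,
    Finset.mul_sum]
  apply Finset.sum_congr rfl
  intro m _
  apply Finset.sum_congr rfl
  intro m' _
  field_simp
  ring

theorem continuous_flowRow (B : Matrix (Idx p) (Idx p) ℝ) : Continuous (flowRow B) := by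
  apply continuous_matrix
  intro i j
  simp only [flowRow, Matrix.of_apply]
  fun_prop

theorem gram_apply_eq_integral (B A : Matrix (Idx p) (Idx p) ℝ) (k l : Idx p) :
    gram B A k l = ∫ s in (0 : ℝ)..1, ((flowRow B s)ᵀ * A * flowRow B s) k l := by
  simp only [flowRow_conj_apply]
  rw [intervalIntegral.integral_mul_const, intervalIntegral.integral_div]
  have : (fun s : ℝ => (-s) ^ ((k.1 : ℕ) + (l.1 : ℕ)))
      = fun s => (-1) ^ ((k.1 : ℕ) + (l.1 : ℕ)) * s ^ ((k.1 : ℕ) + (l.1 : ℕ)) := by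
    funext s
    rw [neg_pow]
  rw [this]
  rw [intervalIntegral.integral_const_mul, integral_pow]
  simp only [gram, Matrix.of_apply]
  have h4 : ((k.1 : ℝ) + (l.1 : ℝ) + 1) ≠ 0 := by positivity
  rw [one_pow, zero_pow (Nat.succ_ne_zero _)]
  push_cast
  field_simp
  ring

/-- The closed formula serves the Lyapunov algebra; this integral form makes positivity and
monotonicity in `A` visible. -/
theorem gram_quadratic (B A : Matrix (Idx p) (Idx p) ℝ) (x : Idx p → ℝ) :
    x ⬝ᵥ gram B A *ᵥ x
      = ∫ s in (0 : ℝ)..1, (flowRow B s *ᵥ x) ⬝ᵥ A *ᵥ (flowRow B s *ᵥ x) := by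
  have h1 : ∀ s, (flowRow B s *ᵥ x) ⬝ᵥ A *ᵥ (flowRow B s *ᵥ x)
      = ∑ k, ∑ l, x k * (((flowRow B s)ᵀ * A * flowRow B s) k l * x l) := by
    intro s
    have : (flowRow B s *ᵥ x) ⬝ᵥ A *ᵥ (flowRow B s *ᵥ x)
        = x ⬝ᵥ ((flowRow B s)ᵀ * A * flowRow B s) *ᵥ x := by
      rw [← Matrix.mulVec_mulVec, ← Matrix.mulVec_mulVec, Matrix.dotProduct_mulVec x,
        Matrix.vecMul_transpose]
    rw [this]
    simp only [dotProduct, Matrix.mulVec, Finset.mul_sum]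
  have hc : ∀ k l, Continuous fun s => x k * (((flowRow B s)ᵀ * A * flowRow B s) k l * x l) := by
    intro k l
    have h := (((continuous_flowRow B).matrix_transpose.matrix_mul
      (continuous_const (y := A))).matrix_mul (continuous_flowRow B)).matrix_elem k l
    exact continuous_const.mul (h.mul continuous_const)
  simp only [h1]
  rw [intervalIntegral.integral_finsetSum
    (fun k _ => (continuous_finsetSum _ fun l _ => hc k l).intervalIntegrable _ _)]
  simp only [dotProduct, Matrix.mulVec, Finset.mul_sum]
  apply Finset.sum_congr rfl
  intro k _
  rw [intervalIntegral.integral_finsetSum (fun l _ => (hc k l).intervalIntegrable _ _)]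
  apply Finset.sum_congr rfl
  intro l _
  rw [intervalIntegral.integral_const_mul, intervalIntegral.integral_mul_const,
    gram_apply_eq_integral]

theorem continuous_flowRow_quadratic (B A : Matrix (Idx p) (Idx p) ℝ) (x : Idx p → ℝ) :
    Continuous fun s => (flowRow B s *ᵥ x) ⬝ᵥ A *ᵥ (flowRow B s *ᵥ x) := by
  have h : Continuous fun s => flowRow B s *ᵥ x :=
    (continuous_flowRow B).matrix_mulVec continuous_const
  exact h.dotProduct (continuous_const.matrix_mulVec h)

/-- Two constants allow both comparisons of `A z₀` with `topProj`, which yield bounds depending only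
on the ellipticity constants. -/
theorem gram_quadratic_mono (B : Matrix (Idx p) (Idx p) ℝ) {A A' : Matrix (Idx p) (Idx p) ℝ}
    {c c' : ℝ} (h : ∀ v : Idx p → ℝ, c * (v ⬝ᵥ A *ᵥ v) ≤ c' * (v ⬝ᵥ A' *ᵥ v)) (x : Idx p → ℝ) :
    c * (x ⬝ᵥ gram B A *ᵥ x) ≤ c' * (x ⬝ᵥ gram B A' *ᵥ x) := by
  rw [gram_quadratic, gram_quadratic, ← intervalIntegral.integral_const_mul,
    ← intervalIntegral.integral_const_mul]
  apply intervalIntegral.integral_mono_on zero_le_one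
  · exact (continuous_const.mul (continuous_flowRow_quadratic B A x)).intervalIntegrable _ _
  · exact (continuous_const.mul (continuous_flowRow_quadratic B A' x)).intervalIntegrable _ _
  · intro s _
    exact h _

/-- The identity on the first block, zero elsewhere. -/
def topProj (p : Fin (n + 1) → ℕ) : Matrix (Idx p) (Idx p) ℝ :=
  Matrix.diagonal fun k => if k.1 = 0 then 1 else 0

theorem topProj_quadratic (v : Idx p → ℝ) :
    v ⬝ᵥ topProj p *ᵥ v = ∑ k : Idx p, if k.1 = 0 then v k ^ 2 else 0 := by
  simp only [topProj, dotProduct, Matrix.mulVec_diagonal]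
  apply Finset.sum_congr rfl
  intro k _
  split_ifs <;> ring

/-- If the integral vanished, the first block of `flowRow B s *ᵥ x`, a polynomial in `s`, would
vanish on `[0,1]`. Its coefficients are multiples of the top components of `B ^ i` applied to block
`i` of `x`, so `x = 0` by Kalman's condition. -/
theorem gram_topProj_pos {B : Matrix (Idx p) (Idx p) ℝ} (hB : IsDrift B) {x : Idx p → ℝ}
    (hx : x ≠ 0) : 0 < x ⬝ᵥ gram B (topProj p) *ᵥ x := by
  rw [gram_quadratic]
  have hnn : ∀ v : Idx p → ℝ, 0 ≤ v ⬝ᵥ topProj p *ᵥ v := fun v => by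
    rw [topProj_quadratic]
    exact Finset.sum_nonneg fun k _ => by split_ifs <;> positivity
  apply intervalIntegral.integral_pos zero_lt_one
    (continuous_flowRow_quadratic B (topProj p) x).continuousOn (fun s _ => hnn _)
  by_contra! hcon
  apply hx
  have hz : ∀ s ∈ Icc (0 : ℝ) 1, ∀ m : Idx p, m.1 = 0 → (flowRow B s *ᵥ x) m = 0 := by
    intro s hs m hm
    have h0 := le_antisymm (hcon s hs) (hnn _)
    rw [topProj_quadratic, Finset.sum_eq_zero_iff_of_nonneg
      (fun k _ => by split_ifs <;> positivity)] at h0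
    have := h0 m (Finset.mem_univ _)
    rw [if_pos hm] at this
    exact pow_eq_zero_iff (two_ne_zero) |>.mp this
  have hcoef : ∀ i : ℕ, ∀ m : Idx p, m.1 = 0 →
      ∑ k : Idx p, (if (k.1 : ℕ) = i then (B ^ i) m k * x k else 0) = 0 := by
    intro i m hm
    set P : Polynomial ℝ := ∑ k : Idx p,
      Polynomial.C ((-1) ^ (k.1 : ℕ) / (k.1 : ℕ).factorial * (B ^ (k.1 : ℕ)) m k * x k)
        * Polynomial.X ^ (k.1 : ℕ) with hP
    have hP0 : P = 0 := by
      apply Polynomial.eq_zero_of_infinite_isRoot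
      apply (Icc_infinite (zero_lt_one (α := ℝ))).mono
      intro s hs
      have h := hz s hs m hm
      simp only [Set.mem_ofPred_eq, Polynomial.IsRoot, hP, Polynomial.eval_finsetSum,
        Polynomial.eval_mul, Polynomial.eval_C, Polynomial.eval_pow, Polynomial.eval_X]
      rw [← h]
      simp only [Matrix.mulVec, dotProduct, flowRow, Matrix.of_apply]
      apply Finset.sum_congr rfl
      intro k _
      rw [neg_pow s]
      ring
    have hc := congrArg (fun q => Polynomial.coeff q i) hP0
    simp only [hP, Polynomial.finsetSum_coeff, Polynomial.coeff_C_mul, Polynomial.coeff_X_pow,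
      Polynomial.coeff_zero] at hc
    have hfac : ((-1 : ℝ) ^ i / (i.factorial : ℝ)) ≠ 0 := by positivity
    have : ((-1 : ℝ) ^ i / (i.factorial : ℝ)) *
        ∑ k : Idx p, (if (k.1 : ℕ) = i then (B ^ i) m k * x k else 0) = 0 := by
      refine Eq.trans ?_ hc
      rw [Finset.mul_sum]
      apply Finset.sum_congr rfl
      intro k _
      by_cases hk : (k.1 : ℕ) = i
      · subst hk
        simp
        ring
      · simp [hk, Ne.symm hk]
    exact (mul_eq_zero.mp this).resolve_left hfac
  funext k
  have := hB.eq_zero_of_pow_mulVec (k.1 : ℕ)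
    (fun q => if (q.1 : ℕ) = (k.1 : ℕ) then x q else 0) (fun q hq => if_neg hq) (by
      intro m hm
      have := hcoef k.1 m (Fin.ext hm)
      simp only [Matrix.mulVec, dotProduct]
      simpa [mul_ite] using this)
  simpa using congrFun this k

/-! ### Bounds for quadratic forms -/

theorem dotProduct_self_eq_norm_sq (x : Idx p → ℝ) :
    x ⬝ᵥ x = ‖(WithLp.toLp 2 x : Space p)‖ ^ 2 := by
  rw [EuclideanSpace.norm_sq_eq]
  simp [dotProduct, sq]

theorem exists_quadratic_bounds {G : Matrix (Idx p) (Idx p) ℝ}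
    (hG : ∀ x : Idx p → ℝ, x ≠ 0 → 0 < x ⬝ᵥ G *ᵥ x) :
    ∃ c C : ℝ, 0 < c ∧ 0 < C ∧ ∀ x : Idx p → ℝ,
      c * (x ⬝ᵥ x) ≤ x ⬝ᵥ G *ᵥ x ∧ x ⬝ᵥ G *ᵥ x ≤ C * (x ⬝ᵥ x) := by
  have hcont : Continuous fun x : Space p => x.ofLp ⬝ᵥ G *ᵥ x.ofLp := by
    have h : Continuous fun x : Space p => x.ofLp := PiLp.continuous_ofLp 2 _
    exact h.dotProduct (continuous_const.matrix_mulVec h)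
  -- Positivity of the block sizes is not assumed here, so the space may be trivial.
  rcases (Metric.sphere (0 : Space p) 1).eq_empty_or_nonempty with he | hne
  · refine ⟨1, 1, one_pos, one_pos, fun x => ?_⟩
    have hx : x = 0 := by
      by_contra hx
      have hx' : (WithLp.toLp 2 x : Space p) ≠ 0 := by simpa using hx
      have : (‖(WithLp.toLp 2 x : Space p)‖⁻¹ • (WithLp.toLp 2 x : Space p))
          ∈ Metric.sphere (0 : Space p) 1 := by
        rw [mem_sphere_zero_iff_norm, norm_smul, norm_inv, norm_norm,
          inv_mul_cancel₀ (norm_ne_zero_iff.mpr hx')]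
      rw [he] at this
      exact this
    simp [hx]
  obtain ⟨a, ha, hamin⟩ := (isCompact_sphere (0 : Space p) 1).exists_isMinOn hne hcont.continuousOn
  obtain ⟨d, hd, hdmax⟩ := (isCompact_sphere (0 : Space p) 1).exists_isMaxOn hne hcont.continuousOn
  have hpos : ∀ y ∈ Metric.sphere (0 : Space p) 1, 0 < y.ofLp ⬝ᵥ G *ᵥ y.ofLp := by
    intro y hy
    apply hG
    intro h0
    have : y = 0 := by ext i; exact congrFun h0 i
    rw [this] at hy
    simp at hy
  refine ⟨_, _, hpos a ha, hpos d hd, fun x => ?_⟩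
  by_cases hx : x = 0
  · simp [hx]
  set y : Space p := WithLp.toLp 2 x with hy
  have hy0 : 0 < ‖y‖ := norm_pos_iff.mpr (by simpa [hy] using hx)
  have hmem : ‖y‖⁻¹ • y ∈ Metric.sphere (0 : Space p) 1 := by
    rw [mem_sphere_zero_iff_norm, norm_smul, norm_inv, norm_norm, inv_mul_cancel₀ hy0.ne']
  have hval : (‖y‖⁻¹ • y).ofLp ⬝ᵥ G *ᵥ (‖y‖⁻¹ • y).ofLp = (‖y‖ ^ 2)⁻¹ * (x ⬝ᵥ G *ᵥ x) := by
    simp only [WithLp.ofLp_smul, Matrix.mulVec_smul, dotProduct_smul, smul_dotProduct,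
      smul_eq_mul, hy]
    rw [← mul_assoc]
    congr 1
    field_simp
  rw [dotProduct_self_eq_norm_sq x, ← hy]
  have h1 := hamin hmem
  have h2 := hdmax hmem
  simp only [Set.mem_ofPred_eq] at h1 h2
  rw [hval] at h1 h2
  have hsq : 0 < ‖y‖ ^ 2 := by positivity
  constructor
  · rw [inv_mul_eq_div, le_div_iff₀ hsq] at h1
    exact h1
  · rw [inv_mul_eq_div, div_le_iff₀ hsq] at h2
    exact h2

/-- Bounds for the inverse of a symmetric positive definite matrix. -/
theorem inv_quadratic_bounds {ι : Type*} [Fintype ι] [DecidableEq ι] {G : Matrix ι ι ℝ}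
    (hsym : Gᵀ = G) {α β : ℝ} (hα : 0 < α) (hβ : 0 < β)
    (h : ∀ x : ι → ℝ, α * (x ⬝ᵥ x) ≤ x ⬝ᵥ G *ᵥ x ∧ x ⬝ᵥ G *ᵥ x ≤ β * (x ⬝ᵥ x)) :
    IsUnit G.det ∧ ∀ y : ι → ℝ,
      β⁻¹ * (y ⬝ᵥ y) ≤ y ⬝ᵥ G⁻¹ *ᵥ y ∧ y ⬝ᵥ G⁻¹ *ᵥ y ≤ α⁻¹ * (y ⬝ᵥ y) := by
  have hnn : ∀ v : ι → ℝ, 0 ≤ v ⬝ᵥ v := fun v => by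
    simp only [dotProduct]
    exact Finset.sum_nonneg fun i _ => mul_self_nonneg _
  have hdet : IsUnit G.det := by
    rw [isUnit_iff_ne_zero]
    intro h0
    obtain ⟨v, hv, hGv⟩ := Matrix.exists_mulVec_eq_zero_iff.mpr h0
    have := (h v).1
    rw [hGv, dotProduct_zero] at this
    have h2 : v ⬝ᵥ v = 0 := le_antisymm (by nlinarith [hnn v]) (hnn v)
    exact hv (dotProduct_self_eq_zero.mp h2)
  refine ⟨hdet, fun y => ?_⟩
  have hGx : G *ᵥ (G⁻¹ *ᵥ y) = y := by
    rw [Matrix.mulVec_mulVec, Matrix.mul_nonsing_inv _ hdet, Matrix.one_mulVec]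
  set x := G⁻¹ *ᵥ y with hx
  constructor
  -- With `x = G⁻¹ y` this expands to `⟨y,x⟩ ≥ 2β⁻¹|y|² - β⁻²⟨y,Gy⟩`, and `⟨y,Gy⟩ ≤ β|y|²`. The
  -- upper bound uses `|y - αx|² ≥ 0` in the same way.
  · have h1 : 0 ≤ (x - β⁻¹ • y) ⬝ᵥ G *ᵥ (x - β⁻¹ • y) :=
      le_trans (mul_nonneg hα.le (hnn _)) (h _).1
    have h2 : x ⬝ᵥ G *ᵥ y = y ⬝ᵥ y := by
      rw [Matrix.dotProduct_mulVec, ← Matrix.mulVec_transpose, hsym, hGx]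
    rw [Matrix.mulVec_sub, hGx, Matrix.mulVec_smul, sub_dotProduct, dotProduct_sub,
      dotProduct_sub, smul_dotProduct, dotProduct_smul, smul_dotProduct, dotProduct_smul, h2,
      dotProduct_comm x y] at h1
    simp only [smul_eq_mul] at h1
    have h3 := (h y).2
    have h4 : β⁻¹ * (β⁻¹ * (y ⬝ᵥ G *ᵥ y)) ≤ β⁻¹ * (y ⬝ᵥ y) := by
      apply mul_le_mul_of_nonneg_left _ (inv_nonneg.mpr hβ.le)
      rw [inv_mul_le_iff₀ hβ]
      exact h3
    linarith
  · have h1 := (h x).1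
    rw [hGx, dotProduct_comm x y] at h1
    have h2 : 0 ≤ (y - α • x) ⬝ᵥ (y - α • x) := hnn _
    rw [sub_dotProduct, dotProduct_sub, dotProduct_sub, smul_dotProduct, dotProduct_smul,
      smul_dotProduct, dotProduct_smul, dotProduct_comm x y] at h2
    simp only [smul_eq_mul] at h2
    rw [inv_mul_eq_div, le_div_iff₀ hα]
    nlinarith

/-! ### The one-parameter group `E` -/

theorem expE_zero (B : Matrix (Idx p) (Idx p) ℝ) : expE B 0 = 1 := by
  simp [expE]

theorem expE_add (B : Matrix (Idx p) (Idx p) ℝ) (s t : ℝ) :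
    expE B (s + t) = expE B s * expE B t := by
  unfold expE
  rw [← Matrix.exp_add_of_commute]
  · rw [add_smul, neg_add]
  · exact (((Commute.refl Bᵀ).smul_left s).smul_right t).neg_left.neg_right

theorem hasDerivAt_expE_apply (B : Matrix (Idx p) (Idx p) ℝ) (s : ℝ) (k l : Idx p) :
    HasDerivAt (fun σ => expE B σ k l) (-(Bᵀ * expE B s) k l) s := by
  -- Any norm will do: it is needed only to differentiate the exponential, and entries do not see
  -- it.
  let _ : NormedRing (Matrix (Idx p) (Idx p) ℝ) := Matrix.linftyOpNormedRing
  let _ : NormedAlgebra ℝ (Matrix (Idx p) (Idx p) ℝ) := Matrix.linftyOpNormedAlgebra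
  have h := hasDerivAt_exp_smul_const' (𝕂 := ℝ) (-Bᵀ) s
  have h2 := ((Matrix.entryLinearMap ℝ ℝ k l).toContinuousLinearMap.hasFDerivAt
    (x := NormedSpace.exp (s • -Bᵀ))).comp_hasDerivAt s h
  convert! h2 using 1
  · funext σ
    rw [expE, ← smul_neg]
    rfl
  · rw [expE, ← smul_neg, ← Matrix.neg_apply, ← Matrix.neg_mul]
    rfl

theorem hasDerivAt_expE_mulVec (B : Matrix (Idx p) (Idx p) ℝ) (v : Idx p → ℝ) (s : ℝ)
    (k : Idx p) :
    HasDerivAt (fun σ => (expE B σ *ᵥ v) k) (-(Bᵀ *ᵥ (expE B s *ᵥ v)) k) s := by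
  rw [Matrix.mulVec_mulVec]
  simp only [Matrix.mulVec, dotProduct]
  rw [← Finset.sum_neg_distrib]
  apply HasDerivAt.fun_sum
  intro l _
  have := (hasDerivAt_expE_apply B s k l).mul_const (v l)
  convert! this using 1
  ring

theorem continuous_expE (B : Matrix (Idx p) (Idx p) ℝ) : Continuous (expE B) :=
  continuous_matrix fun k l =>
    continuous_iff_continuousAt.mpr fun s => (hasDerivAt_expE_apply B s k l).continuousAt

/-! ### The scaled precision matrix -/

/-- `M` is the inverse of a solution of the Lyapunov equation for `A`. -/
structure IsPrecision (B A M : Matrix (Idx p) (Idx p) ℝ) : Prop where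
  symm : Mᵀ = M
  top : TopSupported A
  lyapunov : ∀ k l : Idx p, ((k.1 : ℝ) + (l.1 : ℝ) + 1) * M k l + (M * Bᵀ) k l + (B * M) k l
    = (M * A * M) k l
  trace : (A * M).trace = homDim p

theorem sum_weight_eq_homDim (p : Fin (n + 1) → ℕ) :
    ∑ k : Idx p, (2 * (k.1 : ℝ) + 1) = homDim p := by
  rw [Fintype.sum_sigma]
  simp only [Finset.sum_const, Finset.card_univ, Fintype.card_fin, homDim]
  push_cast
  exact Finset.sum_congr rfl fun i _ => by simp; ring

/-- Write the Lyapunov equation as `WC + CW + BᵀC + CB = A` with `W = diag(i + 1/2)`. Multiplying by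
`C⁻¹` on both sides gives the equation for the inverse; multiplying on the right and taking traces
gives `2 tr W = Q`, as `B` is traceless. -/
theorem isPrecision_inv_gram {B A : Matrix (Idx p) (Idx p) ℝ} (hB : IsDrift B)
    (hA : TopSupported A) (hsym : Aᵀ = A) (hdet : IsUnit (gram B A).det) :
    IsPrecision B A (gram B A)⁻¹ := by
  set C := gram B A with hC
  set W : Matrix (Idx p) (Idx p) ℝ := Matrix.diagonal fun k => (k.1 : ℝ) + 1 / 2 with hW
  have hMC : C⁻¹ * C = 1 := Matrix.nonsing_inv_mul _ hdet
  have hCM : C * C⁻¹ = 1 := Matrix.mul_nonsing_inv _ hdet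
  have hCsym : Cᵀ = C := by rw [hC, gram_transpose, hsym]
  have hL : W * C + C * W + Bᵀ * C + C * B = A := by
    ext k l
    rw [← gram_lyapunov hB hA k l]
    simp only [Matrix.add_apply, hW, Matrix.diagonal_mul, Matrix.mul_diagonal, hC]
    ring
  have hM : C⁻¹ * W + W * C⁻¹ + C⁻¹ * Bᵀ + B * C⁻¹ = C⁻¹ * A * C⁻¹ := by
    rw [← hL]
    simp only [Matrix.mul_add, Matrix.add_mul, Matrix.mul_assoc, hCM, Matrix.mul_one]
    simp only [← Matrix.mul_assoc, hMC, Matrix.one_mul]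
  refine ⟨?_, hA, ?_, ?_⟩
  · rw [Matrix.transpose_nonsing_inv, hCsym]
  · intro k l
    rw [← hM]
    simp only [Matrix.add_apply, hW, Matrix.diagonal_mul, Matrix.mul_diagonal]
    ring
  · rw [← hL]
    have hBtr : B.trace = 0 := by
      simp only [Matrix.trace, Matrix.diag_apply]
      exact Finset.sum_eq_zero fun k _ => hB.zero_off k k (by omega)
    simp only [Matrix.add_mul, Matrix.mul_assoc, hCM, Matrix.mul_one, Matrix.trace_add]
    rw [Matrix.trace_mul_comm C (W * C⁻¹), Matrix.trace_mul_comm C (B * C⁻¹)]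
    simp only [Matrix.mul_assoc, hMC, Matrix.mul_one, Matrix.trace_transpose, hBtr, add_zero]
    rw [← sum_weight_eq_homDim, hW, Matrix.trace_diagonal, ← Finset.sum_add_distrib]
    exact Finset.sum_congr rfl fun k _ => by ring

/-- The precision matrix at time `s`. -/
def prec (M : Matrix (Idx p) (Idx p) ℝ) (s : ℝ) : Matrix (Idx p) (Idx p) ℝ :=
  Matrix.of fun k l => M k l / s ^ ((k.1 : ℕ) + (l.1 : ℕ) + 1)

theorem prec_transpose {M : Matrix (Idx p) (Idx p) ℝ} (hM : Mᵀ = M) (s : ℝ) :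
    (prec M s)ᵀ = prec M s := by
  ext k l
  simp only [prec, Matrix.transpose_apply, Matrix.of_apply]
  rw [add_comm (l.1 : ℕ), ← Matrix.transpose_apply M, hM]

theorem trace_mul_prec {A M : Matrix (Idx p) (Idx p) ℝ} (hA : TopSupported A) (s : ℝ) :
    (A * prec M s).trace = (A * M).trace / s := by
  simp only [Matrix.trace, Matrix.diag_apply, Matrix.mul_apply, Finset.sum_div]
  apply Finset.sum_congr rfl
  intro k _
  apply Finset.sum_congr rfl
  intro l _
  by_cases h : k.1 ≠ 0 ∨ l.1 ≠ 0
  · simp [hA k l h]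
  · push Not at h
    simp [prec, h.1, h.2, mul_div_assoc]

theorem drift_mul_prec_apply {B M : Matrix (Idx p) (Idx p) ℝ} (hB : IsDrift B) (s : ℝ)
    (k l : Idx p) :
    (B * prec M s) k l = (B * M) k l / s ^ ((k.1 : ℕ) + (l.1 : ℕ) + 2) := by
  simp only [Matrix.mul_apply, Finset.sum_div]
  apply Finset.sum_congr rfl
  intro m _
  by_cases hm : B k m = 0
  · simp [hm]
  · have := hB.eq_add_one hm
    simp only [prec, Matrix.of_apply, this, mul_div_assoc]
    ring_nf

/-- The left side is minus the time derivative of the entry of `P = prec M s`, so this is the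
Riccati equation `-P' = PAP - PBᵀ - BP`. Every term scales as `s^{-(k+l+2)}`; for `PAP` this uses
that `A` lives in the top block. -/
theorem IsPrecision.lyapunov_prec {B A M : Matrix (Idx p) (Idx p) ℝ} (hB : IsDrift B)
    (h : IsPrecision B A M) {s : ℝ} (hs : s ≠ 0) (k l : Idx p) :
    ((k.1 : ℝ) + (l.1 : ℝ) + 1) / s * prec M s k l
      = (prec M s * A * prec M s) k l - (prec M s * Bᵀ) k l - (B * prec M s) k l := by
  have h1 : (prec M s * Bᵀ) k l = (M * Bᵀ) k l / s ^ ((k.1 : ℕ) + (l.1 : ℕ) + 2) := by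
    have := drift_mul_prec_apply (M := M) hB s l k
    rw [← Matrix.transpose_apply (B * prec M s), ← Matrix.transpose_apply (B * M),
      Matrix.transpose_mul, Matrix.transpose_mul, prec_transpose h.symm, h.symm] at this
    rw [this, add_comm (l.1 : ℕ)]
  have h2 : (prec M s * A * prec M s) k l
      = (M * A * M) k l / s ^ ((k.1 : ℕ) + (l.1 : ℕ) + 2) := by
    simp only [Matrix.mul_apply, Finset.sum_div, Finset.sum_mul]
    apply Finset.sum_congr rfl
    intro m _
    apply Finset.sum_congr rfl
    intro m' _
    by_cases hm : m'.1 ≠ 0 ∨ m.1 ≠ 0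
    · simp [h.top m' m hm]
    · push Not at hm
      simp only [prec, Matrix.of_apply, hm.1, hm.2, Fin.val_zero]
      field_simp
      ring
  rw [h1, h2, drift_mul_prec_apply hB, ← h.lyapunov k l]
  simp only [prec, Matrix.of_apply]
  field_simp
  ring

/-! ### Derivatives of Gaussians in space -/

/-- A Gaussian with precision matrix proportional to `P`, centred at `w`. -/
def gauss (C c : ℝ) (P : Matrix (Idx p) (Idx p) ℝ) (w x : Space p) : ℝ :=
  C * Real.exp (-(c * ((x - w).ofLp ⬝ᵥ P *ᵥ (x - w).ofLp)))

theorem inner_toEuclideanCLM (P : Matrix (Idx p) (Idx p) ℝ) (x y : Space p) :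
    inner ℝ x (Matrix.toEuclideanCLM (n := Idx p) (𝕜 := ℝ) P y) = x.ofLp ⬝ᵥ P *ᵥ y.ofLp := by
  rw [EuclideanSpace.inner_eq_star_dotProduct, Matrix.ofLp_toEuclideanCLM, dotProduct_comm]
  simp

section abstractGaussian

variable {E : Type*} [NormedAddCommGroup E] [InnerProductSpace ℝ E]

theorem contDiff_exp_neg_quadratic (C c : ℝ) (T : E →L[ℝ] E) (w : E) :
    ContDiff ℝ 2 fun x => C * Real.exp (-(c * inner ℝ (x - w) (T (x - w)))) := by
  have h1 : ContDiff ℝ 2 fun x : E => x - w := contDiff_id.sub contDiff_const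
  have h2 : ContDiff ℝ 2 fun x : E => T (x - w) := T.contDiff.comp h1
  exact contDiff_const.mul ((contDiff_const.mul (h1.inner ℝ h2)).neg.exp)

theorem hasFDerivAt_exp_neg_quadratic (C c : ℝ) {T : E →L[ℝ] E}
    (hT : ∀ u v, inner ℝ u (T v) = inner ℝ (T u) v) (w x : E) :
    HasFDerivAt (fun x => C * Real.exp (-(c * inner ℝ (x - w) (T (x - w)))))
      ((-(2 * c * (C * Real.exp (-(c * inner ℝ (x - w) (T (x - w))))))) •
        innerSL ℝ (T (x - w))) x := by
  have h1 : HasFDerivAt (fun x : E => x - w) (ContinuousLinearMap.id ℝ E) x :=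
    (hasFDerivAt_id x).sub_const w
  have h2 : HasFDerivAt (fun x : E => T (x - w)) T x := T.hasFDerivAt.comp x h1
  have h3 := (((h1.inner ℝ h2).const_mul c).fun_neg.exp).const_mul C
  refine h3.congr_fderiv ?_
  ext v
  simp only [_root_.smul_apply, innerSL_apply_apply, smul_eq_mul,
    _root_.neg_apply, ContinuousLinearMap.comp_apply, fderivInnerCLM_apply,
    ContinuousLinearMap.prod_apply, ContinuousLinearMap.id_apply, hT (x - w) v,
    real_inner_comm (T (x - w)) v]
  ring

theorem fderiv_fderiv_exp_neg_quadratic (C c : ℝ) {T : E →L[ℝ] E}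
    (hT : ∀ u v, inner ℝ u (T v) = inner ℝ (T u) v) (w x d e : E) :
    fderiv ℝ (fun y => fderiv ℝ
        (fun x => C * Real.exp (-(c * inner ℝ (x - w) (T (x - w))))) y e) x d
      = (C * Real.exp (-(c * inner ℝ (x - w) (T (x - w))))) *
        (4 * c ^ 2 * (inner ℝ d (T (x - w)) * inner ℝ e (T (x - w))) - 2 * c * inner ℝ d (T e)) := by
  have h1 : (fun y => fderiv ℝ
        (fun x => C * Real.exp (-(c * inner ℝ (x - w) (T (x - w))))) y e)
      = fun y => (-(2 * c * (C * Real.exp (-(c * inner ℝ (y - w) (T (y - w)))))))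
        * inner ℝ (T e) (y - w) := by
    funext y
    rw [(hasFDerivAt_exp_neg_quadratic C c hT w y).fderiv]
    simp only [_root_.smul_apply, innerSL_apply_apply, smul_eq_mul]
    rw [← hT e, real_inner_comm e]
  have h2 : HasFDerivAt (fun y : E => inner ℝ (T e) (y - w)) (innerSL ℝ (T e)) x :=
    (innerSL ℝ (T e)).hasFDerivAt.comp x ((hasFDerivAt_id x).sub_const w)
  have h4 := (((hasFDerivAt_exp_neg_quadratic C c hT w x).const_mul (2 * c)).fun_neg).fun_mul h2
  rw [h1, h4.fderiv]
  simp only [_root_.add_apply, _root_.smul_apply, smul_eq_mul, _root_.neg_apply,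
    innerSL_apply_apply]
  rw [real_inner_comm d (T (x - w)), ← hT e (x - w), real_inner_comm d (T e)]
  ring

end abstractGaussian

theorem gauss_eq (C c : ℝ) (P : Matrix (Idx p) (Idx p) ℝ) (w : Space p) :
    gauss C c P w = fun x => C * Real.exp (-(c * inner ℝ (x - w)
      (Matrix.toEuclideanCLM (n := Idx p) (𝕜 := ℝ) P (x - w)))) := by
  funext x
  rw [inner_toEuclideanCLM]
  rfl

theorem inner_toEuclideanCLM_symm {P : Matrix (Idx p) (Idx p) ℝ} (hP : Pᵀ = P)
    (u v : Space p) :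
    inner ℝ u (Matrix.toEuclideanCLM (n := Idx p) (𝕜 := ℝ) P v)
      = inner ℝ (Matrix.toEuclideanCLM (n := Idx p) (𝕜 := ℝ) P u) v := by
  rw [real_inner_comm v, inner_toEuclideanCLM, inner_toEuclideanCLM, Matrix.dotProduct_mulVec,
    ← Matrix.mulVec_transpose, hP, dotProduct_comm]

theorem contDiff_gauss (C c : ℝ) (P : Matrix (Idx p) (Idx p) ℝ) (w : Space p) :
    ContDiff ℝ 2 (gauss C c P w) := by
  rw [gauss_eq]
  exact contDiff_exp_neg_quadratic C c _ w

theorem gradient_gauss (C c : ℝ) {P : Matrix (Idx p) (Idx p) ℝ} (hP : Pᵀ = P)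
    (w x : Space p) :
    gradient (gauss C c P w) x = (-(2 * c * gauss C c P w x)) •
      Matrix.toEuclideanCLM (n := Idx p) (𝕜 := ℝ) P (x - w) := by
  apply HasGradientAt.gradient
  rw [hasGradientAt_iff_hasFDerivAt, gauss_eq]
  refine (hasFDerivAt_exp_neg_quadratic C c (inner_toEuclideanCLM_symm hP) w x).congr_fderiv ?_
  rw [map_smul]
  rfl

theorem second_deriv_gauss (C c : ℝ) {P : Matrix (Idx p) (Idx p) ℝ} (hP : Pᵀ = P)
    (w x : Space p) (k l : Idx p) :
    fderiv ℝ (fun y => fderiv ℝ (gauss C c P w) y (EuclideanSpace.single l 1)) x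
      (EuclideanSpace.single k 1)
      = gauss C c P w x * (4 * c ^ 2 * ((P *ᵥ (x - w).ofLp) k * (P *ᵥ (x - w).ofLp) l)
        - 2 * c * P k l) := by
  rw [gauss_eq, fderiv_fderiv_exp_neg_quadratic C c (inner_toEuclideanCLM_symm hP)]
  congr 1
  rw [inner_toEuclideanCLM, inner_toEuclideanCLM, inner_toEuclideanCLM]
  simp

/-! ### The barrier kernel -/

/-- `s^{-a} exp(-c ⟨M(s) y, y⟩)` for `s > 0`, extended by zero. -/
def heatKer (M : Matrix (Idx p) (Idx p) ℝ) (c a : ℝ) (y : Idx p → ℝ) (s : ℝ) : ℝ :=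
  if 0 < s then s ^ (-a) * Real.exp (-(c * (y ⬝ᵥ prec M s *ᵥ y))) else 0

/-- The kernel with pole `ζ`. -/
def poleKer (B M : Matrix (Idx p) (Idx p) ℝ) (c a : ℝ) (z ζ : Pt p) : ℝ :=
  heatKer M c a (z.1.ofLp - expE B (z.2 - ζ.2) *ᵥ ζ.1.ofLp) (z.2 - ζ.2)

theorem poleKer_slice (B M : Matrix (Idx p) (Idx p) ℝ) (c a : ℝ) (ζ : Pt p) {t : ℝ}
    (ht : ζ.2 < t) :
    (fun x => poleKer B M c a (x, t) ζ) = gauss ((t - ζ.2) ^ (-a)) c (prec M (t - ζ.2))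
      (WithLp.toLp 2 (expE B (t - ζ.2) *ᵥ ζ.1.ofLp)) := by
  funext x
  simp [poleKer, heatKer, gauss, sub_pos.mpr ht]

theorem hasDerivAt_prec_quadratic {M : Matrix (Idx p) (Idx p) ℝ} (hM : Mᵀ = M)
    {s : ℝ} (hs : s ≠ 0)
    {y : ℝ → Idx p → ℝ} {d : Idx p → ℝ} (hy : ∀ k, HasDerivAt (fun σ => y σ k) (d k) s) :
    HasDerivAt (fun σ => y σ ⬝ᵥ prec M σ *ᵥ y σ)
      (2 * (d ⬝ᵥ prec M s *ᵥ y s)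
        - ∑ k, ∑ l, y s k * (((k.1 : ℝ) + (l.1 : ℝ) + 1) / s * prec M s k l) * y s l) s := by
  have hterm : ∀ k l : Idx p, HasDerivAt (fun σ => y σ k * (prec M σ k l * y σ l))
      (d k * (prec M s k l * y s l)
        + y s k * (-(((k.1 : ℝ) + (l.1 : ℝ) + 1) / s * prec M s k l) * y s l
          + prec M s k l * d l)) s := by
    intro k l
    have hp : HasDerivAt (fun σ => prec M σ k l)
        (-(((k.1 : ℝ) + (l.1 : ℝ) + 1) / s * prec M s k l)) s := by
      have h1 := ((hasDerivAt_pow ((k.1 : ℕ) + (l.1 : ℕ) + 1) s).inv (pow_ne_zero _ hs)).const_mul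
        (M k l)
      convert! h1 using 1
      simp only [prec, Matrix.of_apply, Nat.add_sub_cancel]
      push_cast
      field_simp
      ring
    exact (hy k).mul (hp.mul (hy l))
  have hsum : HasDerivAt (fun σ => ∑ k, ∑ l, y σ k * (prec M σ k l * y σ l)) _ s :=
    HasDerivAt.fun_sum fun k _ => HasDerivAt.fun_sum fun l _ => hterm k l
  have hsymm : ∑ k, ∑ l, y s k * (prec M s k l * d l) = ∑ k, ∑ l, d k * (prec M s k l * y s l) := by
    rw [Finset.sum_comm]
    refine Finset.sum_congr rfl fun k _ => Finset.sum_congr rfl fun l _ => ?_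
    have : prec M s l k = prec M s k l := by
      rw [← Matrix.transpose_apply (prec M s), prec_transpose hM]
    rw [this]
    ring
  convert! hsum using 1
  · funext σ
    simp only [dotProduct, Matrix.mulVec, Finset.mul_sum]
  · simp only [mul_add, Finset.sum_add_distrib]
    rw [hsymm]
    simp only [dotProduct, Matrix.mulVec, Finset.mul_sum]
    simp only [← Finset.mul_sum]
    rw [two_mul, sub_eq_add_neg, ← Finset.sum_neg_distrib]
    simp only [← Finset.sum_neg_distrib, Finset.mul_sum]
    have : ∀ k l : Idx p, y s k * (-(((k.1 : ℝ) + (l.1 : ℝ) + 1) / s * prec M s k l) * y s l)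
      = -(y s k * (((k.1 : ℝ) + (l.1 : ℝ) + 1) / s * prec M s k l) * y s l) := fun k l => by ring
    simp only [this]
    ring

theorem hasDerivAt_poleKer {B M : Matrix (Idx p) (Idx p) ℝ} (hM : Mᵀ = M) (c a : ℝ)
    (x : Space p) (ζ : Pt p) {t : ℝ} (ht : ζ.2 < t) :
    HasDerivAt (fun t => poleKer B M c a (x, t) ζ)
      (poleKer B M c a (x, t) ζ * (-a / (t - ζ.2) - c *
        (2 * ((Bᵀ *ᵥ (expE B (t - ζ.2) *ᵥ ζ.1.ofLp)) ⬝ᵥ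
          prec M (t - ζ.2) *ᵥ (x.ofLp - expE B (t - ζ.2) *ᵥ ζ.1.ofLp))
        - ∑ k, ∑ l, (x.ofLp - expE B (t - ζ.2) *ᵥ ζ.1.ofLp) k
          * (((k.1 : ℝ) + (l.1 : ℝ) + 1) / (t - ζ.2) * prec M (t - ζ.2) k l)
          * (x.ofLp - expE B (t - ζ.2) *ᵥ ζ.1.ofLp) l))) t := by
  have hs : 0 < t - ζ.2 := sub_pos.mpr ht
  have hy : ∀ k, HasDerivAt (fun σ => (x.ofLp - expE B σ *ᵥ ζ.1.ofLp) k)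
      ((Bᵀ *ᵥ (expE B (t - ζ.2) *ᵥ ζ.1.ofLp)) k) (t - ζ.2) := by
    intro k
    have := (hasDerivAt_expE_mulVec B ζ.1.ofLp (t - ζ.2) k).const_sub (x.ofLp k)
    simpa using this
  have hq := hasDerivAt_prec_quadratic hM hs.ne' hy
  have hpow : HasDerivAt (fun σ : ℝ => σ ^ (-a)) (-a * (t - ζ.2) ^ (-a - 1)) (t - ζ.2) :=
    Real.hasDerivAt_rpow_const (Or.inl hs.ne')
  have hF := hpow.mul ((hq.const_mul c).fun_neg.exp)
  have hsh : HasDerivAt (fun τ => τ - ζ.2) 1 t := (hasDerivAt_id t).sub_const _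
  have h := hF.comp t hsh
  have hev : (fun t => poleKer B M c a (x, t) ζ) =ᶠ[𝓝 t]
      ((fun σ => σ ^ (-a)) * (fun σ => Real.exp (-(c * ((x.ofLp - expE B σ *ᵥ ζ.1.ofLp) ⬝ᵥ
        prec M σ *ᵥ (x.ofLp - expE B σ *ᵥ ζ.1.ofLp)))))) ∘ fun τ => τ - ζ.2 := by
    filter_upwards [lt_mem_nhds ht] with τ hτ
    simp [poleKer, heatKer, sub_pos.mpr hτ]
  refine (h.congr_of_eventuallyEq hev).congr_deriv ?_
  simp only [poleKer, heatKer, if_pos hs]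
  rw [Real.rpow_sub hs, Real.rpow_one]
  field_simp
  ring

/-- By the Riccati equation the operator applied to the kernel `f` equals `f` times `c(4c⟨A Py,Py⟩ -
⟨A₀ Py,Py⟩) + (a - 2c tr(AM))/s`. The two closeness hypotheses make both summands nonnegative. -/
theorem opL_poleKer_nonneg {B M A₀ : Matrix (Idx p) (Idx p) ℝ} (hB : IsDrift B)
    (hM : IsPrecision B A₀ M) {c a : ℝ} (hc : 0 ≤ c)
    {A : Pt p → Matrix (Idx p) (Idx p) ℝ} {z ζ : Pt p} (hz : ζ.2 < z.2)
    (hA : TopSupported (A z))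
    (hlow : ∀ v : Idx p → ℝ, v ⬝ᵥ A₀ *ᵥ v ≤ 4 * c * (v ⬝ᵥ A z *ᵥ v))
    (htr : 2 * c * (A z * M).trace ≤ a) :
    0 ≤ opL B A (fun z => poleKer B M c a z ζ) z := by
  obtain ⟨x, t⟩ := z
  simp only at hz
  have hs : 0 < t - ζ.2 := sub_pos.mpr hz
  set s := t - ζ.2 with hsdef
  set P := prec M s with hP
  set e := expE B s *ᵥ ζ.1.ofLp with he
  set y : Idx p → ℝ := x.ofLp - e with hy
  set f := poleKer B M c a (x, t) ζ with hf
  have hf0 : 0 ≤ f := by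
    simp only [hf, poleKer, heatKer]
    split_ifs <;> positivity
  have hPs : Pᵀ = P := prec_transpose hM.symm s
  have hslice := poleKer_slice B M c a ζ hz
  have hfg : gauss (s ^ (-a)) c P (WithLp.toLp 2 e) x = f := by
    rw [hf, ← hsdef, ← hP, ← he] at *
    exact (congrFun hslice x).symm
  have hxw : (x - WithLp.toLp 2 e : Space p).ofLp = y := rfl
  simp only [opL]
  rw [(hasDerivAt_poleKer hM.symm c a x ζ hz).deriv]
  have hgrad : gradient (fun x => poleKer B M c a (x, t) ζ) x = (-(2 * c * f)) •
      Matrix.toEuclideanCLM (n := Idx p) (𝕜 := ℝ) P (x - WithLp.toLp 2 e) := by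
    rw [hslice, gradient_gauss _ _ hPs, hfg]
  have hhess : ∀ k l, hess (fun z => poleKer B M c a z ζ) (x, t) k l
      = f * (4 * c ^ 2 * ((P *ᵥ y) k * (P *ᵥ y) l) - 2 * c * P k l) := by
    intro k l
    simp only [hess, Matrix.of_apply]
    rw [hslice, second_deriv_gauss _ _ hPs, hfg, hxw]
  have htrace : (A (x, t) * hess (fun z => poleKer B M c a z ζ) (x, t)).trace
      = f * (4 * c ^ 2 * ((P *ᵥ y) ⬝ᵥ A (x, t) *ᵥ (P *ᵥ y)) - 2 * c * (A (x, t) * P).trace) := by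
    simp only [Matrix.trace, Matrix.diag_apply, Matrix.mul_apply, hhess]
    have hAv : ∀ k, (A (x, t) *ᵥ (P *ᵥ y)) k = ∑ l, A (x, t) k l * (P *ᵥ y) l := fun k => rfl
    have hdot : (P *ᵥ y) ⬝ᵥ A (x, t) *ᵥ (P *ᵥ y)
        = ∑ k, ∑ l, (P *ᵥ y) k * (A (x, t) k l * (P *ᵥ y) l) := by
      simp only [← Finset.mul_sum, ← hAv]
      rfl
    rw [hdot]
    simp only [Finset.mul_sum, ← Finset.sum_sub_distrib]
    refine Finset.sum_congr rfl fun k _ => Finset.sum_congr rfl fun l _ => ?_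
    ring
  rw [htrace, hgrad, map_smul, inner_smul_right, inner_toEuclideanCLM, Matrix.ofLp_toEuclideanCLM,
    hxw, ← hf, ← hsdef, ← hP, ← he, ← hy]
  have hsum : ∑ k, ∑ l, y k * (((k.1 : ℝ) + (l.1 : ℝ) + 1) / s * P k l) * y l
      = (P *ᵥ y) ⬝ᵥ A₀ *ᵥ (P *ᵥ y) - 2 * (y ⬝ᵥ B *ᵥ (P *ᵥ y)) := by
    have h1 : (P *ᵥ y) ⬝ᵥ A₀ *ᵥ (P *ᵥ y) = y ⬝ᵥ (P * A₀ * P) *ᵥ y := by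
      rw [← Matrix.mulVec_mulVec, ← Matrix.mulVec_mulVec, Matrix.dotProduct_mulVec y,
        ← Matrix.mulVec_transpose, hPs]
    have h2 : y ⬝ᵥ B *ᵥ (P *ᵥ y) = y ⬝ᵥ (P * Bᵀ) *ᵥ y := by
      have : P * Bᵀ = (B * P)ᵀ := by rw [Matrix.transpose_mul, hPs]
      rw [this, Matrix.mulVec_mulVec, Matrix.mulVec_transpose, dotProduct_comm y (y ᵥ* _),
        ← Matrix.dotProduct_mulVec]
    have h3 : y ⬝ᵥ B *ᵥ (P *ᵥ y) = y ⬝ᵥ (B * P) *ᵥ y := by rw [Matrix.mulVec_mulVec]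
    rw [two_mul]
    nth_rewrite 1 [h2]
    rw [h1, h3]
    simp only [dotProduct, Matrix.mulVec, Finset.mul_sum, ← Finset.sum_sub_distrib,
      ← Finset.sum_add_distrib]
    refine Finset.sum_congr rfl fun k _ => Finset.sum_congr rfl fun l _ => ?_
    rw [hM.lyapunov_prec hB hs.ne' k l]
    ring
  -- Since `e = x - y`, the transported pole produces a term in `x`, which cancels the drift term,
  -- and a term in `y`, which is absorbed by the Riccati equation.
  have hcross : (Bᵀ *ᵥ e) ⬝ᵥ P *ᵥ y = x.ofLp ⬝ᵥ B *ᵥ (P *ᵥ y) - y ⬝ᵥ B *ᵥ (P *ᵥ y) := by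
    rw [← sub_dotProduct, hy, sub_sub_cancel, Matrix.mulVec_transpose, ← Matrix.dotProduct_mulVec]
  rw [hsum, hcross, hP, trace_mul_prec hA, ← hP]
  have h1 := hlow (P *ᵥ y)
  have h2 : 2 * c * ((A (x, t) * M).trace / s) ≤ a / s := by
    rw [← mul_div_assoc]
    exact div_le_div_of_nonneg_right htr hs.le
  have hkey : 0 ≤ c * (4 * c * ((P *ᵥ y) ⬝ᵥ A (x, t) *ᵥ (P *ᵥ y)) - (P *ᵥ y) ⬝ᵥ A₀ *ᵥ (P *ᵥ y))
      + (a / s - 2 * c * ((A (x, t) * M).trace / s)) :=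
    add_nonneg (mul_nonneg hc (by linarith)) (by linarith)
  refine le_of_le_of_eq (mul_nonneg hf0 hkey) ?_
  rw [neg_div]
  ring

/-! ### Second derivatives at a maximum -/

open scoped MatrixOrder in
theorem trace_mul_nonneg {ι : Type*} [Fintype ι] [DecidableEq ι] {A H : Matrix ι ι ℝ}
    (hA : A.PosSemidef) (hH : ∀ x : ι → ℝ, 0 ≤ x ⬝ᵥ H *ᵥ x) : 0 ≤ (A * H).trace := by
  obtain ⟨S, hS⟩ := CStarAlgebra.nonneg_iff_eq_star_mul_self.mp hA.nonneg
  rw [hS, Matrix.mul_assoc, Matrix.trace_mul_comm]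
  simp only [Matrix.trace, Matrix.diag_apply]
  apply Finset.sum_nonneg
  intro i _
  have h := hH (S i)
  have : (S * H * star S) i i = S i ⬝ᵥ H *ᵥ S i := by
    rw [Matrix.mul_assoc, Matrix.mul_apply]
    simp [dotProduct, Matrix.mulVec, Matrix.mul_apply, Matrix.star_eq_conjTranspose]
  rw [this]
  exact h

theorem differentiableAt_fderiv {E : Type*} [NormedAddCommGroup E] [NormedSpace ℝ E] {v : E → ℝ}
    {x : E} (hv : ContDiffAt ℝ 2 v x) : DifferentiableAt ℝ (fderiv ℝ v) x :=
  (hv.fderiv_right (m := 1) (by norm_num)).differentiableAt one_ne_zero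

theorem eventually_differentiableAt {E : Type*} [NormedAddCommGroup E] [NormedSpace ℝ E]
    {v : E → ℝ} {x : E} (hv : ContDiffAt ℝ 2 v x) : ∀ᶠ y in 𝓝 x, DifferentiableAt ℝ v y :=
  (hv.eventually (by simp)).mono fun _ h => h.differentiableAt two_ne_zero

theorem fderiv_fderiv_apply {E : Type*} [NormedAddCommGroup E] [NormedSpace ℝ E] {v : E → ℝ}
    {x : E} (hv : ContDiffAt ℝ 2 v x) (d e : E) :
    fderiv ℝ (fun y => fderiv ℝ v y e) x d = fderiv ℝ (fderiv ℝ v) x d e := by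
  rw [fderiv_clm_apply (differentiableAt_fderiv hv) (differentiableAt_const _)]
  simp

/-- A positive second derivative along a line would make the point a local minimum there too, so the
function would be locally constant on the line and the derivative zero. -/
theorem second_fderiv_nonpos_of_isLocalMax {E : Type*} [NormedAddCommGroup E] [NormedSpace ℝ E]
    {v : E → ℝ} {x : E} (hv : ContDiffAt ℝ 2 v x) (hmax : IsLocalMax v x) (d : E) :
    fderiv ℝ (fderiv ℝ v) x d d ≤ 0 := by
  by_contra! hpos
  set L : ℝ → E := fun s => x + s • d with hL
  have hL0 : L 0 = x := by simp [hL]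
  have hLd : ∀ s, HasDerivAt L d s := fun s => by
    have h := ((hasDerivAt_id s).smul_const d).const_add x
    rw [one_smul] at h
    exact h
  have hLc : Tendsto L (𝓝 0) (𝓝 x) := by
    have := (hLd 0).continuousAt.tendsto
    rwa [hL0] at this
  have hd1 : deriv (v ∘ L) =ᶠ[𝓝 0] fun s => fderiv ℝ v (L s) d := by
    filter_upwards [hLc.eventually (eventually_differentiableAt hv)] with s hs
    exact (hs.hasFDerivAt.comp_hasDerivAt s (hLd s)).deriv
  have hd2 : deriv (deriv (v ∘ L)) 0 = fderiv ℝ (fderiv ℝ v) x d d := by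
    rw [hd1.deriv_eq]
    have h1 : HasFDerivAt (fderiv ℝ v) (fderiv ℝ (fderiv ℝ v) x) (L 0) := by
      rw [hL0]
      exact (differentiableAt_fderiv hv).hasFDerivAt
    have h2 := (h1.comp_hasDerivAt 0 (hLd 0)).clm_apply (hasDerivAt_const (0 : ℝ) d)
    simpa using h2.deriv
  have hd0 : deriv (v ∘ L) 0 = 0 := by
    rw [hd1.eq_of_nhds, hL0, hmax.fderiv_eq_zero]
    rfl
  have hcont : ContinuousAt (v ∘ L) 0 := by
    apply ContinuousAt.comp
    · rw [hL0]; exact hv.continuousAt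
    · exact (hLd 0).continuousAt
  have hmin := isLocalMin_of_deriv_deriv_pos (f := v ∘ L) (x₀ := 0) (by rw [hd2]; exact hpos) hd0
    hcont
  have hconst : (v ∘ L) =ᶠ[𝓝 0] fun _ => v x := by
    filter_upwards [hmin, hLc.eventually hmax] with s h1 h2
    simp only [Function.comp, hL0] at h1 ⊢
    exact le_antisymm h2 h1
  have h3 : deriv (v ∘ L) =ᶠ[𝓝 0] fun _ => 0 := by
    filter_upwards [hconst.eventuallyEq_nhds] with s hs
    rw [hs.deriv_eq]
    simp
  rw [← hd2, h3.deriv_eq] at hpos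
  simp at hpos

/-! ### Functions with smooth slices -/

/-- `f` is `C²` in space and differentiable in time at `z`. -/
structure SliceSmooth (f : Pt p → ℝ) (z : Pt p) : Prop where
  space : ContDiffAt ℝ 2 (fun x => f (x, z.2)) z.1
  time : DifferentiableAt ℝ (fun t => f (z.1, t)) z.2

theorem SliceSmooth.of_contDiffAt {f : Pt p → ℝ} {z : Pt p} (hf : ContDiffAt ℝ 2 f z) :
    SliceSmooth f z := by
  constructor
  · exact ContDiffAt.comp (f := fun x => (x, z.2)) z.1 hf (contDiffAt_id.prodMk contDiffAt_const)
  · have h1 : DifferentiableAt ℝ f z := hf.differentiableAt two_ne_zero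
    exact DifferentiableAt.comp (f := fun t => (z.1, t)) z.2 h1
      ((differentiableAt_const _).prodMk differentiableAt_id)

theorem SliceSmooth.add {f g : Pt p → ℝ} {z : Pt p} (hf : SliceSmooth f z)
    (hg : SliceSmooth g z) : SliceSmooth (fun w => f w + g w) z :=
  ⟨hf.space.add hg.space, hf.time.fun_add hg.time⟩

theorem SliceSmooth.const_mul {f : Pt p → ℝ} {z : Pt p} (c : ℝ) (hf : SliceSmooth f z) :
    SliceSmooth (fun w => c * f w) z :=
  ⟨contDiffAt_const.mul hf.space, hf.time.const_mul c⟩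

theorem SliceSmooth.time_mul (c : ℝ) (z : Pt p) : SliceSmooth (fun w : Pt p => c * w.2) z :=
  ⟨contDiffAt_const (c := c * z.2), differentiableAt_id.const_mul c⟩

theorem hess_apply {f : Pt p → ℝ} {z : Pt p} (hf : SliceSmooth f z) (k l : Idx p) :
    hess f z k l = fderiv ℝ (fderiv ℝ fun x => f (x, z.2)) z.1 (EuclideanSpace.single k 1)
      (EuclideanSpace.single l 1) := by
  simp only [hess, Matrix.of_apply]
  exact fderiv_fderiv_apply hf.space _ _

theorem gradient_eq_toDual_symm (v : Space p → ℝ) (x : Space p) :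
    gradient v x = (InnerProductSpace.toDual ℝ (Space p)).symm (fderiv ℝ v x) := rfl

theorem opL_add (B : Matrix (Idx p) (Idx p) ℝ) (A : Pt p → Matrix (Idx p) (Idx p) ℝ)
    {f g : Pt p → ℝ} {z : Pt p} (hf : SliceSmooth f z) (hg : SliceSmooth g z) :
    opL B A (fun w => f w + g w) z = opL B A f z + opL B A g z := by
  have h1 : fderiv ℝ (fun x => f (x, z.2) + g (x, z.2)) =ᶠ[𝓝 z.1]
      fun y => fderiv ℝ (fun x => f (x, z.2)) y + fderiv ℝ (fun x => g (x, z.2)) y := by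
    filter_upwards [eventually_differentiableAt hf.space,
      eventually_differentiableAt hg.space] with y hy1 hy2
    exact fderiv_fun_add hy1 hy2
  have hh : hess (fun w => f w + g w) z = hess f z + hess g z := by
    ext k l
    rw [Matrix.add_apply, hess_apply (hf.add hg), hess_apply hf, hess_apply hg, h1.fderiv_eq,
      fderiv_fun_add (differentiableAt_fderiv hf.space) (differentiableAt_fderiv hg.space)]
    rfl
  have hgr : gradient (fun x => f (x, z.2) + g (x, z.2)) z.1
      = gradient (fun x => f (x, z.2)) z.1 + gradient (fun x => g (x, z.2)) z.1 := by
    simp only [gradient_eq_toDual_symm]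
    rw [h1.eq_of_nhds, map_add]
  simp only [opL]
  rw [hh, hgr, deriv_fun_add hf.time hg.time, Matrix.mul_add, Matrix.trace_add, map_add,
    inner_add_right]
  ring

theorem opL_const_mul (B : Matrix (Idx p) (Idx p) ℝ) (A : Pt p → Matrix (Idx p) (Idx p) ℝ)
    {f : Pt p → ℝ} {z : Pt p} (hf : SliceSmooth f z) (c : ℝ) :
    opL B A (fun w => c * f w) z = c * opL B A f z := by
  have h1 : fderiv ℝ (fun x => c * f (x, z.2)) =ᶠ[𝓝 z.1]
      fun y => c • fderiv ℝ (fun x => f (x, z.2)) y := by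
    filter_upwards [eventually_differentiableAt hf.space] with y hy
    exact fderiv_const_mul hy c
  have hh : hess (fun w => c * f w) z = c • hess f z := by
    ext k l
    rw [Matrix.smul_apply, hess_apply (hf.const_mul c), hess_apply hf, h1.fderiv_eq,
      fderiv_fun_const_smul (differentiableAt_fderiv hf.space)]
    rfl
  have hgr : gradient (fun x => c * f (x, z.2)) z.1 = c • gradient (fun x => f (x, z.2)) z.1 := by
    simp only [gradient_eq_toDual_symm]
    rw [h1.eq_of_nhds, map_smulₛₗ]
    rfl
  simp only [opL]
  rw [hh, hgr, deriv_const_mul_field, Matrix.mul_smul, Matrix.trace_smul, map_smul,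
    inner_smul_right, smul_eq_mul]
  ring

theorem opL_time_mul (B : Matrix (Idx p) (Idx p) ℝ) (A : Pt p → Matrix (Idx p) (Idx p) ℝ)
    (c : ℝ) (z : Pt p) : opL B A (fun w => c * w.2) z = -c := by
  have h1 : hess (fun w : Pt p => c * w.2) z = 0 := by
    ext k l
    simp [hess]
  simp only [opL]
  rw [h1, deriv_const_mul_field]
  simp [gradient_eq_toDual_symm]

theorem sliceSmooth_and_opL_sum_nonneg {ι : Type*} (B : Matrix (Idx p) (Idx p) ℝ)
    (A : Pt p → Matrix (Idx p) (Idx p) ℝ) {z : Pt p} (s : Finset ι) {m : ι → ℝ}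
    (hm : ∀ i ∈ s, 0 ≤ m i) {f : ι → Pt p → ℝ} (hf : ∀ i ∈ s, SliceSmooth (f i) z)
    (hL : ∀ i ∈ s, 0 ≤ opL B A (f i) z) :
    SliceSmooth (fun w => ∑ i ∈ s, m i * f i w) z ∧
      0 ≤ opL B A (fun w => ∑ i ∈ s, m i * f i w) z := by
  classical
  induction s using Finset.induction_on with
  | empty =>
    have h := opL_time_mul B A 0 z
    have h' := SliceSmooth.time_mul 0 z
    simp only [zero_mul, neg_zero] at h h'
    simpa using ⟨h', h.ge⟩
  | insert i s hi ih =>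
    obtain ⟨h1, h2⟩ := ih (fun j hj => hm j (Finset.mem_insert_of_mem hj))
      (fun j hj => hf j (Finset.mem_insert_of_mem hj))
      (fun j hj => hL j (Finset.mem_insert_of_mem hj))
    have hi' := Finset.mem_insert_self i s
    simp only [Finset.sum_insert hi]
    refine ⟨((hf i hi').const_mul (m i)).add h1, ?_⟩
    rw [opL_add B A ((hf i hi').const_mul (m i)) h1, opL_const_mul B A (hf i hi')]
    exact add_nonneg (mul_nonneg (hm i hi') (hL i hi')) h2

/-- Parabolic maximum principle: comparison with past times suffices, as left difference quotients
already give `∂_t f ≥ 0`. The gradient vanishes and the Hessian is nonpositive. -/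
theorem opL_nonpos_of_backward_max (B : Matrix (Idx p) (Idx p) ℝ)
    (A : Pt p → Matrix (Idx p) (Idx p) ℝ) {f : Pt p → ℝ} {z : Pt p} (hA : (A z).PosSemidef)
    (hf : SliceSmooth f z) (hmax : ∀ᶠ w in 𝓝 z, w.2 ≤ z.2 → f w ≤ f z) :
    opL B A f z ≤ 0 := by
  have hlm : IsLocalMax (fun x => f (x, z.2)) z.1 := by
    have hc : Tendsto (fun x : Space p => (x, z.2)) (𝓝 z.1) (𝓝 z) :=
      (Continuous.prodMk_left z.2).tendsto z.1
    filter_upwards [hc.eventually hmax] with x hx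
    exact hx le_rfl
  have hgr : gradient (fun x => f (x, z.2)) z.1 = 0 := by
    rw [gradient_eq_toDual_symm, hlm.fderiv_eq_zero, map_zero]
  have htime : 0 ≤ deriv (fun t => f (z.1, t)) z.2 := by
    have hc : Tendsto (fun t : ℝ => (z.1, t)) (𝓝 z.2) (𝓝 z) :=
      (Continuous.prodMk_right z.1).tendsto z.2
    have hslope : Tendsto (slope (fun t => f (z.1, t)) z.2) (𝓝[<] z.2)
        (𝓝 (deriv (fun t => f (z.1, t)) z.2)) :=
      (hasDerivAt_iff_tendsto_slope.mp hf.time.hasDerivAt).mono_left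
        (nhdsWithin_mono z.2 (fun t (ht : t ∈ Iio z.2) => ne_of_lt ht))
    refine ge_of_tendsto hslope ?_
    filter_upwards [self_mem_nhdsWithin, nhdsWithin_le_nhds (hc.eventually hmax)] with t ht ht2
    rw [slope_def_field]
    exact div_nonneg_of_nonpos (sub_nonpos.mpr (ht2 (le_of_lt ht)))
      (sub_nonpos.mpr (le_of_lt ht))
  have htr : (A z * hess f z).trace ≤ 0 := by
    have h := trace_mul_nonneg (H := -hess f z) hA (fun x => by
      have h1 := second_fderiv_nonpos_of_isLocalMax hf.space hlm (WithLp.toLp 2 x)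
      have h2 : (WithLp.toLp 2 x : Space p) = ∑ k, x k • EuclideanSpace.single k (1 : ℝ) := by
        ext j
        simp [Finset.sum_apply, EuclideanSpace.single, Pi.single_apply]
      have h3 : x ⬝ᵥ hess f z *ᵥ x = fderiv ℝ (fderiv ℝ fun x => f (x, z.2)) z.1
          (WithLp.toLp 2 x) (WithLp.toLp 2 x) := by
        rw [h2]
        simp only [map_sum, map_smul, dotProduct, Matrix.mulVec, hess_apply hf, Finset.mul_sum,
          _root_.sum_apply, _root_.smul_apply, smul_eq_mul]
        rw [Finset.sum_comm]
        refine Finset.sum_congr rfl fun k _ => Finset.sum_congr rfl fun l _ => ?_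
        ring
      rw [Matrix.neg_mulVec, dotProduct_neg, h3]
      linarith)
    rw [Matrix.mul_neg, Matrix.trace_neg] at h
    linarith
  simp only [opL]
  rw [hgr, map_zero, inner_zero_right]
  linarith

theorem sliceSmooth_poleKer {B M : Matrix (Idx p) (Idx p) ℝ} (hM : Mᵀ = M) (c a : ℝ)
    {z ζ : Pt p} (hz : ζ.2 < z.2) : SliceSmooth (fun w => poleKer B M c a w ζ) z := by
  constructor
  · rw [poleKer_slice B M c a ζ hz]
    exact (contDiff_gauss _ _ _ _).contDiffAt
  · exact (hasDerivAt_poleKer hM c a z.1 ζ hz).differentiableAt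

/-! ### Dilations -/

/-- The dilation with weight `2i+1` on the block `i`. -/
def dil (r : ℝ) (y : Idx p → ℝ) : Idx p → ℝ := fun k => r ^ (2 * (k.1 : ℕ) + 1) * y k

theorem dil_inv_dil {r : ℝ} (hr : r ≠ 0) (y : Idx p → ℝ) : dil r⁻¹ (dil r y) = y := by
  funext k
  simp only [dil]
  rw [← mul_assoc, ← mul_pow, inv_mul_cancel₀ hr, one_pow, one_mul]

theorem dil_dil_inv {r : ℝ} (hr : r ≠ 0) (y : Idx p → ℝ) : dil r (dil r⁻¹ y) = y := by
  simpa using dil_inv_dil (inv_ne_zero hr) y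

theorem dil_sub (r : ℝ) (y v : Idx p → ℝ) : dil r (y - v) = dil r y - dil r v := by
  funext k
  simp only [dil, Pi.sub_apply]
  ring

/-- Consecutive blocks have weights differing by `2` and `Bᵀ` raises the block index by one, so the
dilation conjugates `Bᵀ` into `r² Bᵀ`. -/
theorem expE_mulVec_dil {B : Matrix (Idx p) (Idx p) ℝ} (hB : IsDrift B) {r : ℝ} (hr : r ≠ 0)
    (σ : ℝ) (v : Idx p → ℝ) : expE B (r ^ 2 * σ) *ᵥ dil r v = dil r (expE B σ *ᵥ v) := by
  set U : Matrix (Idx p) (Idx p) ℝ := Matrix.diagonal fun k => r ^ (2 * (k.1 : ℕ) + 1) with hU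
  have hdil : ∀ v : Idx p → ℝ, dil r v = U *ᵥ v := fun v => by
    funext k
    simp [hU, Matrix.mulVec_diagonal, dil]
  have hdet : IsUnit U.det := by
    rw [hU, Matrix.det_diagonal, isUnit_iff_ne_zero]
    exact Finset.prod_ne_zero_iff.mpr fun k _ => pow_ne_zero _ hr
  have hunit : IsUnit U := (Matrix.isUnit_iff_isUnit_det U).mpr hdet
  have hcomm : (-((r ^ 2 * σ) • Bᵀ)) * U = U * (-(σ • Bᵀ)) := by
    ext k l
    simp only [hU, Matrix.mul_diagonal, Matrix.diagonal_mul, Matrix.neg_apply, Matrix.smul_apply,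
      Matrix.transpose_apply, smul_eq_mul]
    by_cases h : B l k = 0
    · simp [h]
    · rw [hB.eq_add_one h]
      ring
  have hconj : -((r ^ 2 * σ) • Bᵀ) = U * (-(σ • Bᵀ)) * U⁻¹ := by
    rw [← hcomm, Matrix.mul_nonsing_inv_cancel_right _ _ hdet]
  rw [hdil, hdil, expE, hconj, Matrix.exp_conj _ _ hunit, Matrix.mulVec_mulVec,
    Matrix.nonsing_inv_mul_cancel_right _ _ hdet, Matrix.mulVec_mulVec]
  rfl

theorem prec_quadratic_dil (M : Matrix (Idx p) (Idx p) ℝ) {r : ℝ} (hr : r ≠ 0) (σ : ℝ)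
    (y : Idx p → ℝ) :
    dil r y ⬝ᵥ prec M (r ^ 2 * σ) *ᵥ dil r y = y ⬝ᵥ prec M σ *ᵥ y := by
  simp only [dotProduct, Matrix.mulVec, Finset.mul_sum]
  refine Finset.sum_congr rfl fun k _ => Finset.sum_congr rfl fun l _ => ?_
  simp only [dil, prec, Matrix.of_apply]
  rw [mul_pow, ← pow_mul]
  have h : r ^ (2 * (k.1 : ℕ) + 1) * r ^ (2 * (l.1 : ℕ) + 1)
      = r ^ (2 * ((k.1 : ℕ) + (l.1 : ℕ) + 1)) := by
    rw [← pow_add]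
    congr 1
    ring
  have h0 : r ^ (2 * ((k.1 : ℕ) + (l.1 : ℕ) + 1)) ≠ 0 := pow_ne_zero _ hr
  calc _ = (r ^ (2 * (k.1 : ℕ) + 1) * r ^ (2 * (l.1 : ℕ) + 1))
        / (r ^ (2 * ((k.1 : ℕ) + (l.1 : ℕ) + 1))) *
        (y k * (M k l / σ ^ ((k.1 : ℕ) + (l.1 : ℕ) + 1) * y l)) := by
        rw [mul_comm (r ^ (2 * ((k.1 : ℕ) + (l.1 : ℕ) + 1))), ← div_div]
        ring
    _ = _ := by rw [h, div_self h0, one_mul]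

theorem heatKer_dil (M : Matrix (Idx p) (Idx p) ℝ) (c a : ℝ) {r : ℝ} (hr : 0 < r) (σ : ℝ)
    (y : Idx p → ℝ) :
    heatKer M c a (dil r y) (r ^ 2 * σ) = (r ^ 2) ^ (-a) * heatKer M c a y σ := by
  have hr2 : 0 < r ^ 2 := by positivity
  by_cases hσ : 0 < σ
  · rw [heatKer, heatKer, if_pos (by positivity), if_pos hσ, prec_quadratic_dil M hr.ne',
      Real.mul_rpow hr2.le hσ.le, mul_assoc]
  · have : ¬ 0 < r ^ 2 * σ := by
      rw [mul_pos_iff_of_pos_left hr2]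
      exact hσ
    rw [heatKer, heatKer, if_neg this, if_neg hσ, mul_zero]

/-- The quadratic form of the precision matrix at time `s` in dilated coordinates. -/
theorem prec_quadratic_eq (M : Matrix (Idx p) (Idx p) ℝ) {s : ℝ} (hs : 0 < s)
    (y : Idx p → ℝ) :
    y ⬝ᵥ prec M s *ᵥ y = dil (√s)⁻¹ y ⬝ᵥ M *ᵥ dil (√s)⁻¹ y := by
  have h := prec_quadratic_dil M (Real.sqrt_pos.mpr hs).ne' 1 (dil (√s)⁻¹ y)
  rw [dil_dil_inv (Real.sqrt_pos.mpr hs).ne', mul_one, Real.sq_sqrt hs.le] at h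
  rw [h]
  have : prec M 1 = M := by
    ext k l
    simp [prec]
  rw [this]

theorem dil_dotProduct_self {s : ℝ} (hs : 0 < s) (y : Idx p → ℝ) :
    dil (√s)⁻¹ y ⬝ᵥ dil (√s)⁻¹ y = ∑ k : Idx p, y k ^ 2 / s ^ (2 * (k.1 : ℕ) + 1) := by
  simp only [dotProduct, dil]
  refine Finset.sum_congr rfl fun k _ => ?_
  have : (√s)⁻¹ ^ (2 * (k.1 : ℕ) + 1) * (√s)⁻¹ ^ (2 * (k.1 : ℕ) + 1)
      = (s ^ (2 * (k.1 : ℕ) + 1))⁻¹ := by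
    rw [← mul_pow, ← mul_inv, Real.mul_self_sqrt hs.le, inv_pow]
  rw [mul_mul_mul_comm, this]
  ring

theorem dotProduct_self_div_le_dil {s : ℝ} (hs : 0 < s) (hs1 : s ≤ 1) (y : Idx p → ℝ) :
    (y ⬝ᵥ y) / s ≤ dil (√s)⁻¹ y ⬝ᵥ dil (√s)⁻¹ y := by
  rw [dil_dotProduct_self hs]
  simp only [dotProduct, Finset.sum_div]
  refine Finset.sum_le_sum fun k _ => ?_
  rw [← sq]
  apply div_le_div_of_nonneg_left (sq_nonneg _) (by positivity)
  calc s ^ (2 * (k.1 : ℕ) + 1) ≤ s ^ 1 := pow_le_pow_of_le_one hs.le hs1 (by omega)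
    _ = s := pow_one s

theorem dil_le_of_le {s m : ℝ} (hm : 0 < m) (hm1 : m ≤ 1) (hs : m ≤ s) (y : Idx p → ℝ) :
    dil (√s)⁻¹ y ⬝ᵥ dil (√s)⁻¹ y ≤ (y ⬝ᵥ y) / m ^ (2 * n + 1) := by
  rw [dil_dotProduct_self (hm.trans_le hs)]
  simp only [dotProduct, Finset.sum_div]
  refine Finset.sum_le_sum fun k _ => ?_
  rw [← sq]
  apply div_le_div_of_nonneg_left (sq_nonneg _) (by positivity)
  calc m ^ (2 * n + 1) ≤ m ^ (2 * (k.1 : ℕ) + 1) :=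
        pow_le_pow_of_le_one hm.le hm1 (by have := k.1.2; omega)
    _ ≤ _ := by gcongr

/-! ### Pointwise bounds for the kernel -/

theorem heatKer_nonneg (M : Matrix (Idx p) (Idx p) ℝ) (c a : ℝ) (y : Idx p → ℝ) (s : ℝ) :
    0 ≤ heatKer M c a y s := by
  unfold heatKer
  split_ifs <;> positivity

/-- The bound `e^{-x} ≤ k!/x^k` trades Gaussian decay for a power of `s`. Taking `k > a` gives decay
to zero off the pole, and `k ≥ a` gives a bound uniform in `s ≤ 1`. -/
theorem heatKer_le {M : Matrix (Idx p) (Idx p) ℝ} {c a μ : ℝ} (hc : 0 < c) (hμ : 0 < μ)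
    (hM : ∀ v : Idx p → ℝ, μ * (v ⬝ᵥ v) ≤ v ⬝ᵥ M *ᵥ v) (k : ℕ) {y : Idx p → ℝ}
    (hy : 0 < y ⬝ᵥ y) {s : ℝ} (hs : 0 < s) (hs1 : s ≤ 1) :
    heatKer M c a y s ≤ k.factorial / (c * μ * (y ⬝ᵥ y)) ^ k * s ^ ((k : ℝ) - a) := by
  rw [heatKer, if_pos hs]
  set x := c * μ * (y ⬝ᵥ y) / s with hx
  have hx0 : 0 < x := by positivity
  have h1 : x ≤ c * (y ⬝ᵥ prec M s *ᵥ y) := by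
    rw [prec_quadratic_eq M hs]
    have h2 := dotProduct_self_div_le_dil hs hs1 y
    have h3 := hM (dil (√s)⁻¹ y)
    calc x = c * (μ * ((y ⬝ᵥ y) / s)) := by rw [hx]; ring
      _ ≤ c * (μ * (dil (√s)⁻¹ y ⬝ᵥ dil (√s)⁻¹ y)) := by gcongr
      _ ≤ _ := by gcongr
  have h2 : Real.exp (-(c * (y ⬝ᵥ prec M s *ᵥ y))) ≤ k.factorial / x ^ k := by
    calc Real.exp (-(c * (y ⬝ᵥ prec M s *ᵥ y))) ≤ Real.exp (-x) :=
          Real.exp_le_exp.mpr (neg_le_neg h1)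
      _ = (Real.exp x)⁻¹ := Real.exp_neg x
      _ ≤ (x ^ k / k.factorial)⁻¹ := by
          apply inv_anti₀ (by positivity)
          exact Real.pow_div_factorial_le_exp x hx0.le k
      _ = _ := inv_div _ _
  calc s ^ (-a) * Real.exp (-(c * (y ⬝ᵥ prec M s *ᵥ y))) ≤ s ^ (-a) * (k.factorial / x ^ k) := by
        gcongr
    _ = _ := by
        rw [sub_eq_neg_add, Real.rpow_add hs, Real.rpow_natCast, hx, div_pow]
        field_simp

theorem le_heatKer {M : Matrix (Idx p) (Idx p) ℝ} {c a μ : ℝ} (hc : 0 ≤ c) (ha : 0 ≤ a)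
    (hμ : 0 ≤ μ) (hM : ∀ v : Idx p → ℝ, v ⬝ᵥ M *ᵥ v ≤ μ * (v ⬝ᵥ v)) {y : Idx p → ℝ}
    {R m s : ℝ} (hy : y ⬝ᵥ y ≤ R) (hm : 0 < m) (hms : m ≤ s) (hs1 : s ≤ 1) :
    Real.exp (-(c * (μ * (R / m ^ (2 * n + 1))))) ≤ heatKer M c a y s := by
  have hs : 0 < s := hm.trans_le hms
  rw [heatKer, if_pos hs]
  have h1 : (1 : ℝ) ≤ s ^ (-a) := Real.one_le_rpow_of_pos_of_le_one_of_nonpos hs hs1 (by linarith)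
  have h2 : y ⬝ᵥ prec M s *ᵥ y ≤ μ * (R / m ^ (2 * n + 1)) := by
    rw [prec_quadratic_eq M hs]
    refine (hM _).trans ?_
    refine mul_le_mul_of_nonneg_left ?_ hμ
    refine (dil_le_of_le hm (hms.trans hs1) hms y).trans ?_
    gcongr
  calc Real.exp (-(c * (μ * (R / m ^ (2 * n + 1)))))
      ≤ Real.exp (-(c * (y ⬝ᵥ prec M s *ᵥ y))) :=
        Real.exp_le_exp.mpr (neg_le_neg (mul_le_mul_of_nonneg_left h2 hc))
    _ ≤ _ := le_mul_of_one_le_left (Real.exp_pos _).le h1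

/-! ### Continuity and measurability -/

theorem continuousOn_prec_quadratic (M : Matrix (Idx p) (Idx p) ℝ) :
    ContinuousOn (fun q : (Idx p → ℝ) × ℝ => q.1 ⬝ᵥ prec M q.2 *ᵥ q.1) {q | 0 < q.2} := by
  simp only [dotProduct, Matrix.mulVec, prec, Matrix.of_apply]
  refine continuousOn_finsetSum _ fun k _ => ContinuousOn.mul (by fun_prop) ?_
  refine continuousOn_finsetSum _ fun l _ => ContinuousOn.mul ?_ (by fun_prop)
  exact ContinuousOn.div (by fun_prop) (by fun_prop) fun q hq => pow_ne_zero _ (ne_of_gt hq)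

/-- Only time zero off the pole is delicate: there the extension by zero is continuous because
`heatKer_le` with `k > a` squeezes the kernel. -/
theorem continuousAt_heatKer {M : Matrix (Idx p) (Idx p) ℝ} {c a μ : ℝ} (hc : 0 < c)
    (hμ : 0 < μ) (hM : ∀ v : Idx p → ℝ, μ * (v ⬝ᵥ v) ≤ v ⬝ᵥ M *ᵥ v) {q : (Idx p → ℝ) × ℝ}
    (hq : q ≠ 0) : ContinuousAt (fun q : (Idx p → ℝ) × ℝ => heatKer M c a q.1 q.2) q := by
  rcases lt_trichotomy q.2 0 with h | h | h
  · have hev : (fun q : (Idx p → ℝ) × ℝ => heatKer M c a q.1 q.2) =ᶠ[𝓝 q] fun _ => 0 := by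
      filter_upwards [(isOpen_lt continuous_snd continuous_const).mem_nhds h] with w hw
      exact if_neg (not_lt.mpr (le_of_lt hw))
    exact continuousAt_const.congr hev.symm
  · have hy : q.1 ≠ 0 := fun h0 => hq (Prod.ext h0 h)
    have hyy : 0 < q.1 ⬝ᵥ q.1 := by
      refine lt_of_le_of_ne ?_ (Ne.symm (mt dotProduct_self_eq_zero.mp hy))
      simp only [dotProduct]
      exact Finset.sum_nonneg fun i _ => mul_self_nonneg _
    have hdc : Continuous fun w : (Idx p → ℝ) × ℝ => w.1 ⬝ᵥ w.1 :=
      continuous_fst.dotProduct continuous_fst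
    obtain ⟨k, hk⟩ := exists_nat_gt (max a 0)
    have hk0 : 0 < (k : ℝ) - a := by
      have := le_max_left a 0
      linarith
    have hval : heatKer M c a q.1 q.2 = 0 := if_neg (by rw [h]; exact lt_irrefl _)
    have hle : ∀ᶠ w : (Idx p → ℝ) × ℝ in 𝓝 q, heatKer M c a w.1 w.2
        ≤ k.factorial / (c * μ * (w.1 ⬝ᵥ w.1)) ^ k * |w.2| ^ ((k : ℝ) - a) := by
      filter_upwards [hdc.continuousAt.eventually (lt_mem_nhds hyy),
        (isOpen_lt continuous_snd continuous_const).mem_nhds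
          (show q.2 < 1 by rw [h]; exact one_pos)] with w hw1 hw2
      by_cases hw : 0 < w.2
      · rw [abs_of_pos hw]
        exact heatKer_le hc hμ hM k hw1 hw (le_of_lt hw2)
      · rw [heatKer, if_neg hw]
        positivity
    have hlim : Tendsto (fun w : (Idx p → ℝ) × ℝ =>
        k.factorial / (c * μ * (w.1 ⬝ᵥ w.1)) ^ k * |w.2| ^ ((k : ℝ) - a)) (𝓝 q) (𝓝 0) := by
      have h1 : ContinuousAt (fun w : (Idx p → ℝ) × ℝ =>
          k.factorial / (c * μ * (w.1 ⬝ᵥ w.1)) ^ k * |w.2| ^ ((k : ℝ) - a)) q := by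
        refine ContinuousAt.mul (ContinuousAt.div continuousAt_const
          ((continuous_const.mul hdc).pow k).continuousAt (by positivity)) ?_
        exact (continuous_snd.abs.continuousAt).rpow_const (Or.inr hk0.le)
      have h2 := h1.tendsto
      rwa [h, abs_zero, Real.zero_rpow hk0.ne', mul_zero] at h2
    rw [ContinuousAt, hval]
    exact tendsto_of_tendsto_of_tendsto_of_le_of_le' tendsto_const_nhds hlim
      (Eventually.of_forall fun w => heatKer_nonneg _ _ _ _ _) hle
  · have hmem : {w : (Idx p → ℝ) × ℝ | 0 < w.2} ∈ 𝓝 q :=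
      (isOpen_lt continuous_const continuous_snd).mem_nhds h
    have hev : (fun q : (Idx p → ℝ) × ℝ => heatKer M c a q.1 q.2) =ᶠ[𝓝 q]
        fun q => q.2 ^ (-a) * Real.exp (-(c * (q.1 ⬝ᵥ prec M q.2 *ᵥ q.1))) := by
      filter_upwards [hmem] with w hw
      exact if_pos hw
    refine ContinuousAt.congr ?_ hev.symm
    refine ContinuousAt.mul (continuous_snd.continuousAt.rpow_const (Or.inl h.ne')) ?_
    have h1 : ContinuousAt (fun q : (Idx p → ℝ) × ℝ => q.1 ⬝ᵥ prec M q.2 *ᵥ q.1) q :=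
      (continuousOn_prec_quadratic M).continuousAt hmem
    exact (h1.const_mul c).neg.rexp

theorem continuous_poleKer_arg (B : Matrix (Idx p) (Idx p) ℝ) :
    Continuous fun w : Pt p × Pt p =>
      (w.1.1.ofLp - expE B (w.1.2 - w.2.2) *ᵥ w.2.1.ofLp, w.1.2 - w.2.2) := by
  have h1 : Continuous fun w : Pt p × Pt p => w.1.1.ofLp :=
    (PiLp.continuous_ofLp 2 _).comp (continuous_fst.comp continuous_fst)
  have h2 : Continuous fun w : Pt p × Pt p => w.2.1.ofLp :=
    (PiLp.continuous_ofLp 2 _).comp (continuous_fst.comp continuous_snd)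
  have h3 : Continuous fun w : Pt p × Pt p => w.1.2 - w.2.2 := by fun_prop
  exact (h1.sub (((continuous_expE B).comp h3).matrix_mulVec h2)).prodMk h3

theorem continuousAt_poleKer (B : Matrix (Idx p) (Idx p) ℝ) {M : Matrix (Idx p) (Idx p) ℝ}
    {c a μ : ℝ} (hc : 0 < c) (hμ : 0 < μ)
    (hM : ∀ v : Idx p → ℝ, μ * (v ⬝ᵥ v) ≤ v ⬝ᵥ M *ᵥ v) {w : Pt p × Pt p} (hw : w.1 ≠ w.2) :
    ContinuousAt (fun w : Pt p × Pt p => poleKer B M c a w.1 w.2) w := by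
  have hne : (w.1.1.ofLp - expE B (w.1.2 - w.2.2) *ᵥ w.2.1.ofLp, w.1.2 - w.2.2) ≠ 0 := by
    intro h0
    have h1 : w.1.2 - w.2.2 = 0 := congrArg Prod.snd h0
    have h2 : w.1.1.ofLp - expE B (w.1.2 - w.2.2) *ᵥ w.2.1.ofLp = 0 := congrArg Prod.fst h0
    rw [h1, expE_zero, Matrix.one_mulVec, sub_eq_zero] at h2
    exact hw (Prod.ext (WithLp.ofLp_injective 2 h2) (sub_eq_zero.mp h1))
  exact ContinuousAt.comp (g := fun q : (Idx p → ℝ) × ℝ => heatKer M c a q.1 q.2)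
    (f := fun w : Pt p × Pt p =>
      (w.1.1.ofLp - expE B (w.1.2 - w.2.2) *ᵥ w.2.1.ofLp, w.1.2 - w.2.2))
    (continuousAt_heatKer hc hμ hM hne) (continuous_poleKer_arg B).continuousAt

theorem measurable_heatKer (M : Matrix (Idx p) (Idx p) ℝ) (c a : ℝ) :
    Measurable fun q : (Idx p → ℝ) × ℝ => heatKer M c a q.1 q.2 := by
  unfold heatKer
  simp only [dotProduct, Matrix.mulVec, prec, Matrix.of_apply]
  refine Measurable.ite (measurableSet_lt measurable_const measurable_snd) ?_ measurable_const
  refine (measurable_snd.pow_const _).mul (Measurable.exp (Measurable.neg (Measurable.const_mul ?_ c)))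
  refine Finset.measurable_fun_sum _ fun k _ => Measurable.mul (by fun_prop) ?_
  refine Finset.measurable_fun_sum _ fun l _ => Measurable.mul ?_ (by fun_prop)
  exact measurable_const.div (by fun_prop)

theorem measurable_poleKer (B M : Matrix (Idx p) (Idx p) ℝ) (c a : ℝ) (z : Pt p) :
    Measurable fun ζ => poleKer B M c a z ζ :=
  (measurable_heatKer M c a).comp
    (((continuous_poleKer_arg B).comp (Continuous.prodMk_right z)).measurable)

/-! ### Integral bound for the kernel -/

theorem expE_det_ne_zero (B : Matrix (Idx p) (Idx p) ℝ) (s : ℝ) : (expE B s).det ≠ 0 := by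
  intro h
  have h1 : (expE B s * expE B (-s)).det = 1 := by
    rw [← expE_add, add_neg_cancel, expE_zero, Matrix.det_one]
  rw [Matrix.det_mul, h, zero_mul] at h1
  exact zero_ne_one h1

theorem prod_pow_weight (r : ℝ) :
    ∏ k : Idx p, r ^ (2 * (k.1 : ℕ) + 1) = r ^ homDim p := by
  rw [Finset.prod_pow_eq_pow_sum]
  congr 1
  rw [Fintype.sum_sigma]
  simp only [Finset.sum_const, Finset.card_univ, Fintype.card_fin, homDim, smul_eq_mul]
  exact Finset.sum_congr rfl fun i _ => by ring

theorem det_toEuclideanLin (T : Matrix (Idx p) (Idx p) ℝ) :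
    LinearMap.det (Matrix.toEuclideanLin T : Space p →ₗ[ℝ] Space p) = T.det := by
  rw [Matrix.toEuclideanLin, Matrix.toLpLin_eq_toLin, LinearMap.det_toLin]

theorem integrable_exp_neg_mul_norm_sq {κ : ℝ} (hκ : 0 < κ) :
    Integrable (fun w : Space p => Real.exp (-(κ * ‖w‖ ^ 2))) := by
  have h := (GaussianFourier.integrable_cexp_neg_mul_sq_norm_add (b := (κ : ℂ)) (V := Space p)
    (by simpa using hκ) 0 0).norm
  refine h.congr (Eventually.of_forall fun w => ?_)
  simp only [zero_mul, add_zero, Complex.norm_exp]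
  congr 1
  norm_cast
  ring

theorem lintegral_exp_neg_norm_sub_comp (κ : ℝ) {T : Matrix (Idx p) (Idx p) ℝ}
    (hT : T.det ≠ 0) (X : Space p) :
    ∫⁻ ξ : Space p, ENNReal.ofReal
        (Real.exp (-(κ * ‖X - (Matrix.toEuclideanLin T ξ : Space p)‖ ^ 2)))
      = ENNReal.ofReal |T.det⁻¹| * ∫⁻ w : Space p, ENNReal.ofReal (Real.exp (-(κ * ‖w‖ ^ 2))) := by
  have hdet : LinearMap.det (Matrix.toEuclideanLin T : Space p →ₗ[ℝ] Space p) ≠ 0 := by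
    rw [det_toEuclideanLin]
    exact hT
  have hmap := Measure.map_linearMap_addHaar_eq_smul_addHaar (volume : Measure (Space p)) hdet
  rw [det_toEuclideanLin] at hmap
  have hmeas : Measurable fun w : Space p => ENNReal.ofReal (Real.exp (-(κ * ‖X - w‖ ^ 2))) := by
    fun_prop
  have hTm : Measurable (Matrix.toEuclideanLin T : Space p →ₗ[ℝ] Space p) :=
    (LinearMap.continuous_of_finiteDimensional _).measurable
  rw [← lintegral_map hmeas hTm, hmap, lintegral_smul_measure, smul_eq_mul]
  congr 1
  exact lintegral_sub_left_eq_self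
    (fun w : Space p => ENNReal.ofReal (Real.exp (-(κ * ‖w‖ ^ 2)))) X

/-- Dilating by `√s` yields a fixed Gaussian and the Jacobian `s^{Q/2}`, so `s^{-(Q+1)/2}` becomes
the time-integrable `s^{-1/2}`. The constant depends on `M` only through its lower bound `μ`. -/
theorem exists_lintegral_heatKer_le {B : Matrix (Idx p) (Idx p) ℝ} (hB : IsDrift B) {c μ : ℝ}
    (hc : 0 < c) (hμ : 0 < μ) :
    ∃ J : ℝ, 0 < J ∧ ∀ M : Matrix (Idx p) (Idx p) ℝ,
      (∀ v : Idx p → ℝ, μ * (v ⬝ᵥ v) ≤ v ⬝ᵥ M *ᵥ v) → ∀ (x : Idx p → ℝ) (s : ℝ), 0 < s →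
      ∫⁻ ξ : Space p, ENNReal.ofReal
          (heatKer M c (((homDim p : ℝ) + 1) / 2) (x - expE B s *ᵥ ξ.ofLp) s)
        ≤ ENNReal.ofReal (J * s ^ (-(1 / 2) : ℝ)) := by
  set κ := c * μ with hκ
  have hκ0 : 0 < κ := mul_pos hc hμ
  set J₀ := ∫ w : Space p, Real.exp (-(κ * ‖w‖ ^ 2)) with hJ₀
  have hint := integrable_exp_neg_mul_norm_sq (p := p) hκ0
  have hJ₀' : ∫⁻ w : Space p, ENNReal.ofReal (Real.exp (-(κ * ‖w‖ ^ 2))) = ENNReal.ofReal J₀ :=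
    (ofReal_integral_eq_lintegral_ofReal hint
      (Eventually.of_forall fun w => (Real.exp_pos _).le)).symm
  have hJ₀0 : 0 ≤ J₀ := integral_nonneg fun w => (Real.exp_pos _).le
  -- The summand `1` only guarantees positivity.
  refine ⟨|(expE B 1).det⁻¹| * J₀ + 1, by positivity, fun M hM x s hs => ?_⟩
  have hrs : 0 < √s := Real.sqrt_pos.mpr hs
  set T : Matrix (Idx p) (Idx p) ℝ :=
    expE B 1 * Matrix.diagonal fun k => (√s)⁻¹ ^ (2 * (k.1 : ℕ) + 1) with hT
  have hTdet : T.det = (expE B 1).det * (√s)⁻¹ ^ homDim p := by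
    rw [hT, Matrix.det_mul, Matrix.det_diagonal, prod_pow_weight]
  have hT0 : T.det ≠ 0 := by
    rw [hTdet]
    exact mul_ne_zero (expE_det_ne_zero B 1) (pow_ne_zero _ (inv_ne_zero hrs.ne'))
  set X : Space p := WithLp.toLp 2 (dil (√s)⁻¹ x) with hX
  have hTξ : ∀ ξ : Space p, dil (√s)⁻¹ (x - expE B s *ᵥ ξ.ofLp)
      = (X - (Matrix.toEuclideanLin T ξ : Space p)).ofLp := by
    intro ξ
    have h1 := expE_mulVec_dil hB hrs.ne' 1 (dil (√s)⁻¹ ξ.ofLp)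
    rw [dil_dil_inv hrs.ne', mul_one, Real.sq_sqrt hs.le] at h1
    rw [h1, dil_sub, dil_inv_dil hrs.ne', WithLp.ofLp_sub, hX]
    have h2 : (Matrix.toEuclideanLin T ξ : Space p).ofLp = T *ᵥ ξ.ofLp := rfl
    rw [h2, hT, ← Matrix.mulVec_mulVec]
    congr 2
    funext k
    simp [Matrix.mulVec_diagonal, dil]
  have hle : ∀ ξ : Space p, ENNReal.ofReal
      (heatKer M c (((homDim p : ℝ) + 1) / 2) (x - expE B s *ᵥ ξ.ofLp) s)
      ≤ ENNReal.ofReal (s ^ (-(((homDim p : ℝ) + 1) / 2))) * ENNReal.ofReal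
        (Real.exp (-(κ * ‖X - (Matrix.toEuclideanLin T ξ : Space p)‖ ^ 2))) := by
    intro ξ
    rw [← ENNReal.ofReal_mul (by positivity)]
    apply ENNReal.ofReal_le_ofReal
    rw [heatKer, if_pos hs]
    apply mul_le_mul_of_nonneg_left _ (by positivity)
    apply Real.exp_le_exp.mpr
    rw [prec_quadratic_eq M hs, neg_le_neg_iff, hκ, mul_assoc]
    apply mul_le_mul_of_nonneg_left _ hc.le
    refine le_trans ?_ (hM _)
    rw [hTξ, dotProduct_self_eq_norm_sq]
  refine (lintegral_mono hle).trans ?_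
  rw [lintegral_const_mul' _ _ ENNReal.ofReal_ne_top, lintegral_exp_neg_norm_sub_comp κ hT0, hJ₀',
    ← ENNReal.ofReal_mul (abs_nonneg _), ← ENNReal.ofReal_mul (by positivity)]
  apply ENNReal.ofReal_le_ofReal
  have hpow : s ^ (-(((homDim p : ℝ) + 1) / 2)) * |T.det⁻¹|
      = |(expE B 1).det⁻¹| * s ^ (-(1 / 2) : ℝ) := by
    have h1 : (√s) ^ homDim p = s ^ ((homDim p : ℝ) / 2) := by
      rw [Real.sqrt_eq_rpow, ← Real.rpow_natCast, ← Real.rpow_mul hs.le]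
      congr 1
      ring
    rw [hTdet, mul_inv, ← inv_pow, inv_inv, abs_mul, abs_of_pos (pow_pos hrs _), h1,
      mul_left_comm, ← Real.rpow_add hs]
    congr 2
    ring
  rw [← mul_assoc, hpow]
  have : 0 ≤ s ^ (-(1 / 2) : ℝ) := by positivity
  nlinarith

theorem lintegral_inv_sqrt_le {J : ℝ} (hJ : 0 ≤ J) (t : ℝ) {δ : ℝ} (hδ : 0 < δ) :
    ∫⁻ τ in Ioo (t - δ) t, ENNReal.ofReal (J * (t - τ) ^ (-(1 / 2) : ℝ))
      ≤ ENNReal.ofReal (J * (2 * √δ)) := by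
  have hii : IntervalIntegrable (fun s : ℝ => s ^ (-(1 / 2) : ℝ)) volume 0 δ :=
    intervalIntegral.intervalIntegrable_rpow' (by norm_num)
  have hii2 : IntervalIntegrable (fun τ : ℝ => J * (t - τ) ^ (-(1 / 2) : ℝ)) volume (t - δ) t := by
    have h := (hii.comp_sub_left t).symm.const_mul J
    simpa using h
  have hle : t - δ ≤ t := by linarith
  have hint : IntegrableOn (fun τ : ℝ => J * (t - τ) ^ (-(1 / 2) : ℝ)) (Ioo (t - δ) t) :=
    ((intervalIntegrable_iff_integrableOn_Ioc_of_le hle).mp hii2).mono_set Ioo_subset_Ioc_self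
  rw [← ofReal_integral_eq_lintegral_ofReal hint]
  · apply ENNReal.ofReal_le_ofReal
    rw [← integral_Ioc_eq_integral_Ioo, ← intervalIntegral.integral_of_le hle,
      intervalIntegral.integral_const_mul,
      intervalIntegral.integral_comp_sub_left (fun s : ℝ => s ^ (-(1 / 2) : ℝ)) t, sub_self,
      sub_sub_cancel, integral_rpow (Or.inl (by norm_num)), Real.sqrt_eq_rpow]
    apply mul_le_mul_of_nonneg_left _ hJ
    norm_num
    linarith
  · filter_upwards [self_mem_ae_restrict measurableSet_Ioo] with τ hτ
    have : 0 ≤ t - τ := by linarith [hτ.2]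
    simp only [Pi.zero_apply]
    positivity

theorem lintegral_poleKer_le {B M : Matrix (Idx p) (Idx p) ℝ} {c a J : ℝ} (hJ : 0 ≤ J)
    (h : ∀ (x : Idx p → ℝ) (s : ℝ), 0 < s →
      ∫⁻ ξ : Space p, ENNReal.ofReal (heatKer M c a (x - expE B s *ᵥ ξ.ofLp) s)
        ≤ ENNReal.ofReal (J * s ^ (-(1 / 2) : ℝ))) (z : Pt p) {δ : ℝ} (hδ : 0 < δ) :
    ∫⁻ ζ in (univ : Set (Space p)) ×ˢ Ioo (z.2 - δ) z.2, ENNReal.ofReal (poleKer B M c a z ζ)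
      ≤ ENNReal.ofReal (J * (2 * √δ)) := by
  rw [Measure.volume_eq_prod, ← Measure.prod_restrict, Measure.restrict_univ,
    lintegral_prod_symm]
  · refine le_trans ?_ (lintegral_inv_sqrt_le hJ z.2 hδ)
    refine setLIntegral_mono' measurableSet_Ioo fun τ hτ => ?_
    exact h z.1.ofLp (z.2 - τ) (sub_pos.mpr hτ.2)
  · exact ((measurable_poleKer B M c a z).ennreal_ofReal).aemeasurable

/-! ### The homogeneous norm -/

theorem continuous_blk (i : Fin (n + 1)) : Continuous fun x : Space p => blk x i :=
  (PiLp.continuous_toLp 2 _).comp (continuous_pi fun a => by fun_prop)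

theorem continuous_normB : Continuous (normB : Space p → ℝ) := by
  unfold normB
  exact continuous_finsetSum _ fun i _ =>
    (continuous_blk i).norm.rpow_const fun x => Or.inr (by positivity)

theorem normB_nonneg (x : Space p) : 0 ≤ normB x :=
  Finset.sum_nonneg fun i _ => by positivity

theorem norm_sq_eq_sum_blk (x : Space p) : ‖x‖ ^ 2 = ∑ i, ‖blk x i‖ ^ 2 := by
  rw [EuclideanSpace.norm_sq_eq, Fintype.sum_sigma]
  refine Finset.sum_congr rfl fun i _ => ?_
  rw [EuclideanSpace.norm_sq_eq]
  rfl

theorem norm_blk_le_normB_pow (x : Space p) (i : Fin (n + 1)) :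
    ‖blk x i‖ ≤ normB x ^ (2 * (i : ℕ) + 1) := by
  have h : ‖blk x i‖ ^ (1 / (2 * ((i : ℕ) : ℝ) + 1)) ≤ normB x :=
    Finset.single_le_sum (f := fun j : Fin (n + 1) =>
      ‖blk x j‖ ^ (1 / (2 * ((j : ℕ) : ℝ) + 1))) (fun j _ => by positivity) (Finset.mem_univ i)
  have h2 := pow_le_pow_left₀ (by positivity) h (2 * (i : ℕ) + 1)
  refine le_trans (le_of_eq ?_) h2
  rw [← Real.rpow_natCast, ← Real.rpow_mul (norm_nonneg _)]
  have : (1 / (2 * ((i : ℕ) : ℝ) + 1)) * ((2 * (i : ℕ) + 1 : ℕ) : ℝ) = 1 := by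
    push_cast
    field_simp
  rw [this, Real.rpow_one]

/-- The squared Euclidean radius of the ball `{|x|_B ≤ ρ}`. -/
def radSq (n : ℕ) (ρ : ℝ) : ℝ := ∑ i : Fin (n + 1), (ρ ^ (2 * (i : ℕ) + 1)) ^ 2

theorem radSq_nonneg (n : ℕ) (ρ : ℝ) : 0 ≤ radSq n ρ :=
  Finset.sum_nonneg fun _ _ => sq_nonneg _

theorem norm_sq_le_radSq {x : Space p} {ρ : ℝ} (h : normB x ≤ ρ) : ‖x‖ ^ 2 ≤ radSq n ρ := by
  rw [norm_sq_eq_sum_blk]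
  refine Finset.sum_le_sum fun i _ => ?_
  refine pow_le_pow_left₀ (norm_nonneg _) ((norm_blk_le_normB_pow x i).trans ?_) 2
  exact pow_le_pow_left₀ (normB_nonneg x) h _

theorem normB_le_mul_max (x : Space p) : normB x ≤ (n + 1) * max 1 ‖x‖ := by
  have h : ∀ i ∈ (Finset.univ : Finset (Fin (n + 1))),
      ‖blk x i‖ ^ (1 / (2 * ((i : ℕ) : ℝ) + 1)) ≤ max 1 ‖x‖ := by
    intro i _
    have h1 : ‖blk x i‖ ≤ ‖x‖ := by
      apply le_of_sq_le_sq _ (norm_nonneg _)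
      rw [norm_sq_eq_sum_blk x]
      exact Finset.single_le_sum (f := fun j => ‖blk x j‖ ^ 2) (fun j _ => sq_nonneg _)
        (Finset.mem_univ i)
    have h2 : (1 : ℝ) / (2 * ((i : ℕ) : ℝ) + 1) ≤ 1 := by
      rw [div_le_one (by positivity)]
      have : (0 : ℝ) ≤ ((i : ℕ) : ℝ) := by positivity
      linarith
    calc ‖blk x i‖ ^ (1 / (2 * ((i : ℕ) : ℝ) + 1))
        ≤ (max 1 ‖x‖) ^ (1 / (2 * ((i : ℕ) : ℝ) + 1)) := by
          apply Real.rpow_le_rpow (norm_nonneg _) (h1.trans (le_max_right _ _)) (by positivity)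
      _ ≤ (max 1 ‖x‖) ^ (1 : ℝ) := Real.rpow_le_rpow_of_exponent_le (le_max_left _ _) h2
      _ = _ := Real.rpow_one _
  have h3 := Finset.sum_le_card_nsmul _ _ _ h
  simpa [normB] using h3

theorem normB_dil {r : ℝ} (hr : 0 ≤ r) (y : Idx p → ℝ) :
    normB (WithLp.toLp 2 (dil r y) : Space p) = r * normB (WithLp.toLp 2 y : Space p) := by
  simp only [normB, Finset.mul_sum]
  refine Finset.sum_congr rfl fun i _ => ?_
  have h : blk (WithLp.toLp 2 (dil r y) : Space p) i
      = r ^ (2 * (i : ℕ) + 1) • blk (WithLp.toLp 2 y : Space p) i := by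
    ext a
    simp [blk, dil]
  rw [h, norm_smul, Real.norm_of_nonneg (by positivity), Real.mul_rpow (by positivity)
    (norm_nonneg _), ← Real.rpow_natCast, ← Real.rpow_mul hr]
  have : ((2 * (i : ℕ) + 1 : ℕ) : ℝ) * (1 / (2 * ((i : ℕ) : ℝ) + 1)) = 1 := by
    push_cast
    field_simp
  rw [this, Real.rpow_one]

theorem normB_zero : normB (0 : Space p) = 0 := by
  apply le_antisymm _ (normB_nonneg _)
  have := normB_dil (p := p) (r := 0) le_rfl 0
  rw [zero_mul] at this
  have h0 : (WithLp.toLp 2 (dil 0 0) : Space p) = 0 := by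
    ext k
    simp [dil]
  rw [← this, h0]

theorem isCompact_normB_le (ρ : ℝ) : IsCompact {x : Space p | normB x ≤ ρ} := by
  apply Metric.isCompact_of_isClosed_isBounded
  · exact isClosed_le continuous_normB continuous_const
  · refine (Metric.isBounded_closedBall (x := (0 : Space p)) (r := √(radSq n ρ))).subset ?_
    intro x hx
    rw [mem_closedBall_zero_iff]
    exact Real.le_sqrt_of_sq_le (norm_sq_le_radSq hx)

theorem sphere_nonempty (hp : ∀ i, 1 ≤ p i) : (Metric.sphere (0 : Space p) 1).Nonempty := by
  refine ⟨EuclideanSpace.single (⟨0, ⟨0, hp 0⟩⟩ : Idx p) 1, ?_⟩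
  simp

theorem sigmaMin_pos (hp : ∀ i, 1 ≤ p i) : 0 < sigmaMin p := by
  have hK : IsCompact (normB '' Metric.sphere (0 : Space p) 1) :=
    (isCompact_sphere _ _).image continuous_normB
  obtain ⟨x, hx, hxe⟩ := hK.sInf_mem ((sphere_nonempty hp).image _)
  rw [sigmaMin, ← hxe]
  refine lt_of_le_of_ne (normB_nonneg x) fun h0 => ?_
  have h1 := norm_sq_le_radSq (x := x) h0.symm.le
  have h2 : radSq n 0 = 0 := by simp [radSq]
  rw [h2, mem_sphere_zero_iff_norm.mp hx] at h1
  norm_num at h1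

theorem sigmaMin_le_sigmaMax : sigmaMin p ≤ sigmaMax p := by
  have hK : IsCompact (normB '' Metric.sphere (0 : Space p) 1) :=
    (isCompact_sphere _ _).image continuous_normB
  exact Real.sInf_le_sSup _ hK.bddBelow hK.bddAbove

theorem IsTimeScale.le_one (hp : ∀ i, 1 ≤ p i) {B : Matrix (Idx p) (Idx p) ℝ} {b : ℝ}
    (hb : IsTimeScale B b) : b ≤ 1 := by
  refine hb.le.trans ?_
  have h0 := sigmaMin_pos hp
  have h1 := sigmaMin_le_sigmaMax (p := p)
  apply pow_le_one₀ (div_nonneg h0.le (h0.le.trans h1))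
  rw [div_le_one (h0.trans_le h1)]
  exact h1

/-! ### Cylinders -/

/-- The spatial part of `z₀⁻¹ ∘ z`. -/
def relPos (B : Matrix (Idx p) (Idx p) ℝ) (z₀ z : Pt p) : Space p :=
  z.1 - Matrix.toEuclideanCLM (n := Idx p) (𝕜 := ℝ) (expE B (z.2 - z₀.2)) z₀.1

theorem continuous_toEuclideanCLM_expE (B : Matrix (Idx p) (Idx p) ℝ) (x : Space p) :
    Continuous fun s => Matrix.toEuclideanCLM (n := Idx p) (𝕜 := ℝ) (expE B s) x := by
  have h : Continuous fun s => (WithLp.toLp 2 (expE B s *ᵥ x.ofLp) : Space p) :=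
    (PiLp.continuous_toLp 2 _).comp ((continuous_expE B).matrix_mulVec continuous_const)
  exact h

theorem continuous_relPos (B : Matrix (Idx p) (Idx p) ℝ) (z₀ : Pt p) :
    Continuous (relPos B z₀) :=
  continuous_fst.sub ((continuous_toEuclideanCLM_expE B z₀.1).comp
    (continuous_snd.sub continuous_const))

theorem comp_relPos (B : Matrix (Idx p) (Idx p) ℝ) (z₀ z : Pt p) :
    comp B z₀ (relPos B z₀ z, z.2 - z₀.2) = z := by
  simp [comp, relPos]

theorem relPos_comp (B : Matrix (Idx p) (Idx p) ℝ) (z₀ ζ : Pt p) :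
    relPos B z₀ (comp B z₀ ζ) = ζ.1 ∧ (comp B z₀ ζ).2 - z₀.2 = ζ.2 := by
  simp [comp, relPos]

theorem mem_cyl {B : Matrix (Idx p) (Idx p) ℝ} {r t₁ t₂ : ℝ} {z₀ z : Pt p} :
    z ∈ cyl B r t₁ t₂ z₀ ↔ normB (relPos B z₀ z) < r ∧ z.2 - z₀.2 ∈ Ioo t₁ t₂ := by
  constructor
  · rintro ⟨ζ, ⟨h1, h2⟩, rfl⟩
    obtain ⟨h3, h4⟩ := relPos_comp B z₀ ζ
    rw [h3, h4]
    exact ⟨h1, h2⟩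
  · rintro ⟨h1, h2⟩
    exact ⟨(relPos B z₀ z, z.2 - z₀.2), ⟨h1, h2⟩, comp_relPos B z₀ z⟩

theorem isOpen_cyl (B : Matrix (Idx p) (Idx p) ℝ) (r t₁ t₂ : ℝ) (z₀ : Pt p) :
    IsOpen (cyl B r t₁ t₂ z₀) := by
  have : cyl B r t₁ t₂ z₀ = {z | normB (relPos B z₀ z) < r} ∩
      (fun z : Pt p => z.2 - z₀.2) ⁻¹' Ioo t₁ t₂ := by
    ext z
    exact mem_cyl
  rw [this]
  exact (isOpen_lt (continuous_normB.comp (continuous_relPos B z₀)) continuous_const).inter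
    (isOpen_Ioo.preimage (by fun_prop))

theorem continuous_comp (B : Matrix (Idx p) (Idx p) ℝ) (z₀ : Pt p) : Continuous (comp B z₀) :=
  (continuous_fst.add ((continuous_toEuclideanCLM_expE B z₀.1).comp continuous_snd)).prodMk
    (continuous_const.add continuous_snd)

theorem isCompact_closure_of_subset_cyl {B : Matrix (Idx p) (Idx p) ℝ} {r t₁ t₂ : ℝ}
    {z₀ : Pt p} {D : Set (Pt p)} (hD : D ⊆ cyl B r t₁ t₂ z₀) :
    IsCompact (closure D) ∧ ∀ z ∈ closure D,
      normB (relPos B z₀ z) ≤ r ∧ z.2 - z₀.2 ∈ Icc t₁ t₂ := by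
  have hK : IsCompact (comp B z₀ '' ({x : Space p | normB x ≤ r} ×ˢ Icc t₁ t₂)) :=
    ((isCompact_normB_le r).prod isCompact_Icc).image (continuous_comp B z₀)
  have hsub : closure D ⊆ comp B z₀ '' ({x : Space p | normB x ≤ r} ×ˢ Icc t₁ t₂) := by
    refine closure_minimal (hD.trans (image_mono (prod_mono ?_ Ioo_subset_Icc_self))) hK.isClosed
    exact fun x (hx : normB x < r) => hx.le
  refine ⟨hK.of_isClosed_subset isClosed_closure hsub, fun z hz => ?_⟩
  obtain ⟨ζ, ⟨h1, h2⟩, rfl⟩ := hsub hz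
  obtain ⟨h3, h4⟩ := relPos_comp B z₀ ζ
  rw [h3, h4]
  exact ⟨h1, h2⟩

/-- Each time slice is a translate of the homogeneous ball, so Fubini suffices. -/
theorem volume_cyl (B : Matrix (Idx p) (Idx p) ℝ) (r t₁ t₂ : ℝ) (z₀ : Pt p) :
    volume (cyl B r t₁ t₂ z₀)
      = volume {x : Space p | normB x < r} * ENNReal.ofReal (t₂ - t₁) := by
  rw [Measure.volume_eq_prod, Measure.prod_apply_symm (isOpen_cyl B r t₁ t₂ z₀).measurableSet]
  have h : ∀ τ : ℝ, volume ((fun x : Space p => (x, τ)) ⁻¹' cyl B r t₁ t₂ z₀)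
      = (Ioo (z₀.2 + t₁) (z₀.2 + t₂)).indicator
        (fun _ => volume {x : Space p | normB x < r}) τ := by
    intro τ
    by_cases hτ : τ ∈ Ioo (z₀.2 + t₁) (z₀.2 + t₂)
    · rw [indicator_of_mem hτ]
      have : (fun x : Space p => (x, τ)) ⁻¹' cyl B r t₁ t₂ z₀
          = (fun x => x - Matrix.toEuclideanCLM (n := Idx p) (𝕜 := ℝ) (expE B (τ - z₀.2)) z₀.1) ⁻¹'
            {x : Space p | normB x < r} := by
        ext x
        simp only [mem_preimage, mem_cyl, relPos]
        constructor
        · exact fun h => h.1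
        · exact fun h => ⟨h, by constructor <;> linarith [hτ.1, hτ.2]⟩
      rw [this]
      simp only [sub_eq_add_neg]
      exact measure_preimage_add_right _ _ _
    · rw [indicator_of_notMem hτ]
      have : (fun x : Space p => (x, τ)) ⁻¹' cyl B r t₁ t₂ z₀ = ∅ := by
        ext x
        simp only [mem_preimage, mem_cyl, mem_empty_iff_false, iff_false]
        rintro ⟨-, h1, h2⟩
        exact hτ ⟨by linarith, by linarith⟩
      rw [this, measure_empty]
  simp only [h]
  rw [lintegral_indicator measurableSet_Ioo, setLIntegral_const, Real.volume_Ioo]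
  congr 2
  ring

theorem volume_normB_lt_mul {r : ℝ} (hr : 0 < r) (ρ : ℝ) :
    volume {x : Space p | normB x < ρ * r}
      = ENNReal.ofReal (r ^ homDim p) * volume {x : Space p | normB x < ρ} := by
  set T : Matrix (Idx p) (Idx p) ℝ := Matrix.diagonal fun k => r ^ (2 * (k.1 : ℕ) + 1) with hT
  have hdet : LinearMap.det (Matrix.toEuclideanLin T : Space p →ₗ[ℝ] Space p) = r ^ homDim p := by
    rw [det_toEuclideanLin, hT, Matrix.det_diagonal, prod_pow_weight]
  have hTx : ∀ x : Space p, (Matrix.toEuclideanLin T x : Space p)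
      = WithLp.toLp 2 (dil r x.ofLp) := by
    intro x
    ext k
    change (T *ᵥ x.ofLp) k = _
    simp [hT, Matrix.mulVec_diagonal, dil]
  have himg : (Matrix.toEuclideanLin T : Space p →ₗ[ℝ] Space p) '' {x : Space p | normB x < ρ}
      = {x : Space p | normB x < ρ * r} := by
    ext x
    constructor
    · rintro ⟨y, hy, rfl⟩
      have hy' : normB y < ρ := hy
      change normB _ < _
      rw [hTx, normB_dil hr.le, mul_comm]
      exact mul_lt_mul_of_pos_right hy' hr
    · intro hx
      have hx' : normB x < ρ * r := hx
      refine ⟨WithLp.toLp 2 (dil r⁻¹ x.ofLp), ?_, ?_⟩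
      · change normB _ < _
        rw [normB_dil (inv_nonneg.mpr hr.le), inv_mul_lt_iff₀ hr, mul_comm]
        exact hx'
      · rw [hTx]
        change (WithLp.toLp 2 (dil r (dil r⁻¹ x.ofLp)) : Space p) = x
        rw [dil_dil_inv hr.ne']
  rw [← himg, Measure.addHaar_image_linearMap, hdet, abs_of_pos (by positivity)]

theorem volume_normB_lt_ne_top (ρ : ℝ) : volume {x : Space p | normB x < ρ} ≠ ⊤ := by
  refine ne_top_of_le_ne_top (isCompact_normB_le ρ).measure_lt_top.ne (measure_mono ?_)
  exact fun x (hx : normB x < ρ) => hx.le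

theorem volume_real_normB_lt_pos {ρ : ℝ} (hρ : 0 < ρ) :
    0 < volume.real {x : Space p | normB x < ρ} := by
  apply ENNReal.toReal_pos _ (volume_normB_lt_ne_top ρ)
  apply ((isOpen_lt continuous_normB continuous_const).measure_pos volume ⟨0, ?_⟩).ne'
  change normB (0 : Space p) < ρ
  rw [normB_zero]
  exact hρ

theorem volume_cyl_ne_top (B : Matrix (Idx p) (Idx p) ℝ) (r t₁ t₂ : ℝ) (z₀ : Pt p) :
    volume (cyl B r t₁ t₂ z₀) ≠ ⊤ := by
  rw [volume_cyl]
  exact ENNReal.mul_ne_top (volume_normB_lt_ne_top r) ENNReal.ofReal_ne_top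

theorem volume_real_cyl3 (B : Matrix (Idx p) (Idx p) ℝ) {b r : ℝ} (hb : 0 < b) (hr : 0 < r)
    (z₀ : Pt p) :
    volume.real (cyl3 B b r z₀)
      = volume.real {x : Space p | normB x < sigmaMin p} * (b / 2) * r ^ (homDim p + 2) := by
  rw [cyl3, measureReal_def, volume_cyl, volume_normB_lt_mul hr, ENNReal.toReal_mul,
    ENNReal.toReal_mul, ENNReal.toReal_ofReal (by positivity),
    ENNReal.toReal_ofReal (by nlinarith [mul_pos hb (pow_pos hr 2)]), measureReal_def]
  ring

/-! ### The kernel in the cylinders -/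

theorem poleKer_nonneg (B M : Matrix (Idx p) (Idx p) ℝ) (c a : ℝ) (z ζ : Pt p) :
    0 ≤ poleKer B M c a z ζ := heatKer_nonneg _ _ _ _ _

theorem poleKer_eq_zero (B M : Matrix (Idx p) (Idx p) ℝ) (c a : ℝ) {z ζ : Pt p}
    (h : z.2 ≤ ζ.2) : poleKer B M c a z ζ = 0 :=
  if_neg (not_lt.mpr (sub_nonpos.mpr h))

/-- The position of `z` relative to `z₀` in units of `r`. -/
def scaledPos (B : Matrix (Idx p) (Idx p) ℝ) (r : ℝ) (z₀ z : Pt p) : Idx p → ℝ :=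
  dil r⁻¹ (relPos B z₀ z).ofLp

theorem normB_scaledPos (B : Matrix (Idx p) (Idx p) ℝ) {r : ℝ} (hr : 0 < r) (z₀ z : Pt p) :
    normB (WithLp.toLp 2 (scaledPos B r z₀ z) : Space p) = normB (relPos B z₀ z) / r := by
  rw [scaledPos, normB_dil (inv_nonneg.mpr hr.le), inv_mul_eq_div]

/-- The group law moves `z₀` to the origin and the dilation brings `r` to `1`; all later bounds are
taken at unit scale. -/
theorem poleKer_eq_scaled {B : Matrix (Idx p) (Idx p) ℝ} (hB : IsDrift B)
    (M : Matrix (Idx p) (Idx p) ℝ) (c a : ℝ) {r : ℝ} (hr : 0 < r) (z₀ z ζ : Pt p) :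
    poleKer B M c a z ζ = (r ^ 2) ^ (-a) * heatKer M c a
      (scaledPos B r z₀ z - expE B ((z.2 - ζ.2) / r ^ 2) *ᵥ scaledPos B r z₀ ζ)
      ((z.2 - ζ.2) / r ^ 2) := by
  have hσ : r ^ 2 * ((z.2 - ζ.2) / r ^ 2) = z.2 - ζ.2 := by field_simp
  rw [← heatKer_dil M c a hr, dil_sub, ← expE_mulVec_dil hB hr.ne', hσ, scaledPos, scaledPos,
    dil_dil_inv hr.ne', dil_dil_inv hr.ne', poleKer]
  congr 1
  simp only [relPos, WithLp.ofLp_sub, Matrix.ofLp_toEuclideanCLM, Matrix.mulVec_sub,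
    Matrix.mulVec_mulVec, ← expE_add, sub_add_sub_cancel]
  abel

theorem norm_toEuclideanCLM_expE_le {B : Matrix (Idx p) (Idx p) ℝ} {b : ℝ}
    (hb : IsTimeScale B b) {σ : ℝ} (hσ : |σ| ≤ b) (x : Space p) :
    ‖Matrix.toEuclideanCLM (n := Idx p) (𝕜 := ℝ) (expE B σ) x‖ ≤ 2 * ‖x‖ :=
  (ContinuousLinearMap.le_opNorm _ x).trans
    (mul_le_mul_of_nonneg_right (hb.exp_le σ hσ) (norm_nonneg x))

theorem toLp_sub_expE (B : Matrix (Idx p) (Idx p) ℝ) (σ : ℝ) (v w : Idx p → ℝ) :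
    (WithLp.toLp 2 (v - expE B σ *ᵥ w) : Space p) = WithLp.toLp 2 v -
      Matrix.toEuclideanCLM (n := Idx p) (𝕜 := ℝ) (expE B σ) (WithLp.toLp 2 w) := by
  rw [Matrix.toEuclideanCLM_toLp, WithLp.toLp_sub]

/-- At unit scale the time lag between the two cylinders lies in `[b/4, b]`, away from zero. The
factor `9 = 3²` comes from `‖X - EΞ‖ ≤ ‖X‖ + 2‖Ξ‖`. -/
theorem le_poleKer {B M : Matrix (Idx p) (Idx p) ℝ} (hB : IsDrift B) (hp : ∀ i, 1 ≤ p i)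
    {b : ℝ} (hb : IsTimeScale B b) {c a μ : ℝ} (hc : 0 ≤ c) (ha : 0 ≤ a) (hμ : 0 ≤ μ)
    (hM : ∀ v : Idx p → ℝ, v ⬝ᵥ M *ᵥ v ≤ μ * (v ⬝ᵥ v)) {r : ℝ} (hr : 0 < r) {z₀ z ζ : Pt p}
    (hz : z ∈ cyl2 B b r z₀) (hζ : ζ ∈ cyl3 B b r z₀) :
    (r ^ 2) ^ (-a) * Real.exp (-(c * (μ * (9 * radSq n (sigmaMin p) / (b / 4) ^ (2 * n + 1)))))
      ≤ poleKer B M c a z ζ := by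
  rw [cyl2, mem_cyl] at hz
  rw [cyl3, mem_cyl] at hζ
  obtain ⟨hz1, hz2, hz3⟩ := hz
  obtain ⟨hζ1, hζ2, hζ3⟩ := hζ
  have hr2 : 0 < r ^ 2 := by positivity
  have hb0 := hb.pos
  rw [poleKer_eq_scaled hB M c a hr z₀]
  refine mul_le_mul_of_nonneg_left ?_ (by positivity)
  have hσ1 : b / 4 ≤ (z.2 - ζ.2) / r ^ 2 := by
    rw [le_div_iff₀ hr2]
    linarith
  have hσ2 : (z.2 - ζ.2) / r ^ 2 ≤ b := by
    rw [div_le_iff₀ hr2]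
    linarith
  refine le_heatKer hc ha hμ hM ?_ (by positivity) hσ1 (hσ2.trans (hb.le_one hp))
  rw [dotProduct_self_eq_norm_sq, toLp_sub_expE]
  set X : Space p := WithLp.toLp 2 (scaledPos B r z₀ z)
  set Ξ : Space p := WithLp.toLp 2 (scaledPos B r z₀ ζ)
  have hX : ‖X‖ ^ 2 ≤ radSq n (sigmaMin p) := norm_sq_le_radSq (by
    rw [normB_scaledPos B hr, div_le_iff₀ hr]
    exact hz1.le)
  have hΞ : ‖Ξ‖ ^ 2 ≤ radSq n (sigmaMin p) := norm_sq_le_radSq (by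
    rw [normB_scaledPos B hr, div_le_iff₀ hr]
    exact hζ1.le)
  have hE := norm_toEuclideanCLM_expE_le hb (σ := (z.2 - ζ.2) / r ^ 2)
    (by rw [abs_of_nonneg (by linarith)]; exact hσ2) Ξ
  have h1 := norm_sub_le X
    (Matrix.toEuclideanCLM (n := Idx p) (𝕜 := ℝ) (expE B ((z.2 - ζ.2) / r ^ 2)) Ξ)
  have hX' := Real.le_sqrt_of_sq_le hX
  have hΞ' := Real.le_sqrt_of_sq_le hΞ
  calc _ ≤ (3 * √(radSq n (sigmaMin p))) ^ 2 :=
        pow_le_pow_left₀ (norm_nonneg _) (by linarith) 2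
    _ = _ := by
        rw [mul_pow, Real.sq_sqrt (radSq_nonneg _ _)]
        norm_num

/-- The homogeneous norm of a lateral point is `K` at unit scale, so its Euclidean norm exceeds `1 +
ρ + 2√radSq`. Subtracting the transported pole, of norm at most `2√radSq`, leaves distance at least
`ρ`, and `heatKer_le` applies even for small time lags. -/
theorem poleKer_lateral_le {B M : Matrix (Idx p) (Idx p) ℝ} (hB : IsDrift B)
    (hp : ∀ i, 1 ≤ p i) {b : ℝ} (hb : IsTimeScale B b) {c a μ : ℝ} (hc : 0 < c) (hμ : 0 < μ)
    (hM : ∀ v : Idx p → ℝ, μ * (v ⬝ᵥ v) ≤ v ⬝ᵥ M *ᵥ v) {k : ℕ} (hk : a ≤ k) {ρ K r : ℝ}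
    (hρ : 0 < ρ) (hK : ((n : ℝ) + 1) * (1 + ρ + 2 * √(radSq n (sigmaMin p))) < K)
    (hr : 0 < r) {z₀ z ζ : Pt p} (hz : normB (relPos B z₀ z) = K * r) (hzt : z.2 ≤ z₀.2)
    (hζ : ζ ∈ cyl3 B b r z₀) :
    poleKer B M c a z ζ ≤ (r ^ 2) ^ (-a) * (k.factorial / (c * μ * ρ ^ 2) ^ k) := by
  rcases le_or_gt z.2 ζ.2 with hle | hlt
  · rw [poleKer_eq_zero B M c a hle]
    positivity
  rw [cyl3, mem_cyl] at hζ
  obtain ⟨hζ1, hζ2, hζ3⟩ := hζ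
  have hr2 : 0 < r ^ 2 := by positivity
  have hσ0 : 0 < (z.2 - ζ.2) / r ^ 2 := div_pos (sub_pos.mpr hlt) hr2
  have hσ2 : (z.2 - ζ.2) / r ^ 2 ≤ b := by
    rw [div_le_iff₀ hr2]
    linarith
  have hσ1 := hσ2.trans (hb.le_one hp)
  rw [poleKer_eq_scaled hB M c a hr z₀]
  refine mul_le_mul_of_nonneg_left ?_ (by positivity)
  set X : Space p := WithLp.toLp 2 (scaledPos B r z₀ z) with hXdef
  set Ξ : Space p := WithLp.toLp 2 (scaledPos B r z₀ ζ) with hΞdef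
  set Y := scaledPos B r z₀ z - expE B ((z.2 - ζ.2) / r ^ 2) *ᵥ scaledPos B r z₀ ζ with hY
  have hΞ : ‖Ξ‖ ^ 2 ≤ radSq n (sigmaMin p) := norm_sq_le_radSq (by
    rw [normB_scaledPos B hr, div_le_iff₀ hr]
    exact hζ1.le)
  have hΞ' := Real.le_sqrt_of_sq_le hΞ
  have hXK : normB X = K := by
    rw [hXdef, normB_scaledPos B hr, hz]
    field_simp
  have hX : 1 + ρ + 2 * √(radSq n (sigmaMin p)) < ‖X‖ := by
    have h1 := normB_le_mul_max X
    rw [hXK] at h1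
    have h2 := lt_of_mul_lt_mul_left (hK.trans_le h1) (by positivity)
    rcases lt_max_iff.mp h2 with h3 | h3
    · have := Real.sqrt_nonneg (radSq n (sigmaMin p))
      linarith
    · exact h3
  have hE := norm_toEuclideanCLM_expE_le hb (σ := (z.2 - ζ.2) / r ^ 2)
    (by rw [abs_of_pos hσ0]; exact hσ2) Ξ
  have h1 := norm_sub_norm_le X
    (Matrix.toEuclideanCLM (n := Idx p) (𝕜 := ℝ) (expE B ((z.2 - ζ.2) / r ^ 2)) Ξ)
  have hYY : ρ ^ 2 ≤ Y ⬝ᵥ Y := by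
    rw [dotProduct_self_eq_norm_sq, hY, toLp_sub_expE]
    exact pow_le_pow_left₀ hρ.le (by linarith) 2
  have hY0 : 0 < Y ⬝ᵥ Y := lt_of_lt_of_le (by positivity) hYY
  calc heatKer M c a Y ((z.2 - ζ.2) / r ^ 2)
      ≤ k.factorial / (c * μ * (Y ⬝ᵥ Y)) ^ k * ((z.2 - ζ.2) / r ^ 2) ^ ((k : ℝ) - a) :=
        heatKer_le hc hμ hM k hY0 hσ0 hσ1
    _ ≤ k.factorial / (c * μ * (Y ⬝ᵥ Y)) ^ k * 1 := by
        gcongr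
        exact Real.rpow_le_one hσ0.le hσ1 (by linarith)
    _ ≤ _ := by
        rw [mul_one]
        gcongr

/-- An explicit radius at which the lateral bound drops below a given level. -/
theorem exists_radius {c μ e : ℝ} (hc : 0 < c) (hμ : 0 < μ) (he : 0 < e) {k : ℕ} (hk : k ≠ 0) :
    ∃ ρ : ℝ, 0 < ρ ∧ k.factorial / (c * μ * ρ ^ 2) ^ k ≤ e := by
  -- Having `w ≥ 1` gives `w ≤ w ^ k`, which avoids a `k`-th root.
  set w : ℝ := 1 + k.factorial / e with hw
  have hw1 : 1 ≤ w := le_add_of_nonneg_right (by positivity)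
  have hw0 : 0 < w := by positivity
  refine ⟨√(w / (c * μ)), Real.sqrt_pos.mpr (by positivity), ?_⟩
  rw [Real.sq_sqrt (by positivity), mul_div_cancel₀ _ (by positivity), div_le_iff₀ (by positivity)]
  have h1 : w ≤ w ^ k := le_self_pow₀ hw1 hk
  calc (k.factorial : ℝ) = e * (k.factorial / e) := by field_simp
    _ ≤ e * w := by gcongr; rw [hw]; linarith
    _ ≤ e * w ^ k := by gcongr

/-! ### Riemann sums -/

/-- Induction on the cover: each centre takes the mass of the part of its ball not removed earlier,
where `g z` differs from its value at the centre by at most `θ`. -/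
theorem exists_weights_of_subset_iUnion_ball {α β : Type*} [PseudoMetricSpace β]
    [MeasurableSpace β] [OpensMeasurableSpace β] [DecidableEq β] {ν : Measure β} {g : α → β → ℝ}
    {S : Set α} {H : Set β} {ρ θ : ℝ} (hν : ν H ≠ ⊤) (hint : ∀ z ∈ S, IntegrableOn (g z) H ν)
    (hosc : ∀ z ∈ S, ∀ ζ ∈ H, ∀ ζ' ∈ H, dist ζ' ζ < ρ → g z ζ ≤ g z ζ' + θ) (t : Finset β)
    (ht : ∀ ζ ∈ t, ζ ∈ H) :
    ∀ E : Set β, MeasurableSet E → E ⊆ H → E ⊆ ⋃ ζ ∈ t, Metric.ball ζ ρ →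
      ∃ m : β → ℝ, (∀ ζ, 0 ≤ m ζ) ∧ ∑ ζ ∈ t, m ζ = ν.real E ∧
        ∀ z ∈ S, ∑ ζ ∈ t, m ζ * g z ζ ≤ ∫ ζ in E, g z ζ ∂ν + θ * ν.real E := by
  induction t using Finset.induction_on with
  | empty =>
    intro E _ _ hE
    have : E = ∅ := by simpa using hE
    exact ⟨0, fun _ => le_rfl, by simp [this], fun z _ => by simp [this]⟩
  | insert ζ t hζ ih =>
    intro E hEm hEH hE
    have hζH : ζ ∈ H := ht ζ (Finset.mem_insert_self _ _)
    obtain ⟨m, hm0, hmsum, hm⟩ := ih (fun η hη => ht η (Finset.mem_insert_of_mem hη))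
      (E \ Metric.ball ζ ρ) (hEm.diff measurableSet_ball) (sdiff_subset.trans hEH) (by
        rintro η ⟨hη, hηn⟩
        have := hE hη
        simp only [Finset.mem_insert, iUnion_iUnion_eq_or_left, mem_union] at this
        exact this.resolve_left hηn)
    have hfin : ∀ F : Set β, F ⊆ H → ν F ≠ ⊤ := fun F hF =>
      ne_top_of_le_ne_top hν (measure_mono hF)
    have hsub1 : E ∩ Metric.ball ζ ρ ⊆ H := inter_subset_left.trans hEH
    have hne : ∀ η ∈ t, η ≠ ζ := fun η hη h => hζ (h ▸ hη)
    refine ⟨fun η => if η = ζ then ν.real (E ∩ Metric.ball ζ ρ) else m η, ?_, ?_, ?_⟩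
    · intro η
      dsimp only
      split_ifs
      · exact measureReal_nonneg
      · exact hm0 η
    · rw [Finset.sum_insert hζ, if_pos rfl,
        Finset.sum_congr rfl (fun η hη => if_neg (hne η hη)), hmsum]
      exact measureReal_inter_add_sdiff measurableSet_ball (hfin E hEH)
    · intro z hz
      dsimp only
      rw [Finset.sum_insert hζ, if_pos rfl,
        Finset.sum_congr rfl (fun η hη => by rw [if_neg (hne η hη)])]
      have h1 := hm z hz
      have h2 : ν.real (E ∩ Metric.ball ζ ρ) * g z ζ
          ≤ ∫ η in E ∩ Metric.ball ζ ρ, g z η ∂ν + θ * ν.real (E ∩ Metric.ball ζ ρ) := by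
        have hconst : ∀ x : ℝ, IntegrableOn (fun _ : β => x) (E ∩ Metric.ball ζ ρ) ν :=
          fun x => integrableOn_const (hfin _ hsub1)
        have hg := (hint z hz).mono_set hsub1
        have h3 : ∫ _ in E ∩ Metric.ball ζ ρ, g z ζ ∂ν
            ≤ ∫ η in E ∩ Metric.ball ζ ρ, (g z η + θ) ∂ν := by
          refine setIntegral_mono_on (hconst _) (hg.add (hconst θ))
            (hEm.inter measurableSet_ball) fun η hη => ?_
          exact hosc z hz ζ hζH η (hsub1 hη) hη.2
        rw [integral_add hg (hconst θ), setIntegral_const, setIntegral_const, smul_eq_mul,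
          smul_eq_mul] at h3
        linarith
      have h4 := integral_inter_add_sdiff (μ := ν) (f := g z) (s := E)
        (measurableSet_ball (x := ζ) (ε := ρ)) ((hint z hz).mono_set hEH)
      have h5 := measureReal_inter_add_sdiff (μ := ν) (s := E)
        (measurableSet_ball (x := ζ) (ε := ρ)) (hfin E hEH)
      rw [← h4, ← h5]
      linarith

theorem exists_riemann_sum {α β : Type*} [PseudoMetricSpace α] [MetricSpace β]
    [MeasurableSpace β] [BorelSpace β] {ν : Measure β} [IsFiniteMeasureOnCompacts ν]
    {g : α → β → ℝ} {S : Set α} {H : Set β} (hS : IsCompact S) (hH : IsCompact H)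
    (hg : ContinuousOn (Function.uncurry g) (S ×ˢ H)) {θ : ℝ} (hθ : 0 < θ) :
    ∃ (t : Finset β) (m : β → ℝ), (∀ ζ ∈ t, ζ ∈ H) ∧ (∀ ζ, 0 ≤ m ζ) ∧
      ∑ ζ ∈ t, m ζ = ν.real H ∧ ∀ z ∈ S, ∑ ζ ∈ t, m ζ * g z ζ ≤ ∫ ζ in H, g z ζ ∂ν + θ := by
  classical
  have huc := (hS.prod hH).uniformContinuousOn_of_continuous hg
  -- The total error is `θ'` times the mass of `H`; adding `1` covers null `H`.
  set θ' := θ / (ν.real H + 1) with hθ'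
  have hνH : 0 ≤ ν.real H := measureReal_nonneg
  have hθ'0 : 0 < θ' := by positivity
  obtain ⟨ρ, hρ, huc⟩ := Metric.uniformContinuousOn_iff.mp huc θ' hθ'0
  obtain ⟨T, hTH, hTfin, hcov⟩ := hH.finite_cover_balls hρ
  have hosc : ∀ z ∈ S, ∀ ζ ∈ H, ∀ ζ' ∈ H, dist ζ' ζ < ρ → g z ζ ≤ g z ζ' + θ' := by
    intro z hz ζ hζ ζ' hζ' hd
    have h := huc (z, ζ') ⟨hz, hζ'⟩ (z, ζ) ⟨hz, hζ⟩ (by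
      rw [Prod.dist_eq, dist_self]
      exact max_lt hρ hd)
    rw [Real.dist_eq] at h
    have := (abs_lt.mp h).1
    simp only [Function.uncurry] at this
    linarith
  have hint : ∀ z ∈ S, IntegrableOn (g z) H ν := fun z hz =>
    ContinuousOn.integrableOn_compact hH
      (hg.comp (f := fun ζ => (z, ζ)) (Continuous.prodMk_right z).continuousOn
        fun ζ hζ => ⟨hz, hζ⟩)
  obtain ⟨m, hm0, hmsum, hm⟩ := exists_weights_of_subset_iUnion_ball hH.measure_lt_top.ne hint hosc
    hTfin.toFinset (fun ζ hζ => hTH (hTfin.mem_toFinset.mp hζ)) H hH.measurableSet subset_rfl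
    (by simpa using hcov)
  refine ⟨hTfin.toFinset, m, fun ζ hζ => hTH (hTfin.mem_toFinset.mp hζ), hm0, hmsum,
    fun z hz => (hm z hz).trans ?_⟩
  have : θ' * ν.real H ≤ θ := by
    rw [hθ', div_mul_eq_mul_div, div_le_iff₀ (by positivity)]
    nlinarith
  linarith

/-! ### Comparison with finitely many poles -/

/-- Maximum principle on `{u ≥ ε}`, which contains no pole. The cutoff `z.2 ≤ t₁` lets the later
application avoid the top of the cylinder, where no boundary values are prescribed. -/
theorem comparison_finite_poles {B M : Matrix (Idx p) (Idx p) ℝ} (hMs : Mᵀ = M)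
    {c a μ : ℝ} (hc : 0 < c) (hμ : 0 < μ)
    (hM : ∀ v : Idx p → ℝ, μ * (v ⬝ᵥ v) ≤ v ⬝ᵥ M *ᵥ v)
    {A : Pt p → Matrix (Idx p) (Idx p) ℝ} {D : Set (Pt p)} {u : Pt p → ℝ} (hD : IsOpen D)
    (hDc : IsCompact (closure D)) (hu : ContDiffOn ℝ 2 u D) (huc : ContinuousOn u (closure D))
    (hA : ∀ z ∈ D, (A z).PosSemidef) (hLu : ∀ z ∈ D, 0 ≤ opL B A u z)
    (poles : Finset (Pt p)) {m : Pt p → ℝ} (hm : ∀ ζ, 0 ≤ m ζ)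
    (hLker : ∀ z ∈ D, ∀ ζ ∈ poles, ζ.2 < z.2 → 0 ≤ opL B A (fun w => poleKer B M c a w ζ) z)
    {t₁ ε N : ℝ} (hpoles : ∀ z ∈ closure D, ε ≤ u z → z ∉ poles)
    (hbd : ∀ z ∈ closure D, z.2 ≤ t₁ → ε ≤ u z → (z ∉ D ∨ u z ≤ ε) →
      u z + ∑ ζ ∈ poles, m ζ * poleKer B M c a z ζ ≤ N)
    {z₁ : Pt p} (hz₁ : z₁ ∈ closure D) (hz₁t : z₁.2 ≤ t₁) (hz₁u : ε ≤ u z₁) :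
    u z₁ + ∑ ζ ∈ poles, m ζ * poleKer B M c a z₁ ζ ≤ N := by
  by_contra! hcon
  set U : Pt p → ℝ := fun z => ∑ ζ ∈ poles, m ζ * poleKer B M c a z ζ with hU
  set S : Set (Pt p) := closure D ∩ u ⁻¹' Ici ε ∩ {z | z.2 ≤ t₁} with hS
  have hScl : IsClosed S :=
    (huc.preimage_isClosed_of_isClosed isClosed_closure isClosed_Ici).inter
      (isClosed_le continuous_snd continuous_const)
  have hSc : IsCompact S := hDc.of_isClosed_subset hScl fun z hz => hz.1.1
  have hz₁S : z₁ ∈ S := ⟨⟨hz₁, hz₁u⟩, hz₁t⟩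
  obtain ⟨zm, _, hzm⟩ := hDc.exists_isMinOn ⟨z₁, hz₁⟩ continuous_snd.continuousOn
  -- Adding `-δ t` makes the subsolution strict; this `δ` costs less than half of the assumed excess
  -- over `N`.
  set δ : ℝ := (u z₁ + U z₁ - N) / (2 * (z₁.2 - zm.2 + 1)) with hδ
  have hgap : 0 < z₁.2 - zm.2 + 1 := by
    have : zm.2 ≤ z₁.2 := hzm hz₁
    linarith
  have hδ0 : 0 < δ := div_pos (sub_pos.mpr hcon) (by positivity)
  have hUc : ContinuousOn U S := by
    refine continuousOn_finsetSum _ fun ζ hζ => ContinuousOn.mul continuousOn_const ?_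
    intro z hz
    have hne : z ≠ ζ := fun h => hpoles z hz.1.1 hz.1.2 (h ▸ hζ)
    exact (ContinuousAt.comp (f := fun z => (z, ζ))
      (g := fun w : Pt p × Pt p => poleKer B M c a w.1 w.2)
      (continuousAt_poleKer B hc hμ hM (w := (z, ζ)) hne)
      (Continuous.prodMk_left ζ).continuousAt).continuousWithinAt
  have hFc : ContinuousOn (fun z => u z + U z + (-δ) * z.2) S :=
    ((huc.mono fun z hz => hz.1.1).add hUc).add (by fun_prop)
  obtain ⟨zs, hzs, hmax⟩ := hSc.exists_isMaxOn ⟨z₁, hz₁S⟩ hFc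
  have hbig : N < u zs + U zs := by
    have h1 : u z₁ + U z₁ + (-δ) * z₁.2 ≤ u zs + U zs + (-δ) * zs.2 := hmax hz₁S
    have h2 : zm.2 ≤ zs.2 := hzm hzs.1.1
    have h3 : δ * (2 * (z₁.2 - zm.2 + 1)) = u z₁ + U z₁ - N := by
      rw [hδ]
      field_simp
    nlinarith
  have hzD : zs ∈ D ∧ ε < u zs := by
    by_contra hnot
    have : zs ∉ D ∨ u zs ≤ ε := by
      by_cases h : zs ∈ D
      · exact Or.inr (not_lt.mp fun h' => hnot ⟨h, h'⟩)
      · exact Or.inl h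
    exact absurd (hbd zs hzs.1.1 hzs.2 hzs.1.2 this) (not_le.mpr hbig)
  -- Poles at or after the time of `zs` contribute nothing at times up to `zs.2`, and the remaining
  -- kernels are smooth near `zs`. A backward maximum sees no difference.
  set act := poles.filter fun ζ => ζ.2 < zs.2 with hact
  have hUact : ∀ w : Pt p, w.2 ≤ zs.2 → U w = ∑ ζ ∈ act, m ζ * poleKer B M c a w ζ := by
    intro w hw
    rw [hU, hact, Finset.sum_filter]
    refine Finset.sum_congr rfl fun ζ _ => ?_
    split_ifs with h
    · rfl
    · rw [poleKer_eq_zero B M c a (hw.trans (not_lt.mp h)), mul_zero]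
  obtain ⟨hs1, hs2⟩ := sliceSmooth_and_opL_sum_nonneg B A (z := zs) act (fun ζ _ => hm ζ)
    (f := fun ζ w => poleKer B M c a w ζ)
    (fun ζ hζ => sliceSmooth_poleKer hMs c a (Finset.mem_filter.mp hζ).2)
    (fun ζ hζ => hLker zs hzD.1 ζ (Finset.mem_filter.mp hζ).1 (Finset.mem_filter.mp hζ).2)
  have hsu : SliceSmooth u zs := SliceSmooth.of_contDiffAt (hu.contDiffAt (hD.mem_nhds hzD.1))
  have hst := SliceSmooth.time_mul (-δ) zs
  have hle := opL_nonpos_of_backward_max B A (hA zs hzD.1) ((hsu.add hs1).add hst) (by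
    have hcu : ContinuousAt u zs := (hu.contDiffAt (hD.mem_nhds hzD.1)).continuousAt
    filter_upwards [hD.mem_nhds hzD.1, hcu.eventually (lt_mem_nhds hzD.2)] with w hwD hwu hwt
    have hwS : w ∈ S := ⟨⟨subset_closure hwD, le_of_lt hwu⟩, hwt.trans hzs.2⟩
    rw [← hUact w hwt, ← hUact zs le_rfl]
    exact hmax hwS)
  rw [opL_add B A (hsu.add hs1) hst, opL_add B A hsu hs1, opL_time_mul] at hle
  have := hLu zs hzD.1
  linarith

/-! ### The coefficient matrix -/

theorem quadratic_eq_topBlock {A : Matrix (Idx p) (Idx p) ℝ} (hA : TopSupported A)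
    (v : Idx p → ℝ) :
    v ⬝ᵥ A *ᵥ v = (fun a => v ⟨0, a⟩) ⬝ᵥ topBlock A *ᵥ fun a => v ⟨0, a⟩ := by
  simp only [dotProduct, Matrix.mulVec, topBlock, Matrix.submatrix_apply]
  rw [Fintype.sum_sigma, Finset.sum_eq_single 0]
  · refine Finset.sum_congr rfl fun a _ => ?_
    congr 1
    rw [Fintype.sum_sigma, Finset.sum_eq_single 0]
    · intro i _ hi
      exact Finset.sum_eq_zero fun e _ => by rw [hA _ _ (Or.inr hi), zero_mul]
    · simp
  · intro i _ hi
    refine Finset.sum_eq_zero fun e _ => ?_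
    rw [Finset.sum_eq_zero fun l _ => by rw [hA _ _ (Or.inl hi), zero_mul], mul_zero]
  · simp

theorem topProj_quadratic_eq (v : Idx p → ℝ) :
    v ⬝ᵥ topProj p *ᵥ v = (fun a => v ⟨0, a⟩) ⬝ᵥ fun a => v ⟨0, a⟩ := by
  rw [topProj_quadratic, Fintype.sum_sigma, Finset.sum_eq_single 0]
  · simp [dotProduct, sq]
  · intro i _ hi
    simp [hi]
  · simp

theorem topProj_quadratic_nonneg (v : Idx p → ℝ) : 0 ≤ v ⬝ᵥ topProj p *ᵥ v := by
  rw [topProj_quadratic]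
  exact Finset.sum_nonneg fun k _ => by split_ifs <;> positivity

theorem IsCoefficient.topSupported {Ω : Set (Pt p)} {lam Lam : ℝ}
    {A : Pt p → Matrix (Idx p) (Idx p) ℝ} (hA : IsCoefficient Ω lam Lam A) {z : Pt p}
    (hz : z ∈ Ω) : TopSupported (A z) := hA.zero_off z hz

theorem IsCoefficient.transpose {Ω : Set (Pt p)} {lam Lam : ℝ}
    {A : Pt p → Matrix (Idx p) (Idx p) ℝ} (hA : IsCoefficient Ω lam Lam A) {z : Pt p}
    (hz : z ∈ Ω) : (A z)ᵀ = A z := by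
  have h := (hA.lower z hz).1
  ext k l
  rw [Matrix.transpose_apply]
  by_cases hkl : k.1 ≠ 0 ∨ l.1 ≠ 0
  · rw [hA.zero_off z hz k l hkl, hA.zero_off z hz l k hkl.symm]
  · push Not at hkl
    obtain ⟨i, e⟩ := k
    obtain ⟨j, f⟩ := l
    obtain ⟨rfl, rfl⟩ : i = 0 ∧ j = 0 := hkl
    have h1 := h.apply e f
    simp only [topBlock, Matrix.sub_apply, Matrix.submatrix_apply, Matrix.smul_apply,
      Matrix.one_apply, star_trivial, eq_comm (a := f)] at h1
    linarith

theorem IsCoefficient.quadratic_bounds {Ω : Set (Pt p)} {lam Lam : ℝ}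
    {A : Pt p → Matrix (Idx p) (Idx p) ℝ} (hA : IsCoefficient Ω lam Lam A) {z : Pt p}
    (hz : z ∈ Ω) (v : Idx p → ℝ) :
    lam * (v ⬝ᵥ topProj p *ᵥ v) ≤ v ⬝ᵥ A z *ᵥ v ∧
      v ⬝ᵥ A z *ᵥ v ≤ Lam * (v ⬝ᵥ topProj p *ᵥ v) := by
  rw [quadratic_eq_topBlock (hA.topSupported hz), topProj_quadratic_eq]
  have h1 := (hA.lower z hz).dotProduct_mulVec_nonneg fun a => v ⟨0, a⟩
  have h2 := (hA.upper z hz).dotProduct_mulVec_nonneg fun a => v ⟨0, a⟩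
  simp only [star_trivial, Matrix.sub_mulVec, dotProduct_sub, Matrix.smul_mulVec,
    Matrix.one_mulVec, dotProduct_smul, smul_eq_mul] at h1 h2
  exact ⟨by linarith, by linarith⟩

theorem IsCoefficient.posSemidef {Ω : Set (Pt p)} {lam Lam : ℝ} (hlam : 0 < lam)
    {A : Pt p → Matrix (Idx p) (Idx p) ℝ} (hA : IsCoefficient Ω lam Lam A) {z : Pt p}
    (hz : z ∈ Ω) : (A z).PosSemidef := by
  refine Matrix.PosSemidef.of_dotProduct_mulVec_nonneg ?_ fun v => ?_
  · rw [Matrix.IsHermitian, Matrix.conjTranspose_eq_transpose_of_trivial]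
    exact hA.transpose hz
  · rw [star_trivial]
    exact (mul_nonneg hlam.le (topProj_quadratic_nonneg v)).trans (hA.quadratic_bounds hz v).1

theorem abs_quadratic_le_opNorm {m : ℕ} (T : Matrix (Fin m) (Fin m) ℝ) (v : Fin m → ℝ) :
    |v ⬝ᵥ T *ᵥ v| ≤ opNorm T * (v ⬝ᵥ v) := by
  set x : EuclideanSpace ℝ (Fin m) := WithLp.toLp 2 v with hx
  have h1 : v ⬝ᵥ T *ᵥ v = inner ℝ x (Matrix.toEuclideanCLM (n := Fin m) (𝕜 := ℝ) T x) := by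
    rw [EuclideanSpace.inner_eq_star_dotProduct, Matrix.ofLp_toEuclideanCLM, dotProduct_comm]
    simp [hx]
  have h2 : v ⬝ᵥ v = ‖x‖ ^ 2 := by
    rw [EuclideanSpace.norm_sq_eq]
    simp [dotProduct, sq, hx]
  rw [h1, h2]
  refine (abs_real_inner_le_norm _ _).trans ?_
  have h3 := (Matrix.toEuclideanCLM (n := Fin m) (𝕜 := ℝ) T).le_opNorm x
  calc ‖x‖ * ‖Matrix.toEuclideanCLM (n := Fin m) (𝕜 := ℝ) T x‖
      ≤ ‖x‖ * (‖Matrix.toEuclideanCLM (n := Fin m) (𝕜 := ℝ) T‖ * ‖x‖) := by gcongr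
    _ = _ := by rw [opNorm]; ring

/-- Ellipticity of `A z₀` turns absolute closeness into relative closeness of quadratic forms, the
form needed for the subsolution property. -/
theorem IsCoefficient.quadratic_close {Ω : Set (Pt p)} {lam Lam : ℝ}
    {A : Pt p → Matrix (Idx p) (Idx p) ℝ} (hA : IsCoefficient Ω lam Lam A) {z z₀ : Pt p}
    (hz : z ∈ Ω) (hz₀ : z₀ ∈ Ω) {κ : ℝ} (hκ : 0 ≤ κ)
    (h : opNorm (topBlock (A z) - topBlock (A z₀)) ≤ κ * lam) (v : Idx p → ℝ) :
    |v ⬝ᵥ A z *ᵥ v - v ⬝ᵥ A z₀ *ᵥ v| ≤ κ * (v ⬝ᵥ A z₀ *ᵥ v) := by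
  have h1 := (hA.quadratic_bounds hz₀ v).1
  have h2 : |v ⬝ᵥ A z *ᵥ v - v ⬝ᵥ A z₀ *ᵥ v| ≤ κ * lam * (v ⬝ᵥ topProj p *ᵥ v) := by
    rw [quadratic_eq_topBlock (hA.topSupported hz), quadratic_eq_topBlock (hA.topSupported hz₀),
      ← dotProduct_sub, ← Matrix.sub_mulVec]
    refine (abs_quadratic_le_opNorm _ _).trans ?_
    rw [← topProj_quadratic_eq]
    exact mul_le_mul_of_nonneg_right h (topProj_quadratic_nonneg v)
  calc _ ≤ κ * lam * (v ⬝ᵥ topProj p *ᵥ v) := h2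
    _ = κ * (lam * (v ⬝ᵥ topProj p *ᵥ v)) := by ring
    _ ≤ _ := by gcongr

theorem IsCoefficient.trace_mul_le {Ω : Set (Pt p)} {lam Lam : ℝ}
    {A : Pt p → Matrix (Idx p) (Idx p) ℝ} (hA : IsCoefficient Ω lam Lam A) {z z₀ : Pt p}
    (hz : z ∈ Ω) (hz₀ : z₀ ∈ Ω) {κ : ℝ}
    (h : ∀ v : Idx p → ℝ, |v ⬝ᵥ A z *ᵥ v - v ⬝ᵥ A z₀ *ᵥ v| ≤ κ * (v ⬝ᵥ A z₀ *ᵥ v))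
    {M : Matrix (Idx p) (Idx p) ℝ} (hM : ∀ v : Idx p → ℝ, 0 ≤ v ⬝ᵥ M *ᵥ v) :
    (A z * M).trace ≤ (1 + κ) * (A z₀ * M).trace := by
  have hps : ((1 + κ) • A z₀ - A z).PosSemidef := by
    refine Matrix.PosSemidef.of_dotProduct_mulVec_nonneg ?_ fun v => ?_
    · rw [Matrix.IsHermitian, Matrix.conjTranspose_eq_transpose_of_trivial, Matrix.transpose_sub,
        Matrix.transpose_smul, hA.transpose hz, hA.transpose hz₀]
    · have := (abs_le.mp (h v)).2
      simp only [star_trivial, Matrix.sub_mulVec, dotProduct_sub, Matrix.smul_mulVec,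
        dotProduct_smul, smul_eq_mul]
      linarith
  have := trace_mul_nonneg hps hM
  rw [Matrix.sub_mul, Matrix.trace_sub, Matrix.smul_mul, Matrix.trace_smul, smul_eq_mul] at this
  linarith

/-- The precision matrix of the frozen operator, with bounds depending only on the ellipticity
constants. -/
theorem exists_precision {B : Matrix (Idx p) (Idx p) ℝ} (hB : IsDrift B) {lam Lam : ℝ}
    (hlam : 0 < lam) (hLam : 0 < Lam) :
    ∃ μ₁ μ₂ : ℝ, 0 < μ₁ ∧ 0 < μ₂ ∧ ∀ (Ω : Set (Pt p)) (A : Pt p → Matrix (Idx p) (Idx p) ℝ),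
      IsCoefficient Ω lam Lam A → ∀ z₀ ∈ Ω, ∃ M : Matrix (Idx p) (Idx p) ℝ,
        IsPrecision B (A z₀) M ∧ ∀ v : Idx p → ℝ,
          μ₁ * (v ⬝ᵥ v) ≤ v ⬝ᵥ M *ᵥ v ∧ v ⬝ᵥ M *ᵥ v ≤ μ₂ * (v ⬝ᵥ v) := by
  obtain ⟨c, C, hc, hC, hcC⟩ := exists_quadratic_bounds
    (G := gram B (topProj p)) fun x hx => gram_topProj_pos hB hx
  have hα : 0 < lam * c := mul_pos hlam hc
  have hβ : 0 < Lam * C := mul_pos hLam hC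
  refine ⟨(Lam * C)⁻¹, (lam * c)⁻¹, inv_pos.mpr hβ, inv_pos.mpr hα, fun Ω A hA z₀ hz₀ => ?_⟩
  have hsymm : (gram B (A z₀))ᵀ = gram B (A z₀) := by
    rw [gram_transpose, hA.transpose hz₀]
  have hbd : ∀ x : Idx p → ℝ, lam * c * (x ⬝ᵥ x) ≤ x ⬝ᵥ gram B (A z₀) *ᵥ x ∧
      x ⬝ᵥ gram B (A z₀) *ᵥ x ≤ Lam * C * (x ⬝ᵥ x) := by
    intro x
    have h1 := gram_quadratic_mono B (A := topProj p) (A' := A z₀) (c := lam) (c' := 1)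
      (fun v => by rw [one_mul]; exact (hA.quadratic_bounds hz₀ v).1) x
    have h2 := gram_quadratic_mono B (A := A z₀) (A' := topProj p) (c := 1) (c' := Lam)
      (fun v => by rw [one_mul]; exact (hA.quadratic_bounds hz₀ v).2) x
    rw [one_mul] at h1 h2
    constructor
    · refine le_trans ?_ h1
      rw [mul_assoc]
      exact mul_le_mul_of_nonneg_left (hcC x).1 hlam.le
    · refine h2.trans ?_
      rw [mul_assoc]
      exact mul_le_mul_of_nonneg_left (hcC x).2 hLam.le
  obtain ⟨hdet, hinv⟩ := inv_quadratic_bounds hsymm hα hβ hbd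
  exact ⟨_, isPrecision_inv_gram hB (hA.topSupported hz₀) (hA.transpose hz₀) hdet, hinv⟩

/-! ### The growth estimate -/

theorem setIntegral_poleKer_le {B M : Matrix (Idx p) (Idx p) ℝ} {c a J : ℝ} (hJ : 0 ≤ J)
    (h : ∀ (x : Idx p → ℝ) (s : ℝ), 0 < s →
      ∫⁻ ξ : Space p, ENNReal.ofReal (heatKer M c a (x - expE B s *ᵥ ξ.ofLp) s)
        ≤ ENNReal.ofReal (J * s ^ (-(1 / 2) : ℝ))) {z : Pt p} {δ : ℝ} (hδ : 0 < δ)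
    {H : Set (Pt p)} (hH : MeasurableSet H) (hHt : ∀ ζ ∈ H, z.2 - δ < ζ.2) :
    ∫ ζ in H, poleKer B M c a z ζ ≤ J * (2 * √δ) := by
  have hmeas := measurable_poleKer B M c a z
  rw [integral_eq_lintegral_of_nonneg_ae (Eventually.of_forall fun ζ => poleKer_nonneg _ _ _ _ _ _)
    hmeas.aestronglyMeasurable]
  apply ENNReal.toReal_le_of_le_ofReal (by positivity)
  refine le_trans ?_ (lintegral_poleKer_le hJ h z hδ)
  rw [← lintegral_indicator hH, ← lintegral_indicator (MeasurableSet.univ.prod measurableSet_Ioo)]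
  refine lintegral_mono fun ζ => ?_
  by_cases hζ : ζ ∈ H
  · rw [indicator_of_mem hζ]
    by_cases ht : ζ.2 < z.2
    · rw [indicator_of_mem (show ζ ∈ (univ : Set (Space p)) ×ˢ Ioo (z.2 - δ) z.2 from
        ⟨mem_univ _, hHt ζ hζ, ht⟩)]
    · rw [poleKer_eq_zero B M c a (not_lt.mp ht)]
      simp
  · rw [indicator_of_notMem hζ]
    exact zero_le

/-- The comparison of `u + qU` with its boundary values. Since `U ≥ R e V` at `z₁` but only `U ≤ R
(e/2) V` on the lateral boundary, a surplus `q R (e/2) V` remains. -/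
theorem growth_of_isCompact {B M : Matrix (Idx p) (Idx p) ℝ} {b : ℝ} (hb : 0 < b)
    {c a μ J e : ℝ} (hc : 0 < c) (hμ : 0 < μ) (hMs : Mᵀ = M)
    (hM : ∀ v : Idx p → ℝ, μ * (v ⬝ᵥ v) ≤ v ⬝ᵥ M *ᵥ v) (hJ : 0 < J)
    (hJle : ∀ (x : Idx p → ℝ) (s : ℝ), 0 < s →
      ∫⁻ ξ : Space p, ENNReal.ofReal (heatKer M c a (x - expE B s *ᵥ ξ.ofLp) s)
        ≤ ENNReal.ofReal (J * s ^ (-(1 / 2) : ℝ)))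
    {K r : ℝ} (hr : 0 < r) (hK : sigmaMin p ≤ K) {z₀ : Pt p}
    {A : Pt p → Matrix (Idx p) (Idx p) ℝ} {D : Set (Pt p)} {u : Pt p → ℝ} (hD : IsOpen D)
    (hDsub : D ⊆ cyl1 B b K r z₀) (hu : ContDiffOn ℝ 2 u D) (huc : ContinuousOn u (closure D))
    (hbd : ∀ z ∈ frontier D ∩ cyl1 B b K r z₀, u z = 0)
    (hA : ∀ z ∈ D, (A z).PosSemidef) (hLu : ∀ z ∈ D, 0 ≤ opL B A u z)
    (hLker : ∀ z ∈ D, ∀ ζ : Pt p, ζ.2 < z.2 → 0 ≤ opL B A (fun w => poleKer B M c a w ζ) z)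
    (he : 0 ≤ e)
    (hlow : ∀ z ∈ cyl2 B b r z₀, ∀ ζ ∈ cyl3 B b r z₀, (r ^ 2) ^ (-a) * e ≤ poleKer B M c a z ζ)
    (hlat : ∀ z : Pt p, normB (relPos B z₀ z) = K * r → z.2 ≤ z₀.2 → ∀ ζ ∈ cyl3 B b r z₀,
      poleKer B M c a z ζ ≤ (r ^ 2) ^ (-a) * (e / 2))
    {H : Set (Pt p)} (hH : IsCompact H) (hHsub : H ⊆ cyl3 B b r z₀ \ D)
    {z₁ : Pt p} (hz₁ : z₁ ∈ D ∩ cyl2 B b r z₀) (hz₁u : 0 < u z₁) :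
    u z₁ ≤ sSup (u '' D)
      * (1 - e / (8 * J * √b) * ((r ^ 2) ^ (-a) / r) * volume.real H) := by
  obtain ⟨hDc, hDcl⟩ := isCompact_closure_of_subset_cyl hDsub
  set Mx := sSup (u '' D) with hMx
  have hbdd : BddAbove (u '' D) :=
    (hDc.image_of_continuousOn huc).bddAbove.mono (image_mono subset_closure)
  have huMx : ∀ z ∈ closure D, u z ≤ Mx := by
    intro z hz
    have h1 := huc.image_closure (mem_image_of_mem u hz)
    exact closure_minimal (fun y hy => le_csSup hbdd hy) isClosed_Iic h1
  have hMx0 : 0 ≤ Mx := hz₁u.le.trans (huMx _ (subset_closure hz₁.1))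
  have hHm : MeasurableSet H := hH.measurableSet
  have hH3 : ∀ ζ ∈ H, ζ ∈ cyl3 B b r z₀ := fun ζ hζ => (hHsub hζ).1
  have hH1 : ∀ ζ ∈ H, ζ ∈ cyl1 B b K r z₀ := by
    intro ζ hζ
    obtain ⟨h1, h2, h3⟩ := mem_cyl.mp (hH3 ζ hζ)
    refine mem_cyl.mpr ⟨h1.trans_le (by gcongr), h2, h3.trans ?_⟩
    have : 0 < b * r ^ 2 := by positivity
    linarith
  set C₂ := J * (2 * √(b * r ^ 2)) with hC₂
  have hC₂0 : 0 < C₂ := by positivity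
  set R := (r ^ 2) ^ (-a) with hR
  have hR0 : 0 < R := by positivity
  -- The Riemann sums are at most `2 C₂`, one `C₂` from the integral and one from the discretization
  -- error, so this is the largest `q` for which they guarantee `qU ≤ Mx`.
  set q := Mx / (2 * C₂) with hq
  have hq0 : 0 ≤ q := by positivity
  set V := volume.real H with hV
  have hV0 : 0 ≤ V := measureReal_nonneg
  have hz₁t : z₁.2 < z₀.2 := by
    have := (mem_cyl.mp hz₁.2).2.2
    linarith
  have key : ∀ ε, 0 < ε → ε ≤ u z₁ → u z₁ + q * (R * e * V) ≤ Mx + ε + q * (R * (e / 2) * V) := by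
    intro ε hε hεu
    set S : Set (Pt p) := closure D ∩ u ⁻¹' Ici ε with hS
    have hSc : IsCompact S := hDc.of_isClosed_subset
      (huc.preimage_isClosed_of_isClosed isClosed_closure isClosed_Ici) fun z hz => hz.1
    -- A point of `H` in `closure D` is a frontier point inside `𝒬¹`, where `u = 0 < ε`.
    have hdisj : ∀ z ∈ S, z ∉ H := by
      intro z hz hzH
      have hzf : z ∈ frontier D := by
        rw [hD.frontier_eq]
        exact ⟨hz.1, (hHsub hzH).2⟩
      have h0 := hbd z ⟨hzf, hH1 z hzH⟩
      have h1 : ε ≤ u z := hz.2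
      linarith
    have hgc : ContinuousOn (Function.uncurry (poleKer B M c a)) (S ×ˢ H) := by
      rintro ⟨z, ζ⟩ ⟨hz, hζ⟩
      have hne : z ≠ ζ := fun h => hdisj z hz (h ▸ hζ)
      exact (continuousAt_poleKer B hc hμ hM (w := (z, ζ)) hne).continuousWithinAt
    obtain ⟨poles, m, hpH, hm0, hmsum, hmle⟩ :=
      exists_riemann_sum (ν := volume) hSc hH hgc hC₂0
    have hUle : ∀ z ∈ S, ∑ ζ ∈ poles, m ζ * poleKer B M c a z ζ ≤ 2 * C₂ := by
      intro z hz
      have h1 := setIntegral_poleKer_le hJ.le hJle (z := z) (δ := b * r ^ 2) (by positivity) hHm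
        (by
          intro ζ hζ
          have h2 := (hDcl z hz.1).2.2
          have h3 := (mem_cyl.mp (hH3 ζ hζ)).2.1
          linarith)
      have h2 := hmle z hz
      linarith
    have hsumle : ∀ z (x : ℝ), (∀ ζ ∈ poles, poleKer B M c a z ζ ≤ x) →
        ∑ ζ ∈ poles, m ζ * poleKer B M c a z ζ ≤ x * V := by
      intro z x hx
      rw [hV, ← hmsum, Finset.mul_sum]
      refine Finset.sum_le_sum fun ζ hζ => ?_
      rw [mul_comm]
      exact mul_le_mul_of_nonneg_right (hx ζ hζ) (hm0 ζ)
    have hpull : ∀ z, ∑ ζ ∈ poles, (q * m ζ) * poleKer B M c a z ζ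
        = q * ∑ ζ ∈ poles, m ζ * poleKer B M c a z ζ := fun z => by
      rw [Finset.mul_sum]
      exact Finset.sum_congr rfl fun ζ _ => by ring
    have hqe : 0 ≤ q * (R * (e / 2) * V) := by positivity
    have hcomp := comparison_finite_poles (N := Mx + ε + q * (R * (e / 2) * V)) (ε := ε)
      (t₁ := z₁.2) (m := fun ζ => q * m ζ) hMs hc hμ hM hD hDc hu huc hA hLu poles
      (fun ζ => mul_nonneg hq0 (hm0 ζ)) (fun z hz ζ _ => hLker z hz ζ)
      (fun z hz hzε hzp => hdisj z ⟨hz, hzε⟩ (hpH z hzp)) (by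
        intro z hz hzt hzε hor
        rw [hpull]
        by_cases hsmall : u z ≤ ε
        · have h1 : q * ∑ ζ ∈ poles, m ζ * poleKer B M c a z ζ ≤ Mx := by
            calc _ ≤ q * (2 * C₂) := mul_le_mul_of_nonneg_left (hUle z ⟨hz, hzε⟩) hq0
              _ = Mx := by rw [hq]; field_simp
          linarith
        · have hzD : z ∉ D := hor.resolve_right hsmall
          have hzf : z ∈ frontier D := by
            rw [hD.frontier_eq]
            exact ⟨hz, hzD⟩
          have hz1 : z ∉ cyl1 B b K r z₀ := fun h => by
            have := hbd z ⟨hzf, h⟩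
            linarith
          obtain ⟨hn, htl, -⟩ := hDcl z hz
          have hu1 := huMx z hz
          by_cases hlatz : normB (relPos B z₀ z) = K * r
          · have h1 := hsumle z (R * (e / 2)) fun ζ hζ =>
              hlat z hlatz (hzt.trans hz₁t.le) ζ (hH3 ζ (hpH ζ hζ))
            have h2 := mul_le_mul_of_nonneg_left h1 hq0
            linarith
          -- Neither lateral nor inside `𝒬¹`: the point is at the bottom, earlier than every pole.
          · have htb : z.2 - z₀.2 ≤ -(b * r ^ 2) := by
              by_contra! hlt
              exact hz1 (mem_cyl.mpr ⟨lt_of_le_of_ne hn hlatz, hlt, by linarith⟩)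
            have h1 := hsumle z 0 fun ζ hζ => by
              rw [poleKer_eq_zero]
              have := (mem_cyl.mp (hH3 ζ (hpH ζ hζ))).2.1
              linarith
            have h2 := mul_le_mul_of_nonneg_left h1 hq0
            linarith) (subset_closure hz₁.1) le_rfl hεu
    rw [hpull] at hcomp
    have hlow₁ : R * e * V ≤ ∑ ζ ∈ poles, m ζ * poleKer B M c a z₁ ζ := by
      rw [hV, ← hmsum, Finset.mul_sum]
      refine Finset.sum_le_sum fun ζ hζ => ?_
      rw [mul_comm]
      exact mul_le_mul_of_nonneg_left (hlow z₁ hz₁.2 ζ (hH3 ζ (hpH ζ hζ))) (hm0 ζ)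
    have := mul_le_mul_of_nonneg_left hlow₁ hq0
    linarith
  -- The poles depend on `ε` but the estimate does not, so `ε → 0` is allowed.
  have hfin : u z₁ + q * (R * e * V) ≤ Mx + q * (R * (e / 2) * V) := by
    refine le_of_forall_pos_le_add fun ε hε => ?_
    have h1 := key (min ε (u z₁)) (lt_min hε hz₁u) (min_le_right _ _)
    have h2 := min_le_left ε (u z₁)
    linarith
  have hC₂' : C₂ = 2 * J * √b * r := by
    rw [hC₂, Real.sqrt_mul hb.le, Real.sqrt_sq hr.le]
    ring
  have hsb : 0 < √b := Real.sqrt_pos.mpr hb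
  have hqv : q * (R * (e / 2) * V) * 2 = Mx * (e / (8 * J * √b) * (R / r) * V) * 2 := by
    rw [hq, hC₂']
    field_simp
    ring
  linarith

theorem exists_isScale {Q : ℕ} (hQ : 0 < Q) {lam : ℝ} (hlam : 0 < lam) {ω : ℝ → ℝ}
    (hω : IsModulus ω) : ∃ ε₀ : ℝ, IsScale Q lam ω ε₀ := by
  have hQ' : (0 : ℝ) < Q := by exact_mod_cast hQ
  have hpos : 0 < (1 / (Q : ℝ)) / (2 + 1 / (Q : ℝ)) * lam := by positivity
  have h1 := hω.tendsto.eventually (gt_mem_nhds hpos)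
  have h2 : ∀ᶠ s in 𝓝[>] (0 : ℝ), s < 1 := nhdsWithin_le_nhds (gt_mem_nhds one_pos)
  obtain ⟨s, ⟨hs1, hs2⟩, hs0⟩ := ((h1.and h2).and self_mem_nhdsWithin).exists
  exact ⟨s, hs0, hs2, hs1.le⟩

theorem homDim_pos (hp : ∀ i, 1 ≤ p i) : 0 < homDim p :=
  lt_of_lt_of_le (by have := hp 0; simp; omega) (Finset.single_le_sum
    (f := fun i : Fin (n + 1) => (2 * (i : ℕ) + 1) * p i) (fun _ _ => Nat.zero_le _)
    (Finset.mem_univ 0))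

/-- Passing from compact subsets to the whole set. -/
theorem le_of_forall_compact_subset {H : Set (Pt p)} (hH : MeasurableSet H)
    (hHfin : volume H ≠ ⊤) {x y c : ℝ} (hc : 0 < c) (hxy : x ≤ y)
    (h : ∀ H' ⊆ H, IsCompact H' → x + c * volume.real H' ≤ y) :
    x + c * volume.real H ≤ y := by
  by_contra! hcon
  have h0 : 0 ≤ (y - x) / c := div_nonneg (sub_nonneg.mpr hxy) hc.le
  have h1 : ENNReal.ofReal ((y - x) / c) < volume H := by
    rw [ENNReal.ofReal_lt_iff_lt_toReal h0 hHfin, div_lt_iff₀ hc]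
    rw [measureReal_def] at hcon
    linarith
  obtain ⟨H', hsub, hcomp, hlt⟩ := hH.exists_lt_isCompact_of_ne_top hHfin h1
  rw [ENNReal.ofReal_lt_iff_lt_toReal h0 hcomp.measure_lt_top.ne, div_lt_iff₀ hc] at hlt
  have h2 := h H' hsub hcomp
  rw [measureReal_def] at h2
  linarith

/-- The conditions `K r ≤ ε₀` and `b r² ≤ ε₀²` place `𝒬¹` inside the cylinder on which the modulus
is evaluated at `ε₀`. -/
theorem HasModulus.opNorm_le {B : Matrix (Idx p) (Idx p) ℝ} {Ω : Set (Pt p)}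
    {A : Pt p → Matrix (Idx p) (Idx p) ℝ} {ω : ℝ → ℝ} (hω : HasModulus B Ω A ω)
    {b K r ε₀ : ℝ} (hb : b ≤ 1) (hK : 1 ≤ K) (hr : 0 < r) (hrε : r ≤ ε₀ / K)
    (hε0 : 0 < ε₀) (hε : ε₀ < 1) {z₀ z : Pt p} (hz₀ : z₀ ∈ Ω) (hzΩ : z ∈ Ω)
    (hz : z ∈ cyl1 B b K r z₀) : opNorm (topBlock (A z) - topBlock (A z₀)) ≤ ω ε₀ := by
  have hK0 : 0 < K := one_pos.trans_le hK
  have hKr : K * r ≤ ε₀ := by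
    rw [le_div_iff₀ hK0] at hrε
    linarith
  have hrε' : r ≤ ε₀ := le_trans (by nlinarith) hKr
  have hbr : b * r ^ 2 ≤ ε₀ ^ 2 := by
    have h1 : r ^ 2 ≤ ε₀ ^ 2 := pow_le_pow_left₀ hr.le hrε' 2
    have h2 : 0 < r ^ 2 := by positivity
    nlinarith
  obtain ⟨h1, h2, h3⟩ := mem_cyl.mp hz
  refine hω ε₀ hε0 hε z₀ hz₀ z ⟨hzΩ, mem_cyl.mpr ⟨h1.trans_le hKr, by linarith, h3.trans ?_⟩⟩
  positivity

end Kolmogorov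

end

open Kolmogorov Matrix

/-! ### Choice of constants and assembly. -/

theorem theorem5p2 (n : ℕ) (hn : 1 ≤ n) (p : Fin (n + 1) → ℕ) (hp : ∀ i, 1 ≤ p i)
    (hp_anti : Antitone p)
    (B : Matrix (Kolmogorov.Idx p) (Kolmogorov.Idx p) ℝ) (hB : Kolmogorov.IsDrift B)
    (lam Lam : ℝ) (hlam : 0 < lam) (hLam : 0 < Lam)
    (b : ℝ) (hb : Kolmogorov.IsTimeScale B b) :
    ∃ K₀ : ℝ, 1 ≤ K₀ ∧ Kolmogorov.sigmaMin p < K₀ ∧ ∀ K : ℝ, K₀ < K →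
      ∃ η : ℝ, 0 < η ∧ ∀ ω : ℝ → ℝ, Kolmogorov.IsModulus ω →
        (∃ ε₀ : ℝ, Kolmogorov.IsScale (Kolmogorov.homDim p) lam ω ε₀) ∧
        ∀ ε₀ : ℝ, Kolmogorov.IsScale (Kolmogorov.homDim p) lam ω ε₀ →
        ∀ (Ω : Set (Kolmogorov.Pt p))
          (A : Kolmogorov.Pt p → Matrix (Kolmogorov.Idx p) (Kolmogorov.Idx p) ℝ),
          IsOpen Ω → Kolmogorov.IsCoefficient Ω lam Lam A → Kolmogorov.HasModulus B Ω A ω →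
        ∀ z₀ ∈ Ω, ∀ r : ℝ, 0 < r → r ≤ ε₀ / K →
          Kolmogorov.cyl1 B b K r z₀ ⊆ Ω →
        ∀ (D : Set (Kolmogorov.Pt p)) (u : Kolmogorov.Pt p → ℝ),
          IsOpen D → D ⊆ Kolmogorov.cyl1 B b K r z₀ →
          (D ∩ Kolmogorov.cyl2 B b r z₀).Nonempty →
          ContDiffOn ℝ 2 u D → ContinuousOn u (closure D) →
          (∀ z ∈ D, 0 ≤ u z) →
          (∀ z ∈ frontier D ∩ Kolmogorov.cyl1 B b K r z₀, u z = 0) →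
          (∀ z ∈ D, 0 ≤ Kolmogorov.opL B A u z) →
          (1 + η * (volume.real (Kolmogorov.cyl3 B b r z₀ \ D)
                / volume.real (Kolmogorov.cyl3 B b r z₀)))
              * sSup (u '' (D ∩ Kolmogorov.cyl2 B b r z₀))
            ≤ sSup (u '' D) := by
  have hQ : 0 < homDim p := homDim_pos hp
  set Q : ℝ := (homDim p : ℝ) with hQdef
  have hQ0 : 0 < Q := Nat.cast_pos.mpr hQ
  set a : ℝ := (Q + 1) / 2 with ha
  have ha0 : 0 < a := by positivity
  set κ : ℝ := (1 / Q) / (2 + 1 / Q) with hκ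
  have hκ0 : 0 < κ := by positivity
  set c : ℝ := (1 + 1 / Q / 2) / 4 with hc
  have hc0 : 0 < c := by positivity
  -- The exact balances for the subsolution property: closeness gives `A z ≥ (1 - κ) A z₀` and `tr(A
  -- z M) ≤ (1 + κ) Q`. They determine `c` and `a`.
  have hcκ : 4 * c * (1 - κ) = 1 := by
    rw [hc, hκ]
    field_simp
    ring
  have hcκ' : 2 * c * ((1 + κ) * Q) = a := by
    rw [hc, hκ, ha]
    field_simp
    ring
  obtain ⟨μ₁, μ₂, hμ₁, hμ₂, hprec⟩ := exists_precision hB hlam hLam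
  obtain ⟨J, hJ, hJle⟩ := exists_lintegral_heatKer_le hB hc0 hμ₁
  have hb0 := hb.pos
  have hb1 := hb.le_one hp
  set e : ℝ := Real.exp (-(c * (μ₂ * (9 * radSq n (sigmaMin p) / (b / 4) ^ (2 * n + 1))))) with he
  have he0 : 0 < e := Real.exp_pos _
  -- The power `k = Q + 1` is an integer above `a = (Q+1)/2`; the level `e / 2` is half of the lower
  -- bound on `𝒬²`.
  obtain ⟨ρ, hρ, hρe⟩ := exists_radius hc0 hμ₁ (half_pos he0) (Nat.succ_ne_zero (homDim p))
  have hak : a ≤ (homDim p).succ := by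
    push_cast
    rw [ha]
    linarith
  set v₀ := volume.real {x : Space p | normB x < sigmaMin p} with hv₀
  have hσ := sigmaMin_pos hp
  have hv₀0 : 0 < v₀ := volume_real_normB_lt_pos hσ
  set K₁ : ℝ := ((n : ℝ) + 1) * (1 + ρ + 2 * √(radSq n (sigmaMin p))) with hK₁
  refine ⟨max (max 1 (sigmaMin p + 1)) K₁, (le_max_left _ _).trans (le_max_left _ _),
    lt_of_lt_of_le (lt_add_one _) ((le_max_right _ _).trans (le_max_left _ _)), fun K hK => ?_⟩
  have hK1 : 1 ≤ K := ((le_max_left _ _).trans (le_max_left _ _)).trans hK.le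
  have hKσ : sigmaMin p ≤ K :=
    (lt_add_one _).le.trans (((le_max_right _ _).trans (le_max_left _ _)).trans hK.le)
  have hKK₁ : K₁ < K := (le_max_right _ _).trans_lt hK
  have hsb : 0 < √b := Real.sqrt_pos.mpr hb0
  refine ⟨e / (8 * J * √b) * (v₀ * (b / 2)), by positivity, fun ω hω =>
    ⟨exists_isScale hQ hlam hω, ?_⟩⟩
  intro ε₀ hε₀ Ω A _ hA hmod z₀ hz₀ r hr hrε hsub D u hD hDsub hne hu huc hu0 hbd hLu
  obtain ⟨M, hMp, hMb⟩ := hprec Ω A hA z₀ hz₀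
  have hDΩ : ∀ z ∈ D, z ∈ Ω := fun z hz => hsub (hDsub hz)
  have hLker : ∀ z ∈ D, ∀ ζ : Pt p, ζ.2 < z.2 →
      0 ≤ opL B A (fun w => poleKer B M c a w ζ) z := by
    intro z hz ζ hζ
    have hop := (hmod.opNorm_le hb1 hK1 hr hrε hε₀.pos hε₀.lt_one hz₀ (hDΩ z hz)
      (hDsub hz)).trans hε₀.le
    have hclose := hA.quadratic_close (hDΩ z hz) hz₀ hκ0.le hop
    refine opL_poleKer_nonneg hB hMp hc0.le hζ (hA.topSupported (hDΩ z hz)) (fun v => ?_) ?_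
    · have h1 := (abs_le.mp (hclose v)).1
      calc _ = 4 * c * ((1 - κ) * (v ⬝ᵥ A z₀ *ᵥ v)) := by rw [← mul_assoc, hcκ, one_mul]
        _ ≤ _ := mul_le_mul_of_nonneg_left (by linarith) (by positivity)
    · have h1 := hA.trace_mul_le (hDΩ z hz) hz₀ hclose (M := M) (fun v => by
        refine le_trans (mul_nonneg hμ₁.le ?_) (hMb v).1
        rw [dotProduct_self_eq_norm_sq]
        positivity)
      rw [hMp.trace] at h1
      calc _ ≤ 2 * c * ((1 + κ) * Q) := mul_le_mul_of_nonneg_left h1 (by positivity)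
        _ = a := hcκ'
  have hlow : ∀ z ∈ cyl2 B b r z₀, ∀ ζ ∈ cyl3 B b r z₀,
      (r ^ 2) ^ (-a) * e ≤ poleKer B M c a z ζ := fun z hz ζ hζ =>
    le_poleKer hB hp hb hc0.le ha0.le hμ₂.le (fun v => (hMb v).2) hr hz hζ
  have hlat : ∀ z : Pt p, normB (relPos B z₀ z) = K * r → z.2 ≤ z₀.2 → ∀ ζ ∈ cyl3 B b r z₀,
      poleKer B M c a z ζ ≤ (r ^ 2) ^ (-a) * (e / 2) := fun z hz hzt ζ hζ =>
    (poleKer_lateral_le hB hp hb hc0 hμ₁ (fun v => (hMb v).1) hak hρ hKK₁ hr hz hzt hζ).trans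
      (mul_le_mul_of_nonneg_left hρe (by positivity))
  -- Here `r^{-2a} = r^{-(Q+1)}`, and the further `1/r` comes from `C₂`. The total `r^{-(Q+2)}`
  -- matches `|𝒬³|`, so `η` does not depend on `r`.
  have hpow : (r ^ 2) ^ (-a) / r = (r ^ (homDim p + 2))⁻¹ := by
    have h1 : (r ^ 2) ^ (-a) = (r ^ (homDim p + 1))⁻¹ := by
      rw [Real.rpow_neg (by positivity), ← Real.rpow_natCast r 2, ← Real.rpow_mul hr.le,
        ← Real.rpow_natCast r (homDim p + 1)]
      congr 2
      rw [ha]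
      push_cast
      ring
    rw [h1]
    field_simp
    ring
  set V := volume.real (cyl3 B b r z₀) with hV
  have hVeq : V = v₀ * (b / 2) * r ^ (homDim p + 2) := volume_real_cyl3 B hb0 hr z₀
  have hV0 : 0 < V := by
    rw [hVeq]
    positivity
  set η : ℝ := e / (8 * J * √b) * (v₀ * (b / 2)) with hη
  have hη0 : 0 < η := by positivity
  have hηV : e / (8 * J * √b) * ((r ^ 2) ^ (-a) / r) = η / V := by
    rw [hpow, hη, hVeq]
    field_simp
  have hbdd : BddAbove (u '' D) :=
    ((isCompact_closure_of_subset_cyl hDsub).1.image_of_continuousOn huc).bddAbove.mono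
      (image_mono subset_closure)
  set Mx := sSup (u '' D) with hMx
  have hpt : ∀ z₁ ∈ D ∩ cyl2 B b r z₀,
      (1 + η * (volume.real (cyl3 B b r z₀ \ D) / V)) * u z₁ ≤ Mx := by
    intro z₁ hz₁
    have hle : u z₁ ≤ Mx := le_csSup hbdd (mem_image_of_mem u hz₁.1)
    rcases (hu0 z₁ hz₁.1).eq_or_lt with h0 | hpos
    · rw [← h0] at hle ⊢
      simpa using hle
    have hlim := le_of_forall_compact_subset (H := cyl3 B b r z₀ \ D) (x := u z₁) (y := Mx)
      (c := u z₁ * (η / V)) ((isOpen_cyl _ _ _ _ _).measurableSet.diff hD.measurableSet)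
      (ne_top_of_le_ne_top (volume_cyl_ne_top B _ _ _ z₀) (measure_mono sdiff_subset))
      (by positivity) hle (by
        intro H' hH'sub hH'
        have h1 := growth_of_isCompact hb0 hc0 hμ₁ hMp.symm (fun v => (hMb v).1) hJ
          (hJle M fun v => (hMb v).1) hr hKσ hD hDsub hu huc hbd
          (fun z hz => hA.posSemidef hlam (hDΩ z hz)) hLu hLker he0.le hlow hlat hH' hH'sub hz₁ hpos
        rw [hηV] at h1
        have hy : 0 ≤ η / V * volume.real H' := mul_nonneg (by positivity) measureReal_nonneg
        set y := η / V * volume.real H' with hydef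
        have hMx0 : 0 ≤ Mx := hpos.le.trans hle
        -- The bound `u ≤ Mx (1 - y)` becomes `(1 + y) u ≤ Mx` because `(1 - y)(1 + y) ≤ 1`.
        calc u z₁ + u z₁ * (η / V) * volume.real H' = u z₁ * (1 + y) := by rw [hydef]; ring
          _ ≤ Mx * (1 - y) * (1 + y) := mul_le_mul_of_nonneg_right h1 (by positivity)
          _ = Mx - Mx * y ^ 2 := by ring
          _ ≤ Mx := sub_le_self _ (by positivity))
    refine le_of_eq_of_le ?_ hlim
    ring
  have hfac : 0 < 1 + η * (volume.real (cyl3 B b r z₀ \ D) / V) :=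
    add_pos_of_pos_of_nonneg one_pos
      (mul_nonneg hη0.le (div_nonneg measureReal_nonneg hV0.le))
  rw [mul_comm, ← le_div_iff₀ hfac]
  refine csSup_le (hne.image u) ?_
  rintro _ ⟨z₁, hz₁, rfl⟩
  rw [le_div_iff₀ hfac, mul_comm]
  exact hpt z₁ hz₁
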